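/- Let $\Sigma$ be a compact Riemann surface with (possibly empty) boundary, or more generally a compact oriented smooth surface with boundary. A \emph{bundle pair} $(E,L)\to(\Sigma,\partial\Sigma)$ is a smooth symplectic vector bundle $(E,\omega)$ over $\Sigma$ together with a smooth Lagrangian subbundle $L$ of $E|_{\partial\Sigma}$. A \emph{compatible complex structure} is a smooth $J\in\Gamma(\mathrm{End}(E))$ with $J^2=-\mathrm{id}$ such that $\omega(J\cdot,J\cdot)=\omega$ and $g_J=\omega(\cdot,J\cdot)$ is positive definite; it makes $E$ a complex vector bundle with Hermitian metric $g_J+\sqrt{-1}\,\omega$. An \emph{orthogonal connection} for $(E,L,J)$ is a smooth connection $\nabla$ of the complex vector bundle $(E,J)$ whose restriction to $\partial\Sigma$ is unitary (compatible with $g_J+\sqrt{-1}\,\omega$) and $L$-orthogonal, that is, its parallel transport along $\partial\Sigma$ preserves $L$. The Chern--Weil Maslov index of $(E,L)$ computed with $J$ and such a connection $\nabla$ is $$\mu_{CW}(E,L;J,\nabla)=\frac{\sqrt{-1}}{\pi}\int_\Sigma \mathrm{tr}_{\mathbb C}(F_\nabla),$$ where $F_\nabla\in\Omega^2(\Sigma,\mathrm{End}(E))$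 is the curvature of $\nabla$ and the complex trace is taken with respect to $J$. \textbf{Corollary.} The Maslov index $\mu_{CW}(E,L)$ of a bundle pair $(E,L)$ does not depend on the compatible complex structure: if $J_0$ and $J_1$ are compatible complex structures on $E$, and $\nabla_0$ and $\nabla_1$ are orthogonal connections for $(E,L,J_0)$ and $(E,L,J_1)$ respectively, then $$\frac{\sqrt{-1}}{\pi}\int_\Sigma \mathrm{tr}_{\mathbb C}(F_{\nabla_0})=\frac{\sqrt{-1}}{\pi}\int_\Sigma \mathrm{tr}_{\mathbb C}(F_{\nabla_1}).$$ -/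

import Mathlib

open Bundle Set
open scoped Manifold ContDiff Topology

noncomputable section

namespace ChernWeilMaslov

/-! ### Oriented surfaces with boundary and integration of two-forms

A surface with boundary is a manifold `M` modelled on the half-plane
`EuclideanHalfSpace 2 = {x ∈ ℝ² | 0 ≤ x 0}`, with model with corners `𝓡∂ 2`. -/

section Surface

variable (M : Type*) [TopologicalSpace M] [ChartedSpace (EuclideanHalfSpace 2) M]

/-- The atlas of the surface `M` is oriented: every change of coordinates between two charts of the
atlas has positive Jacobian determinant. Such an atlas is an orientation of `M`. The charts of a
Riemann surface with boundary form such an atlas. -/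
def IsOriented : Prop :=
  ∀ e ∈ atlas (EuclideanHalfSpace 2) M, ∀ e' ∈ atlas (EuclideanHalfSpace 2) M,
    ∀ p ∈ e.source ∩ e'.source,
      0 < (fderivWithin ℝ (e'.extend (𝓡∂ 2) ∘ (e.extend (𝓡∂ 2)).symm) (range (𝓡∂ 2))
        (e.extend (𝓡∂ 2) p)).det

variable {M}

/-- The tangent space of the boundary at a boundary point `x`. Mathlib represents tangent vectors
at `x` by their coordinates in the preferred chart at `x`, in which the boundary is the line where
the coordinate of index `0` vanishes. -/
def boundaryTangentSpace (x : M) : Submodule ℝ (TangentSpace (𝓡∂ 2) x) :=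
  LinearMap.ker (EuclideanSpace.proj (0 : Fin 2) : EuclideanSpace ℝ (Fin 2) →L[ℝ] ℝ).toLinearMap

/-- The coordinate vector field `∂ᵢ` of the preferred chart at `p`, at the point with coordinates
`z` in this chart. -/
def coordinateVector (p : M) (z : EuclideanSpace ℝ (Fin 2)) (i : Fin 2) :
    TangentSpace (𝓡∂ 2) ((extChartAt (𝓡∂ 2) p).symm z) :=
  mfderivWithin 𝓘(ℝ, EuclideanSpace ℝ (Fin 2)) (𝓡∂ 2) (extChartAt (𝓡∂ 2) p).symm
    (range (𝓡∂ 2)) z (EuclideanSpace.single i (1 : ℝ) : EuclideanSpace ℝ (Fin 2))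

variable (M) in
/-- A smooth partition of unity subordinate to the domains of the preferred charts. -/
def chartPartition [IsManifold (𝓡∂ 2) ∞ M] [T2Space M] [CompactSpace M] :
    SmoothPartitionOfUnity M (𝓡∂ 2) M univ :=
  (SmoothPartitionOfUnity.exists_isSubordinate_chartAt_source (𝓡∂ 2) M).choose

/-- The integral of a complex-valued two-form `η` over a compact oriented surface, computed in the
charts with a partition of unity: the sum over `p` of the integrals of `ρ_p η(∂₀, ∂₁)` over the
coordinate domain of the chart at `p` (all but finitely many of them vanish). -/
def surfaceIntegral [IsManifold (𝓡∂ 2) ∞ M] [T2Space M] [CompactSpace M]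
    (η : ∀ x : M, TangentSpace (𝓡∂ 2) x → TangentSpace (𝓡∂ 2) x → ℂ) : ℂ :=
  ∑ᶠ p : M, ∫ z in (extChartAt (𝓡∂ 2) p).target,
    ((chartPartition M p ((extChartAt (𝓡∂ 2) p).symm z) : ℝ) : ℂ) *
      η ((extChartAt (𝓡∂ 2) p).symm z) (coordinateVector p z 0) (coordinateVector p z 1)

end Surface

/-! ### Trace of a complex-linear endomorphism -/

section Trace

/-- The complex trace of an endomorphism `A` of a real vector space with complex structure `J`, for
`A` commuting with `J` (see `complexTrace_eq_trace`). -/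
def complexTrace {V : Type*} [AddCommGroup V] [Module ℝ V] (J A : V →ₗ[ℝ] V) : ℂ :=
  ((LinearMap.trace ℝ V A : ℂ) - Complex.I * (LinearMap.trace ℝ V (J ∘ₗ A) : ℂ)) / 2

/-- When `J` is multiplication by the imaginary unit of a complex vector space, `complexTrace` is
the trace of complex-linear endomorphisms. -/
theorem complexTrace_eq_trace {V : Type*} [AddCommGroup V] [Module ℝ V] [Module ℂ V]
    [IsScalarTower ℝ ℂ V] [FiniteDimensional ℂ V] (J : V →ₗ[ℝ] V)
    (hJ : ∀ v, J v = Complex.I • v) (A : V →ₗ[ℂ] V) :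
    complexTrace J (A.restrictScalars ℝ) = LinearMap.trace ℂ V A := by
  have key : ∀ B : V →ₗ[ℂ] V, LinearMap.trace ℝ V (B.restrictScalars ℝ)
      = 2 * (LinearMap.trace ℂ V B).re := by
    intro B
    let b := Module.finBasis ℂ V
    rw [LinearMap.trace_eq_matrix_trace ℂ b B,
      LinearMap.trace_eq_matrix_trace ℝ (Complex.basisOneI.smulTower b)]
    simp only [Matrix.trace, Matrix.diag, LinearMap.toMatrix_apply, Fintype.sum_prod_type,
      Fin.sum_univ_two, Module.Basis.smulTower_repr, Module.Basis.smulTower_apply,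
      Complex.coe_basisOneI_repr, Complex.coe_basisOneI, LinearMap.coe_restrictScalars,
      map_smul, Finsupp.smul_apply, Complex.re_sum]
    simp
    ring
  have hJA : J ∘ₗ A.restrictScalars ℝ = (Complex.I • A).restrictScalars ℝ := by
    ext v
    simp [hJ]
  rw [complexTrace, hJA, key, key, map_smul]
  apply Complex.ext <;> simp

end Trace

/-! ### Bundle pairs -/

section BundlePair

variable {M : Type*} [TopologicalSpace M] [ChartedSpace (EuclideanHalfSpace 2) M]
  [IsManifold (𝓡∂ 2) ∞ M]
  (F : Type*) [NormedAddCommGroup F] [NormedSpace ℝ F]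
  (E : M → Type*) [TopologicalSpace (TotalSpace F E)] [∀ x, AddCommGroup (E x)]
  [∀ x, Module ℝ (E x)] [∀ x, TopologicalSpace (E x)] [∀ x, IsTopologicalAddGroup (E x)]
  [∀ x, ContinuousSMul ℝ (E x)] [FiberBundle F E] [VectorBundle ℝ F E]

/-- A smooth symplectic structure `ω` on the real vector bundle `E`. -/
structure SymplecticStructure where
  form : ∀ x, E x →L[ℝ] E x →L[ℝ] ℝ
  contMDiff_form : ContMDiff (𝓡∂ 2) ((𝓡∂ 2).prod 𝓘(ℝ, F →L[ℝ] F →L[ℝ] ℝ)) ∞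
    (fun x ↦ TotalSpace.mk' (F →L[ℝ] F →L[ℝ] ℝ) x (form x))
  self_eq_zero : ∀ x v, form x v v = 0
  nondegenerate : ∀ x v, (∀ w, form x v w = 0) → v = 0

variable {F E}

/-- A smooth Lagrangian subbundle `L` of `E` over the boundary: each fibre is equal to its own
symplectic orthogonal, and near each boundary point `L` has a smooth frame. -/
structure LagrangianSubbundle (Ω : SymplecticStructure F E) where
  fiber : ∀ x : (𝓡∂ 2).boundary M, Submodule ℝ (E x)
  lagrangian : ∀ x v, v ∈ fiber x ↔ ∀ w ∈ fiber x, Ω.form x v w = 0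
  exists_frame : ∀ x : (𝓡∂ 2).boundary M, ∃ U ∈ 𝓝 (x : M), ∃ (k : ℕ) (s : Fin k → ∀ y, E y),
    (∀ i, ContMDiffOn (𝓡∂ 2) ((𝓡∂ 2).prod 𝓘(ℝ, F)) ∞ (fun y ↦ TotalSpace.mk' F y (s i y)) U) ∧
    ∀ y : (𝓡∂ 2).boundary M, (y : M) ∈ U →
      LinearIndependent ℝ (fun i ↦ s i y) ∧ Submodule.span ℝ (range fun i ↦ s i y) = fiber y

/-- A smooth complex structure `J` on `E` compatible with `ω`: `ω(Jv, Jw) = ω(v, w)` and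
`ω(v, Jv) > 0` for `v ≠ 0`. -/
structure CompatibleComplexStructure (Ω : SymplecticStructure F E) where
  J : ∀ x, E x →L[ℝ] E x
  contMDiff_J : ContMDiff (𝓡∂ 2) ((𝓡∂ 2).prod 𝓘(ℝ, F →L[ℝ] F)) ∞
    (fun x ↦ TotalSpace.mk' (F →L[ℝ] F) x (J x))
  sq_eq_neg : ∀ x v, J x (J x v) = -v
  form_map : ∀ x v w, Ω.form x (J x v) (J x w) = Ω.form x v w
  form_pos : ∀ x v, v ≠ 0 → 0 < Ω.form x v (J x v)

/-- The Hermitian inner product `g + i ω`, where `g(v, w) = ω(v, Jw)`. -/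
def CompatibleComplexStructure.hermitian {Ω : SymplecticStructure F E}
    (𝒥 : CompatibleComplexStructure Ω) (x : M) (v w : E x) : ℂ :=
  (Ω.form x v (𝒥.J x w) : ℂ) + Complex.I * (Ω.form x v w : ℂ)

end BundlePair

/-! ### Connections and curvature -/

section Connection

variable {M : Type*} [TopologicalSpace M] [ChartedSpace (EuclideanHalfSpace 2) M]
  [IsManifold (𝓡∂ 2) ∞ M]
  {F : Type*} [NormedAddCommGroup F] [NormedSpace ℝ F]
  {E : M → Type*} [TopologicalSpace (TotalSpace F E)] [∀ x, AddCommGroup (E x)]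
  [∀ x, Module ℝ (E x)] [∀ x, TopologicalSpace (E x)] [∀ x, IsTopologicalAddGroup (E x)]
  [∀ x, ContinuousSMul ℝ (E x)] [FiberBundle F E] [VectorBundle ℝ F E]
  [ContMDiffVectorBundle ∞ F E (𝓡∂ 2)]

/-- `∇_X ∇_Y s - ∇_Y ∇_X s - ∇_[X,Y] s` at the point `x`. -/
def curvatureAux (D : CovariantDerivative (𝓡∂ 2) F E) (X Y : ∀ y : M, TangentSpace (𝓡∂ 2) y)
    (s : ∀ y, E y) (x : M) : E x :=
  D (fun y ↦ D s y (Y y)) x (X x) - D (fun y ↦ D s y (X y)) x (Y x)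
    - D s x (VectorField.mlieBracket (𝓡∂ 2) X Y x)

variable (F) in
/-- Extension of a vector of the fibre at `x` to a section that is constant in the preferred local
trivialization at `x`, and `0` outside the domain of this trivialization. -/
def localExtension {x : M} : E x →ₗ[ℝ] ∀ y, E y :=
  LinearMap.pi fun y ↦ ((trivializationAt F E x).symmL ℝ y).toLinearMap ∘ₗ
    ((trivializationAt F E x).continuousLinearMapAt ℝ x).toLinearMap

theorem contMDiffOn_localExtension {x : M} (e : E x) :
    ∃ U ∈ 𝓝 x, ContMDiffOn (𝓡∂ 2) ((𝓡∂ 2).prod 𝓘(ℝ, F)) ∞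
      (fun y ↦ TotalSpace.mk' F y (localExtension F e y)) U := by
  have hx := FiberBundle.mem_baseSet_trivializationAt F E x
  obtain ⟨U, hU, hs⟩ := FiberBundle.exists_contMDiffOn_extend (𝓡∂ 2) F e (k := ∞)
  refine ⟨U ∩ (trivializationAt F E x).baseSet,
    Filter.inter_mem hU ((trivializationAt F E x).open_baseSet.mem_nhds hx),
    (hs.mono inter_subset_left).congr fun y hy ↦ ?_⟩
  congr 1
  simp [localExtension, FiberBundle.extend, hx, hy.2]

/-- A smooth connection maps a section and a vector field that are smooth near a point to a section
that is differentiable there. -/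
theorem mdifferentiableAt_connection [T2Space M]
    (D : CovariantDerivative (𝓡∂ 2) F E)
    (hD : CovariantDerivative.ContMDiffCovariantDerivative D ∞) {x : M}
    {s : ∀ y, E y} {X : ∀ y : M, TangentSpace (𝓡∂ 2) y} {U : Set M} (hU : U ∈ 𝓝 x)
    (hs : ContMDiffOn (𝓡∂ 2) ((𝓡∂ 2).prod 𝓘(ℝ, F)) ∞ (fun y ↦ TotalSpace.mk' F y (s y)) U)
    (hX : MDifferentiableAt (𝓡∂ 2) ((𝓡∂ 2).prod 𝓘(ℝ, EuclideanSpace ℝ (Fin 2)))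
      (fun y ↦ TotalSpace.mk' (EuclideanSpace ℝ (Fin 2)) y (X y)) x) :
    MDifferentiableAt (𝓡∂ 2) ((𝓡∂ 2).prod 𝓘(ℝ, F))
      (fun y ↦ TotalSpace.mk' F y (D s y (X y))) x := by
  obtain ⟨f, hf⟩ := (SmoothBumpFunction.nhds_basis_tsupport (I := 𝓡∂ 2) x).mem_iff.1
    (interior_mem_nhds.2 hU)
  have h1 := ContMDiffOn.smul_section_of_tsupport (V := E) (F := F) (s := s)
    f.contMDiff.contMDiffOn isOpen_interior hf.2 (hs.mono interior_subset)
  have h2 := hD.contMDiff.contMDiff (σ := (f : M → ℝ) • s) (by simpa using h1.contMDiffOn)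
  have h3 := (h2.contMDiffAt (x := x) Filter.univ_mem).mdifferentiableAt (by simp)
  have h4 := MDifferentiableAt.clm_bundle_apply h3 hX
  refine h4.congr_of_eventuallyEq ?_
  have hev : ∀ᶠ y in 𝓝 x, ∀ᶠ z in 𝓝 y, f z = 1 := f.eventuallyEq_one.eventually_nhds
  filter_upwards [hev, eventually_mem_nhds_iff.2 hU] with y hy hyU
  have hsy := (hs.contMDiffAt hyU).mdifferentiableAt (by simp)
  have : D s y = D ((f : M → ℝ) • s) y := by
    refine D.isCovariantDerivativeOnUniv.congr_of_eventuallyEq hsy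
      (h1.contMDiffAt.mdifferentiableAt (by simp)) Filter.univ_mem ?_
    filter_upwards [hy] with z hz
    simp [hz]
  rw [this]

/-- The curvature `F(u, v)` of a smooth connection at the point `x`, as an endomorphism of the
fibre. It is computed with the extensions of `u`, `v` and of fibre vectors that are constant in the
preferred local trivialization at `x`. -/
def curvature [T2Space M] (D : CovariantDerivative (𝓡∂ 2) F E)
    (hD : CovariantDerivative.ContMDiffCovariantDerivative D ∞)
    (x : M) (u v : TangentSpace (𝓡∂ 2) x) : E x →ₗ[ℝ] E x where
  toFun e := curvatureAux D (FiberBundle.extend (EuclideanSpace ℝ (Fin 2)) u)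
    (FiberBundle.extend (EuclideanSpace ℝ (Fin 2)) v) (localExtension F e) x
  map_add' e e' := by
    obtain ⟨U, hU, hs⟩ := contMDiffOn_localExtension (F := F) e
    obtain ⟨U', hU', hs'⟩ := contMDiffOn_localExtension (F := F) e'
    have key : ∀ w : TangentSpace (𝓡∂ 2) x,
        D (fun y ↦ D (localExtension F (e + e')) y
            (FiberBundle.extend (EuclideanSpace ℝ (Fin 2)) w y)) x
          = D (fun y ↦ D (localExtension F e) y
              (FiberBundle.extend (EuclideanSpace ℝ (Fin 2)) w y)) x
            + D (fun y ↦ D (localExtension F e') y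
              (FiberBundle.extend (EuclideanSpace ℝ (Fin 2)) w y)) x := by
      intro w
      have hw := FiberBundle.mdifferentiableAt_extend (𝓡∂ 2) (EuclideanSpace ℝ (Fin 2)) w
      have d1 := mdifferentiableAt_connection D hD hU hs hw
      have d2 := mdifferentiableAt_connection D hD hU' hs' hw
      rw [← D.isCovariantDerivativeOnUniv.add d1 d2]
      have d3 := mdifferentiableAt_add_section d1 d2
      have hev : ∀ᶠ y in 𝓝 x, D (localExtension F (e + e')) y
            (FiberBundle.extend (EuclideanSpace ℝ (Fin 2)) w y)
          = D (localExtension F e) y (FiberBundle.extend (EuclideanSpace ℝ (Fin 2)) w y)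
            + D (localExtension F e') y
              (FiberBundle.extend (EuclideanSpace ℝ (Fin 2)) w y) := by
        filter_upwards [eventually_mem_nhds_iff.2 hU, eventually_mem_nhds_iff.2 hU'] with y hy hy'
        rw [map_add, D.isCovariantDerivativeOnUniv.add
          ((hs.contMDiffAt hy).mdifferentiableAt (by simp))
          ((hs'.contMDiffAt hy').mdifferentiableAt (by simp))]
        rfl
      refine D.isCovariantDerivativeOnUniv.congr_of_eventuallyEq ?_ d3 Filter.univ_mem hev
      exact d3.congr_of_eventuallyEq (hev.mono fun y hy ↦ congrArg (TotalSpace.mk' F y) hy)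
    have h0 := D.isCovariantDerivativeOnUniv.add
      ((hs.contMDiffAt hU).mdifferentiableAt (by simp))
      ((hs'.contMDiffAt hU').mdifferentiableAt (by simp))
    simp only [curvatureAux, key]
    rw [map_add, h0]
    simp only [add_apply]
    abel
  map_smul' c e := by
    obtain ⟨U, hU, hs⟩ := contMDiffOn_localExtension (F := F) e
    have key : ∀ w : TangentSpace (𝓡∂ 2) x,
        D (fun y ↦ D (localExtension F (c • e)) y
            (FiberBundle.extend (EuclideanSpace ℝ (Fin 2)) w y)) x
          = c • D (fun y ↦ D (localExtension F e) y
              (FiberBundle.extend (EuclideanSpace ℝ (Fin 2)) w y)) x := by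
      intro w
      have hw := FiberBundle.mdifferentiableAt_extend (𝓡∂ 2) (EuclideanSpace ℝ (Fin 2)) w
      have d1 := mdifferentiableAt_connection D hD hU hs hw
      rw [← D.isCovariantDerivativeOnUniv.smul_const c d1]
      have d3 := (mdifferentiableAt_const (c := c)).smul_section d1
      have hev : ∀ᶠ y in 𝓝 x, D (localExtension F (c • e)) y
            (FiberBundle.extend (EuclideanSpace ℝ (Fin 2)) w y)
          = c • D (localExtension F e) y
            (FiberBundle.extend (EuclideanSpace ℝ (Fin 2)) w y) := by
        filter_upwards [eventually_mem_nhds_iff.2 hU] with y hy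
        rw [map_smul, D.isCovariantDerivativeOnUniv.smul_const c
          ((hs.contMDiffAt hy).mdifferentiableAt (by simp))]
        rfl
      refine D.isCovariantDerivativeOnUniv.congr_of_eventuallyEq ?_ d3 Filter.univ_mem hev
      exact d3.congr_of_eventuallyEq (hev.mono fun y hy ↦ congrArg (TotalSpace.mk' F y) hy)
    have h0 := D.isCovariantDerivativeOnUniv.smul_const c
      ((hs.contMDiffAt hU).mdifferentiableAt (by simp))
    simp only [curvatureAux, key]
    rw [map_smul, h0]
    simp only [smul_apply, RingHom.id_apply, smul_sub]

variable {Ω : SymplecticStructure F E}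

/-- `∇` is a connection of the complex vector bundle `(E, J)`: `∇(Js) = J ∇s`. -/
def IsComplexLinear (𝒥 : CompatibleComplexStructure Ω) (D : CovariantDerivative (𝓡∂ 2) F E) :
    Prop :=
  ∀ (s : ∀ y, E y) (x : M),
    MDifferentiableAt (𝓡∂ 2) ((𝓡∂ 2).prod 𝓘(ℝ, F)) (fun y ↦ TotalSpace.mk' F y (s y)) x →
    ∀ v, D (fun y ↦ 𝒥.J y (s y)) x v = 𝒥.J x (D s x v)

/-- The restriction of `∇` to the boundary is unitary: in the directions tangent to the boundary,
`d h(s, t) = h(∇s, t) + h(s, ∇t)`, where `h` is the Hermitian inner product defined by `ω` and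
`J`. -/
def IsUnitaryAlongBoundary (𝒥 : CompatibleComplexStructure Ω)
    (D : CovariantDerivative (𝓡∂ 2) F E) : Prop :=
  ∀ x ∈ (𝓡∂ 2).boundary M, ∀ s t : ∀ y, E y,
    MDifferentiableAt (𝓡∂ 2) ((𝓡∂ 2).prod 𝓘(ℝ, F)) (fun y ↦ TotalSpace.mk' F y (s y)) x →
    MDifferentiableAt (𝓡∂ 2) ((𝓡∂ 2).prod 𝓘(ℝ, F)) (fun y ↦ TotalSpace.mk' F y (t y)) x →
    ∀ v ∈ boundaryTangentSpace x,
      mvfderiv (𝓡∂ 2) (fun y ↦ 𝒥.hermitian y (s y) (t y)) x v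
        = 𝒥.hermitian x (D s x v) (t x) + 𝒥.hermitian x (s x) (D t x v)

/-- Parallel transport of `∇` along the boundary preserves `L`: a section that is parallel along a
connected open piece `C` of the boundary and lies in `L` at one point of `C` lies in `L` at all
points of `C`. -/
def ParallelTransportPreserves (L : LagrangianSubbundle Ω) (D : CovariantDerivative (𝓡∂ 2) F E) :
    Prop :=
  ∀ U : Set M, IsOpen U → IsPreconnected (U ∩ (𝓡∂ 2).boundary M) → ∀ s : ∀ y, E y,
    (∀ x ∈ U ∩ (𝓡∂ 2).boundary M,
      MDifferentiableAt (𝓡∂ 2) ((𝓡∂ 2).prod 𝓘(ℝ, F)) (fun y ↦ TotalSpace.mk' F y (s y)) x ∧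
      ∀ v ∈ boundaryTangentSpace x, D s x v = 0) →
    ∀ x y : (𝓡∂ 2).boundary M, (x : M) ∈ U → (y : M) ∈ U → s x ∈ L.fiber x → s y ∈ L.fiber y

/-- A smooth connection of the complex vector bundle `(E, J)` which restricts on the boundary to an
`L`-orthogonal unitary connection. -/
structure OrthogonalConnection (L : LagrangianSubbundle Ω) (𝒥 : CompatibleComplexStructure Ω) where
  D : CovariantDerivative (𝓡∂ 2) F E
  smooth : CovariantDerivative.ContMDiffCovariantDerivative D ∞
  complexLinear : IsComplexLinear 𝒥 D
  unitary : IsUnitaryAlongBoundary 𝒥 D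
  orthogonal : ParallelTransportPreserves L D

/-- The Chern-Weil Maslov index `(i / π) ∫_M tr F` of a bundle pair, computed with the compatible
complex structure `J` and the connection `∇`. -/
def chernWeilMaslovIndex [T2Space M] [CompactSpace M] {L : LagrangianSubbundle Ω}
    {𝒥 : CompatibleComplexStructure Ω} (N : OrthogonalConnection L 𝒥) : ℂ :=
  Complex.I / Real.pi *
    surfaceIntegral fun x u v ↦ complexTrace (𝒥.J x : E x →ₗ[ℝ] E x) (curvature N.D N.smooth x u v)

end Connection

end ChernWeilMaslov

end

/-!
The traces of the curvatures of two connections differ by the exterior derivative of the trace of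
the difference of the connections. On an oriented surface Stokes' theorem therefore expresses the
difference of the two integrals through the restriction of this one-form to the boundary. There it
vanishes: if both connections are unitary and preserve `L`, their difference is skew-Hermitian, so
its trace is imaginary, and maps `L` to itself, so its trace is real.

For two complex structures `J` and `J'` the connection `∇'` is first carried to the other complex
structure by an automorphism `Φ` of `E` with `Φ J = J' Φ` and `Φ L ⊆ L`. Such maps that also satisfy
`ω(Φ u, (J + J') u) > 0` for `u ≠ 0` form a convex set, exist locally, and are invertible, hence a
partition of unity yields a global one. The connection `Φ⁻¹ ∇' Φ` need not be unitary along the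
boundary, but it preserves `L` and is `J`-linear, which suffices for the imaginary part of the
complex trace. The real part is half the real trace and does not involve the complex structure.
-/

open MeasureTheory

noncomputable section

namespace ChernWeilMaslov

local notation "ℝ²" => EuclideanSpace ℝ (Fin 2)

local notation "ℍ" => range (𝓡∂ 2)

/-! ### Stokes' theorem on the half-plane -/

section HalfPlane

theorem mem_halfPlane {z : ℝ²} : z ∈ ℍ ↔ 0 ≤ z 0 := by
  rw [range_modelWithCornersEuclideanHalfSpace]; rfl

theorem measurableSet_halfPlane : MeasurableSet ℍ := (𝓡∂ 2).isClosed_range.measurableSet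

/-- The coordinate vector `∂ᵢ` of the plane. -/
abbrev stdVec (i : Fin 2) : ℝ² := EuclideanSpace.single i (1 : ℝ)

theorem eq_sum_stdVec (w : ℝ²) : w = w 0 • stdVec 0 + w 1 • stdVec 1 := by
  ext i; fin_cases i <;> simp

/-- The identification of `ℝ × ℝ` with the Euclidean plane, needed because Mathlib states the
divergence theorem over rectangles in `ℝ × ℝ`. -/
def planeEquiv : (ℝ × ℝ) ≃L[ℝ] ℝ² :=
  (ContinuousLinearEquiv.finTwoArrow ℝ ℝ).symm.trans (EuclideanSpace.equiv (Fin 2) ℝ).symm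

@[simp] theorem planeEquiv_apply_zero (x : ℝ × ℝ) : planeEquiv x 0 = x.1 := by
  simp [planeEquiv]

@[simp] theorem planeEquiv_apply_one (x : ℝ × ℝ) : planeEquiv x 1 = x.2 := by
  simp [planeEquiv]

theorem planeEquiv_one_zero : planeEquiv (1, 0) = stdVec 0 := by
  ext i; fin_cases i <;> simp

theorem planeEquiv_zero_one : planeEquiv (0, 1) = stdVec 1 := by
  ext i; fin_cases i <;> simp

theorem measurePreserving_planeEquiv : MeasurePreserving planeEquiv volume volume :=
  (EuclideanSpace.volume_preserving_symm_measurableEquiv_toLp (Fin 2)).symm.comp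
    (volume_preserving_finTwoArrow ℝ).symm

theorem planeEquiv_mem_halfPlane {x : ℝ × ℝ} : planeEquiv x ∈ ℍ ↔ 0 ≤ x.1 := by
  rw [mem_halfPlane, planeEquiv_apply_zero]

theorem halfPlane_mem_nhds_planeEquiv {x : ℝ × ℝ} (hx : 0 < x.1) : ℍ ∈ 𝓝 (planeEquiv x) := by
  rw [← mem_interior_iff_mem_nhds, interior_range_modelWithCornersEuclideanHalfSpace]
  simpa using hx

variable {V W : Type*} [NormedAddCommGroup V] [NormedSpace ℝ V]
  [NormedAddCommGroup W] [NormedSpace ℝ W]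

theorem fderivWithin_eq_zero_of_notMem {s K : Set V} (hK : IsClosed K) {g : V → W}
    (hg : ∀ z ∈ s, z ∉ K → g z = 0) {z : V} (hz : z ∈ s) (hzK : z ∉ K) :
    fderivWithin ℝ g s z = 0 := by
  have : g =ᶠ[𝓝[s] z] fun _ ↦ 0 := by
    filter_upwards [self_mem_nhdsWithin, nhdsWithin_le_nhds (hK.isOpen_compl.mem_nhds hzK)]
      with y hy hyK using hg y hy hyK
  rw [this.fderivWithin_eq (hg z hz hzK), fderivWithin_fun_const, Pi.zero_apply]

theorem integral_divergence_prod_Icc_eq_zero [CompleteSpace V] {f g : ℝ × ℝ → V}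
    {f' g' : ℝ × ℝ → ℝ × ℝ →L[ℝ] V} {a b : ℝ × ℝ} (hab : a ≤ b)
    (hfc : ContinuousOn f (Icc a b)) (hgc : ContinuousOn g (Icc a b))
    (hf : ∀ x ∈ Ioo a.1 b.1 ×ˢ Ioo a.2 b.2, HasFDerivAt f (f' x) x)
    (hg : ∀ x ∈ Ioo a.1 b.1 ×ˢ Ioo a.2 b.2, HasFDerivAt g (g' x) x)
    (hint : IntegrableOn (fun x ↦ f' x (1, 0) + g' x (0, 1)) (Icc a b))
    (hf₀ : ∀ y ∈ Icc a.2 b.2, f (a.1, y) = 0 ∧ f (b.1, y) = 0)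
    (hg₀ : ∀ x ∈ Icc a.1 b.1, g (x, a.2) = 0 ∧ g (x, b.2) = 0) :
    ∫ x in Icc a b, f' x (1, 0) + g' x (0, 1) = 0 := by
  have vanish : ∀ {c d : ℝ} (_ : c ≤ d) {h : ℝ → V}, (∀ t ∈ Icc c d, h t = 0) →
      ∫ t in c..d, h t = 0 := fun {c d} hcd h hh ↦ by
    rw [intervalIntegral.integral_congr (g := fun _ ↦ 0) (by rwa [uIcc_of_le hcd]),
      intervalIntegral.integral_zero]
  rw [integral_divergence_prod_Icc_of_hasFDerivAt_of_le f g f' g' a b hab hfc hgc hf hg hint,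
    vanish hab.1 fun x hx ↦ (hg₀ x hx).1, vanish hab.1 fun x hx ↦ (hg₀ x hx).2,
    vanish hab.2 fun y hy ↦ (hf₀ y hy).1, vanish hab.2 fun y hy ↦ (hf₀ y hy).2]
  simp only [sub_zero, add_zero]

theorem exists_square_of_isCompact {K : Set ℝ²} (hK : IsCompact K) :
    ∃ R : ℝ, 0 < R ∧ ∀ z ∈ K, |z 0| < R ∧ |z 1| < R := by
  obtain ⟨R, hR⟩ := hK.isBounded.exists_norm_le
  have hcoord (z : ℝ²) (hz : z ∈ K) (i : Fin 2) : |z i| < max R 0 + 1 :=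
    calc |z i| ≤ ‖z‖ := PiLp.norm_apply_le z i
      _ ≤ max R 0 := (hR z hz).trans (le_max_left R 0)
      _ < max R 0 + 1 := lt_add_one _
  exact ⟨max R 0 + 1, by positivity, fun z hz ↦ ⟨hcoord z hz 0, hcoord z hz 1⟩⟩

theorem hasFDerivAt_comp_planeEquiv {g : ℝ² → V} (hg : ContDiffOn ℝ 1 g ℍ) {x : ℝ × ℝ}
    (hx : 0 < x.1) : HasFDerivAt (fun x ↦ g (planeEquiv x))
      ((fderivWithin ℝ g ℍ (planeEquiv x)).comp (planeEquiv : (ℝ × ℝ) →L[ℝ] ℝ²)) x :=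
  have hgx := hg.differentiableOn one_ne_zero _ (planeEquiv_mem_halfPlane.2 hx.le)
  (hgx.hasFDerivWithinAt.hasFDerivAt (halfPlane_mem_nhds_planeEquiv hx)).comp x
    planeEquiv.hasFDerivAt

/-- The function `∂₀ g₁ - ∂₁ g₀` on the half-plane, that is, the exterior derivative of the one-form
`g₀ dx₀ + g₁ dx₁`. -/
def curl (g₀ g₁ : ℝ² → V) (z : ℝ²) : V :=
  fderivWithin ℝ g₁ ℍ z (stdVec 0) - fderivWithin ℝ g₀ ℍ z (stdVec 1)

theorem continuousOn_curl {g₀ g₁ : ℝ² → V} (h₀ : ContDiffOn ℝ 1 g₀ ℍ)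
    (h₁ : ContDiffOn ℝ 1 g₁ ℍ) : ContinuousOn (curl g₀ g₁) ℍ :=
  ((h₁.continuousOn_fderivWithin (𝓡∂ 2).uniqueDiffOn le_rfl).clm_apply continuousOn_const).sub
    ((h₀.continuousOn_fderivWithin (𝓡∂ 2).uniqueDiffOn le_rfl).clm_apply continuousOn_const)

theorem curl_eq_zero_of_notMem {K : Set ℝ²} (hK : IsClosed K) {g₀ g₁ : ℝ² → V}
    (hK₀ : ∀ z ∈ ℍ, z ∉ K → g₀ z = 0) (hK₁ : ∀ z ∈ ℍ, z ∉ K → g₁ z = 0) {z : ℝ²} (hz : z ∈ ℍ)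
    (hzK : z ∉ K) : curl g₀ g₁ z = 0 := by
  rw [curl, fderivWithin_eq_zero_of_notMem hK hK₀ hz hzK,
    fderivWithin_eq_zero_of_notMem hK hK₁ hz hzK, zero_apply, zero_apply, sub_zero]

theorem setIntegral_halfPlane_eq_setIntegral_box {g : ℝ² → V} {R : ℝ}
    (hg : ∀ z ∈ ℍ, R < |z 0| ∨ R < |z 1| → g z = 0) :
    ∫ z in ℍ, g z = ∫ x in Icc ((0 : ℝ), -R) (R, R), g (planeEquiv x) := by
  set B : Set (ℝ × ℝ) := Icc ((0 : ℝ), -R) (R, R)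
  rw [← measurePreserving_planeEquiv.setIntegral_image_emb
    planeEquiv.toHomeomorph.measurableEmbedding g B]
  refine setIntegral_eq_of_subset_of_forall_sdiff_eq_zero measurableSet_halfPlane ?_ ?_
  · rintro _ ⟨x, hx, rfl⟩
    exact planeEquiv_mem_halfPlane.2 hx.1.1
  · rintro z ⟨hz, hzB⟩
    refine hg z hz ?_
    by_contra! hle
    obtain ⟨h0, h1⟩ := And.intro (abs_le.1 hle.1) (abs_le.1 hle.2)
    refine hzB ⟨(z 0, z 1), ⟨⟨mem_halfPlane.1 hz, h1.1⟩, ⟨h0.2, h1.2⟩⟩, ?_⟩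
    ext i; fin_cases i <;> simp

theorem setIntegral_halfPlane_curl_eq_zero [CompleteSpace V] {g₀ g₁ : ℝ² → V}
    (h₀ : ContDiffOn ℝ 1 g₀ ℍ) (h₁ : ContDiffOn ℝ 1 g₁ ℍ) {K : Set ℝ²} (hK : IsCompact K)
    (hK₀ : ∀ z ∈ ℍ, z ∉ K → g₀ z = 0) (hK₁ : ∀ z ∈ ℍ, z ∉ K → g₁ z = 0)
    (hb : ∀ z : ℝ², z 0 = 0 → g₁ z = 0) : ∫ z in ℍ, curl g₀ g₁ z = 0 := by
  obtain ⟨R, hR0, hR⟩ := exists_square_of_isCompact hK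
  have hout (z : ℝ²) (hz : R ≤ |z 0| ∨ R ≤ |z 1|) : z ∉ K := fun hzK ↦
    hz.elim (hR z hzK).1.not_ge (hR z hzK).2.not_ge
  rw [setIntegral_halfPlane_eq_setIntegral_box (R := R) fun z hz hzR ↦
    curl_eq_zero_of_notMem hK.isClosed hK₀ hK₁ hz (hout z (hzR.imp le_of_lt le_of_lt))]
  set B : Set (ℝ × ℝ) := Icc ((0 : ℝ), -R) (R, R)
  have hBH : MapsTo planeEquiv B ℍ := fun x hx ↦ planeEquiv_mem_halfPlane.2 hx.1.1
  have hcont {g : ℝ² → V} (hg : ContinuousOn g ℍ) : ContinuousOn (fun x ↦ g (planeEquiv x)) B :=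
    hg.comp planeEquiv.continuous.continuousOn hBH
  have hcurl (x : ℝ × ℝ) : curl g₀ g₁ (planeEquiv x)
      = (fderivWithin ℝ g₁ ℍ (planeEquiv x)).comp (planeEquiv : (ℝ × ℝ) →L[ℝ] ℝ²) (1, 0)
        + (-(fderivWithin ℝ g₀ ℍ (planeEquiv x)).comp (planeEquiv : (ℝ × ℝ) →L[ℝ] ℝ²)) (0, 1) := by
    simp only [curl, neg_apply, ContinuousLinearMap.comp_apply, ContinuousLinearEquiv.coe_coe,
      planeEquiv_one_zero, planeEquiv_zero_one, sub_eq_add_neg]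
  have hint : IntegrableOn (fun x ↦ curl g₀ g₁ (planeEquiv x)) B :=
    (hcont (continuousOn_curl h₀ h₁)).integrableOn_compact isCompact_Icc
  simp only [hcurl] at hint ⊢
  have hvanish {g : ℝ² → V} (hg : ∀ z ∈ ℍ, z ∉ K → g z = 0) {x y : ℝ} (hx : 0 ≤ x)
      (hxy : R ≤ |x| ∨ R ≤ |y|) : g (planeEquiv (x, y)) = 0 :=
    hg _ (planeEquiv_mem_halfPlane.2 hx) (hout _ (by simpa using hxy))
  refine integral_divergence_prod_Icc_eq_zero (f := fun x ↦ g₁ (planeEquiv x))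
    (g := fun x ↦ -g₀ (planeEquiv x)) ⟨hR0.le, neg_le_self hR0.le⟩ (hcont h₁.continuousOn)
    (hcont h₀.continuousOn).neg (fun x hx ↦ hasFDerivAt_comp_planeEquiv h₁ hx.1.1)
    (fun x hx ↦ (hasFDerivAt_comp_planeEquiv h₀ hx.1.1).neg) hint
    (fun y _ ↦ ⟨hb _ (by simp), hvanish hK₁ hR0.le (.inl (le_abs_self R))⟩) fun x hx ↦ ?_
  exact ⟨neg_eq_zero.2 (hvanish hK₀ hx.1 (.inr (by simp [le_abs_self]))),
    neg_eq_zero.2 (hvanish hK₀ hx.1 (.inr (le_abs_self R)))⟩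

theorem contDiffOn_indicator_of_isCompact {s T K : Set W} {n : WithTop ℕ∞}
    (hT : ∀ z ∈ T, T ∈ 𝓝[s] z) (hK : IsCompact K) (hKT : K ⊆ T) {g : W → V}
    (hg : ContDiffOn ℝ n g T) (h0 : ∀ z ∈ T, z ∉ K → g z = 0) :
    ContDiffOn ℝ n (T.indicator g) s := by
  intro z _
  by_cases hzT : z ∈ T
  · refine ((hg z hzT).mono_of_mem_nhdsWithin (hT z hzT)).congr_of_eventuallyEq ?_ (by simp [hzT])
    filter_upwards [hT z hzT] with y hy using indicator_of_mem hy g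
  · refine (contDiffWithinAt_const (c := (0 : V))).congr_of_eventuallyEq ?_ (by simp [hzT])
    filter_upwards [nhdsWithin_le_nhds (hK.isClosed.isOpen_compl.mem_nhds (mt (@hKT z) hzT))]
      with y hy using indicator_apply_eq_zero.2 fun hyT ↦ h0 y hyT hy

theorem setIntegral_curl_eq_zero [CompleteSpace V] {U T K : Set ℝ²} (hU : IsOpen U)
    (hTU : T = U ∩ ℍ) (hK : IsCompact K) (hKT : K ⊆ T) {g₀ g₁ : ℝ² → V}
    (h₀ : ContDiffOn ℝ 1 g₀ T) (h₁ : ContDiffOn ℝ 1 g₁ T)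
    (hK₀ : ∀ z ∈ T, z ∉ K → g₀ z = 0) (hK₁ : ∀ z ∈ T, z ∉ K → g₁ z = 0)
    (hb : ∀ z ∈ T, z 0 = 0 → g₁ z = 0) : ∫ z in T, curl g₀ g₁ z = 0 := by
  have hTH : T ⊆ ℍ := hTU ▸ inter_subset_right
  have hT (z) (hz : z ∈ T) : T ∈ 𝓝[ℍ] z := by
    subst hTU
    exact Filter.inter_mem (mem_nhdsWithin_of_mem_nhds (hU.mem_nhds hz.1)) self_mem_nhdsWithin
  have hout {g : ℝ² → V} (hg : ∀ z ∈ T, z ∉ K → g z = 0) (z) (_ : z ∈ ℍ) (hzK : z ∉ K) :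
      T.indicator g z = 0 := indicator_apply_eq_zero.2 fun hz ↦ hg z hz hzK
  have hcurl {z} (hz : z ∈ T) : curl (T.indicator g₀) (T.indicator g₁) z = curl g₀ g₁ z := by
    have heq (g : ℝ² → V) : T.indicator g =ᶠ[𝓝[ℍ] z] g := by
      filter_upwards [hT z hz] with y hy using indicator_of_mem hy g
    rw [curl, curl, (heq g₁).fderivWithin_eq (indicator_of_mem hz g₁),
      (heq g₀).fderivWithin_eq (indicator_of_mem hz g₀)]
  calc ∫ z in T, curl g₀ g₁ z
      = ∫ z in T, curl (T.indicator g₀) (T.indicator g₁) z :=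
        setIntegral_congr_fun (hTU ▸ hU.measurableSet.inter measurableSet_halfPlane)
          fun z hz ↦ (hcurl hz).symm
    _ = ∫ z in ℍ, curl (T.indicator g₀) (T.indicator g₁) z :=
        (setIntegral_eq_of_subset_of_forall_sdiff_eq_zero measurableSet_halfPlane hTH
          fun z hz ↦ curl_eq_zero_of_notMem hK.isClosed (hout hK₀) (hout hK₁) hz.1
            (mt (@hKT z) hz.2)).symm
    _ = 0 := setIntegral_halfPlane_curl_eq_zero
        (contDiffOn_indicator_of_isCompact hT hK hKT h₀ hK₀)
        (contDiffOn_indicator_of_isCompact hT hK hKT h₁ hK₁) hK (hout hK₀) (hout hK₁)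
        fun z hz ↦ indicator_apply_eq_zero.2 fun hzT ↦ hb z hzT hz

end HalfPlane

/-! ### Coordinate vector fields -/

section Coordinates

variable {G H : Type*} [NormedAddCommGroup G] [NormedSpace ℝ G] [TopologicalSpace H]
  {I : ModelWithCorners ℝ G H} {M : Type*} [TopologicalSpace M] [ChartedSpace H M]

theorem symm_mem_chart_source {p : M} {z : G} (hz : z ∈ (extChartAt I p).target) :
    (extChartAt I p).symm z ∈ (chartAt H p).source :=
  extChartAt_source I p ▸ (extChartAt I p).map_target hz

theorem eventually_mem_target_and_symm {p : M} {z : G} (hz : z ∈ (extChartAt I p).target)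
    {P : M → Prop} (hP : ∀ᶠ x in 𝓝 ((extChartAt I p).symm z), P x) :
    ∀ᶠ y in 𝓝[range I] z, y ∈ (extChartAt I p).target ∧ P ((extChartAt I p).symm y) :=
  have hT := extChartAt_target_mem_nhdsWithin_of_mem hz
  Filter.Eventually.and hT <| ((continuousOn_extChartAt_symm p z hz).tendsto.mono_left
    (nhdsWithin_le_of_mem hT)).eventually hP

variable (I)

/-- The coordinates of tangent vectors at `x` in the preferred chart at `p`. -/
def chartCoords (p x : M) : TangentSpace I x →L[ℝ] G :=
  mvfderiv I (extChartAt I p) x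

variable [IsManifold I 1 M]

/-- The vector field with constant coordinates `w` in the preferred chart at `p`. -/
def coordField (p x : M) : G →L[ℝ] TangentSpace I x :=
  (trivializationAt G (TangentSpace I) p).symmL ℝ x

variable {I}

theorem coordField_eq {p x : M} (hx : x ∈ (chartAt H p).source) :
    coordField I p x = mfderivWithin 𝓘(ℝ, G) I (extChartAt I p).symm (range I)
      (extChartAt I p x) :=
  TangentBundle.symmL_trivializationAt hx

theorem mfderivWithin_symm_eq {p : M} {z : G} (hz : z ∈ (extChartAt I p).target) (w : G) :
    mfderivWithin 𝓘(ℝ, G) I (extChartAt I p).symm (range I) z w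
      = coordField I p ((extChartAt I p).symm z) w := by
  rw [coordField_eq (symm_mem_chart_source hz), (extChartAt I p).right_inv hz]
  rfl

theorem chartCoords_eq {p x : M} (hx : x ∈ (chartAt H p).source) :
    chartCoords I p x = (trivializationAt G (TangentSpace I) p).continuousLinearMapAt ℝ x :=
  (TangentBundle.continuousLinearMapAt_trivializationAt hx).symm

theorem chartCoords_coordField {p x : M} (hx : x ∈ (chartAt H p).source) (w : G) :
    chartCoords I p x (coordField I p x w) = w := by
  rw [chartCoords_eq hx]
  exact Trivialization.continuousLinearMapAt_symmL _ (by simpa using hx) w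

theorem coordField_chartCoords {p x : M} (hx : x ∈ (chartAt H p).source)
    (v : TangentSpace I x) : coordField I p x (chartCoords I p x v) = v := by
  rw [chartCoords_eq hx]
  exact Trivialization.symmL_continuousLinearMapAt _ (by simpa using hx) v

theorem coordField_self (x : M) (w : G) : coordField I x x w = w := by
  rw [coordField_eq (mem_chart_source _ x), mfderivWithin_range_extChartAt_symm]
  rfl

theorem hasMFDerivAt_extChartAt {p x : M} (hx : x ∈ (chartAt H p).source) :
    HasMFDerivAt I 𝓘(ℝ, G) (extChartAt I p) x (chartCoords I p x) :=
  (mdifferentiableAt_extChartAt hx).hasMFDerivAt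

variable {W : Type*} [NormedAddCommGroup W] [NormedSpace ℝ W]

theorem hasFDerivWithinAt_comp_symm {f : M → W} {p : M} {z : G}
    (hz : z ∈ (extChartAt I p).target)
    (hf : MDifferentiableAt I 𝓘(ℝ, W) f ((extChartAt I p).symm z)) :
    HasFDerivWithinAt (fun z ↦ f ((extChartAt I p).symm z))
      ((mvfderiv I f ((extChartAt I p).symm z)).comp
        (coordField I p ((extChartAt I p).symm z))) (range I) z := by
  have hsymm := (mdifferentiableWithinAt_extChartAt_symm (I := I) hz).hasMFDerivWithinAt
  refine (hf.hasMFDerivAt.comp_hasMFDerivWithinAt z hsymm).hasFDerivWithinAt.congr_fderiv ?_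
  ext w
  exact congrArg (mvfderiv I f ((extChartAt I p).symm z)) (mfderivWithin_symm_eq hz w)

theorem fderivWithin_comp_symm {f : M → W} {p : M} {z : G}
    (hz : z ∈ (extChartAt I p).target)
    (hf : MDifferentiableAt I 𝓘(ℝ, W) f ((extChartAt I p).symm z)) (w : G) :
    fderivWithin ℝ (fun z ↦ f ((extChartAt I p).symm z)) (range I) z w
      = mvfderiv I f ((extChartAt I p).symm z) (coordField I p ((extChartAt I p).symm z) w) := by
  rw [(hasFDerivWithinAt_comp_symm hz hf).fderivWithin
    (I.uniqueDiffOn z (extChartAt_target_subset_range p hz))]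
  rfl

end Coordinates

/-! ### The boundary of a surface -/

section Boundary

variable {M : Type*} [TopologicalSpace M] [ChartedSpace (EuclideanHalfSpace 2) M]
  {W : Type*} [NormedAddCommGroup W] [NormedSpace ℝ W]

theorem fderivWithin_eq_zero_of_eventually_boundary {g : ℝ² → W} {z w : ℝ²} (hz : z 0 = 0)
    (hw : w 0 = 0) (hg : DifferentiableWithinAt ℝ g ℍ z)
    (h0 : ∀ᶠ y in 𝓝[ℍ] z, y 0 = 0 → g y = 0) : fderivWithin ℝ g ℍ z w = 0 := by
  have hline : HasDerivAt (fun t : ℝ ↦ z + t • w) w 0 := by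
    simpa using ((hasDerivAt_id (0 : ℝ)).smul_const w).const_add z
  have hmem (t : ℝ) : z + t • w ∈ ℍ := by rw [mem_halfPlane]; simp [hz, hw]
  have hlim : Filter.Tendsto (fun t : ℝ ↦ z + t • w) (𝓝 0) (𝓝[ℍ] z) :=
    tendsto_nhdsWithin_iff.2 ⟨by simpa using hline.continuousAt.tendsto, .of_forall hmem⟩
  have hderiv : HasDerivAt (g ∘ fun t : ℝ ↦ z + t • w) (fderivWithin ℝ g ℍ z w) 0 := by
    rw [← hasDerivWithinAt_univ]
    exact HasFDerivWithinAt.comp_hasDerivWithinAt (t := ℍ) 0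
      (by simpa using hg.hasFDerivWithinAt) hline.hasDerivWithinAt fun t _ ↦ hmem t
  have hzero : (fun _ ↦ 0) =ᶠ[𝓝 0] g ∘ fun t : ℝ ↦ z + t • w := by
    filter_upwards [hlim.eventually h0] with t ht
    exact (ht (by simp [hz, hw])).symm
  exact (hderiv.congr_of_eventuallyEq hzero).unique (hasDerivAt_const 0 0)

variable [IsManifold (𝓡∂ 2) 1 M]

theorem coordinateVector_eq {p : M} {z : ℝ²} (hz : z ∈ (extChartAt (𝓡∂ 2) p).target) (i : Fin 2) :
    coordinateVector p z i = coordField (𝓡∂ 2) p ((extChartAt (𝓡∂ 2) p).symm z) (stdVec i) :=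
  mfderivWithin_symm_eq hz _

theorem mem_boundary_iff {p x : M} (hx : x ∈ (chartAt (EuclideanHalfSpace 2) p).source) :
    x ∈ (𝓡∂ 2).boundary M ↔ extChartAt (𝓡∂ 2) p x 0 = 0 := by
  have hz : extChartAt (𝓡∂ 2) p x ∈ (extChartAt (𝓡∂ 2) p).target :=
    (extChartAt (𝓡∂ 2) p).map_source (by rwa [extChartAt_source])
  have hr : 0 ≤ extChartAt (𝓡∂ 2) p x 0 :=
    mem_halfPlane.1 (extChartAt_target_subset_range p hz)
  have hint : x ∈ (𝓡∂ 2).interior M ↔ 0 < extChartAt (𝓡∂ 2) p x 0 := by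
    refine ((𝓡∂ 2).isInteriorPoint_iff_of_mem_atlas one_ne_zero
      (chart_mem_atlas (EuclideanHalfSpace 2) p) hx).trans ⟨fun h ↦ ?_, fun h ↦ ?_⟩
    · have := interior_mono (extChartAt_target_subset_range p) h
      rwa [interior_range_modelWithCornersEuclideanHalfSpace] at this
    · have hz0 : extChartAt (𝓡∂ 2) p x ∈ interior ℍ := by
        rwa [interior_range_modelWithCornersEuclideanHalfSpace]
      have := extChartAt_target_mem_nhdsWithin_of_mem hz
      rw [nhdsWithin_eq_nhds.2 (mem_interior_iff_mem_nhds.1 hz0)] at this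
      exact mem_interior_iff_mem_nhds.2 this
  rw [← ModelWithCorners.compl_interior, mem_compl_iff, hint, hr.lt_iff_ne', not_not]

theorem mvfderiv_coordField_eq_zero {f : M → W} {p x : M}
    (hp : x ∈ (chartAt (EuclideanHalfSpace 2) p).source) (hx : x ∈ (𝓡∂ 2).boundary M)
    (hf : MDifferentiableAt (𝓡∂ 2) 𝓘(ℝ, W) f x)
    (h0 : ∀ᶠ y in 𝓝 x, y ∈ (𝓡∂ 2).boundary M → f y = 0) {w : ℝ²} (hw : w 0 = 0) :
    mvfderiv (𝓡∂ 2) f x (coordField (𝓡∂ 2) p x w) = 0 := by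
  obtain ⟨z, hz, rfl⟩ : ∃ z ∈ (extChartAt (𝓡∂ 2) p).target, (extChartAt (𝓡∂ 2) p).symm z = x :=
    ⟨extChartAt (𝓡∂ 2) p x, (extChartAt (𝓡∂ 2) p).map_source (by rwa [extChartAt_source]),
      (extChartAt (𝓡∂ 2) p).left_inv (by rwa [extChartAt_source])⟩
  have hbd {y : ℝ²} (hy : y ∈ (extChartAt (𝓡∂ 2) p).target) :
      (extChartAt (𝓡∂ 2) p).symm y ∈ (𝓡∂ 2).boundary M ↔ y 0 = 0 := by
    rw [mem_boundary_iff (symm_mem_chart_source hy), (extChartAt (𝓡∂ 2) p).right_inv hy]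
  rw [← fderivWithin_comp_symm hz hf]
  refine fderivWithin_eq_zero_of_eventually_boundary ((hbd hz).1 hx) hw
    (hasFDerivWithinAt_comp_symm hz hf).differentiableWithinAt ?_
  filter_upwards [eventually_mem_target_and_symm hz h0] with y hy hy0
  exact hy.2 ((hbd hy.1).2 hy0)

theorem mem_boundaryTangentSpace_self {x : M} {v : TangentSpace (𝓡∂ 2) x} :
    v ∈ boundaryTangentSpace x ↔ chartCoords (𝓡∂ 2) x x v 0 = 0 := by
  have h := coordField_chartCoords (mem_chart_source (EuclideanHalfSpace 2) x) v
  rw [coordField_self] at h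
  rw [h]
  rfl

theorem mvfderiv_eq_zero_of_boundary {f : M → W} {x : M}
    (hx : x ∈ (𝓡∂ 2).boundary M) (hf : MDifferentiableAt (𝓡∂ 2) 𝓘(ℝ, W) f x)
    (h0 : ∀ᶠ y in 𝓝 x, y ∈ (𝓡∂ 2).boundary M → f y = 0) {v : TangentSpace (𝓡∂ 2) x}
    (hv : v ∈ boundaryTangentSpace x) : mvfderiv (𝓡∂ 2) f x v = 0 := by
  rw [← coordField_chartCoords (mem_chart_source (EuclideanHalfSpace 2) x) v]
  exact mvfderiv_coordField_eq_zero (mem_chart_source _ x) hx hf h0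
    (mem_boundaryTangentSpace_self.1 hv)

theorem hasMFDerivAt_extChartAt_zero {p x : M}
    (hp : x ∈ (chartAt (EuclideanHalfSpace 2) p).source) :
    HasMFDerivAt (𝓡∂ 2) 𝓘(ℝ, ℝ) (fun y ↦ extChartAt (𝓡∂ 2) p y 0) x
      ((EuclideanSpace.proj (0 : Fin 2) : ℝ² →L[ℝ] ℝ).comp (chartCoords (𝓡∂ 2) p x)) :=
  (EuclideanSpace.proj (𝕜 := ℝ) (0 : Fin 2)).hasMFDerivAt.comp x (hasMFDerivAt_extChartAt hp)

/-- The boundary is the zero set of the coordinate of index `0` in both charts, so the derivative of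
either coordinate annihilates the boundary directions. -/
theorem mem_boundaryTangentSpace_iff {p x : M}
    (hp : x ∈ (chartAt (EuclideanHalfSpace 2) p).source) (hx : x ∈ (𝓡∂ 2).boundary M)
    {v : TangentSpace (𝓡∂ 2) x} :
    v ∈ boundaryTangentSpace x ↔ chartCoords (𝓡∂ 2) p x v 0 = 0 := by
  have hcoord {q : M} (hq : x ∈ (chartAt (EuclideanHalfSpace 2) q).source) :
      ∀ᶠ y in 𝓝 x, y ∈ (𝓡∂ 2).boundary M → extChartAt (𝓡∂ 2) q y 0 = 0 := by
    filter_upwards [(chartAt (EuclideanHalfSpace 2) q).open_source.mem_nhds hq] with y hy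
      using (mem_boundary_iff hy).1
  have hmv {q : M} (hq : x ∈ (chartAt (EuclideanHalfSpace 2) q).source) :
      mvfderiv (𝓡∂ 2) (fun y ↦ extChartAt (𝓡∂ 2) q y 0) x v = chartCoords (𝓡∂ 2) q x v 0 :=
    DFunLike.congr_fun (hasMFDerivAt_extChartAt_zero hq).mfderiv v
  have hdiff {q : M} (hq : x ∈ (chartAt (EuclideanHalfSpace 2) q).source) :=
    (hasMFDerivAt_extChartAt_zero hq).mdifferentiableAt
  have hx₀ := mem_chart_source (EuclideanHalfSpace 2) x
  refine ⟨fun hv ↦ ?_, fun hv ↦ ?_⟩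
  · rw [← hmv hp]
    exact mvfderiv_eq_zero_of_boundary hx (hdiff hp) (hcoord hp) hv
  · rw [mem_boundaryTangentSpace_self, ← hmv hx₀, ← coordField_chartCoords hp v]
    exact mvfderiv_coordField_eq_zero hp hx (hdiff hx₀) (hcoord hx₀) hv

theorem coordField_mem_boundaryTangentSpace {p x : M}
    (hp : x ∈ (chartAt (EuclideanHalfSpace 2) p).source) (hx : x ∈ (𝓡∂ 2).boundary M) {w : ℝ²}
    (hw : w 0 = 0) : coordField (𝓡∂ 2) p x w ∈ boundaryTangentSpace x := by
  rwa [mem_boundaryTangentSpace_iff hp hx, chartCoords_coordField hp]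

end Boundary

/-! ### Exterior derivatives of one-forms -/

section ExteriorDerivative

variable {G H : Type*} [NormedAddCommGroup G] [NormedSpace ℝ G] [TopologicalSpace H]
  {I : ModelWithCorners ℝ G H} {M : Type*} [TopologicalSpace M] [ChartedSpace H M]
  {W W' : Type*} [NormedAddCommGroup W] [NormedSpace ℝ W]
  [NormedAddCommGroup W'] [NormedSpace ℝ W']

theorem contDiffWithinAt_range {p : M} {g : G → W} {n : WithTop ℕ∞}
    (hg : ContDiffOn ℝ n g (extChartAt I p).target) {z : G} (hz : z ∈ (extChartAt I p).target) :
    ContDiffWithinAt ℝ n g (range I) z :=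
  (hg z hz).mono_of_mem_nhdsWithin (extChartAt_target_mem_nhdsWithin_of_mem hz)

variable [IsManifold I 1 M]

/-- The value of the one-form `β` on the vector field with constant coordinates `w` in the preferred
chart at `p`, as a function of the coordinates in this chart. -/
def coeff (β : ∀ x : M, TangentSpace I x →L[ℝ] W) (p : M) (w : G) (z : G) : W :=
  β ((extChartAt I p).symm z) (coordField I p ((extChartAt I p).symm z) w)

/-- The one-form `β` is continuously differentiable and `η` is its exterior derivative. Since
coordinate vector fields commute, `dβ(∂ᵤ, ∂ᵥ) = ∂ᵤ β(∂ᵥ) - ∂ᵥ β(∂ᵤ)` in every chart. -/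
structure IsExteriorDerivative (β : ∀ x : M, TangentSpace I x →L[ℝ] W)
    (η : ∀ x : M, TangentSpace I x → TangentSpace I x → W) : Prop where
  contDiffOn : ∀ (p : M) (w : G), ContDiffOn ℝ 1 (coeff β p w) (extChartAt I p).target
  eq : ∀ (p : M), ∀ z ∈ (extChartAt I p).target, ∀ u v : G,
    η ((extChartAt I p).symm z) (coordField I p ((extChartAt I p).symm z) u)
        (coordField I p ((extChartAt I p).symm z) v)
      = fderivWithin ℝ (coeff β p v) (range I) z u - fderivWithin ℝ (coeff β p u) (range I) z v

/-- Two-forms, as functions of two tangent vectors. -/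
def IsTwoForm (η : ∀ x : M, TangentSpace I x → TangentSpace I x → W) : Prop :=
  ∀ (x : M) (u v : TangentSpace I x) (a b c d : ℝ),
    η x (a • u + b • v) (c • u + d • v) = (a * d - b * c) • η x u v

namespace IsExteriorDerivative

variable {β β' : ∀ x : M, TangentSpace I x →L[ℝ] W}
  {η η' : ∀ x : M, TangentSpace I x → TangentSpace I x → W}

theorem differentiableWithinAt (h : IsExteriorDerivative β η) {p : M} {z : G}
    (hz : z ∈ (extChartAt I p).target) (w : G) :
    DifferentiableWithinAt ℝ (coeff β p w) (range I) z :=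
  (contDiffWithinAt_range (h.contDiffOn p w) hz).differentiableWithinAt one_ne_zero

theorem fderivWithin_coeff_add_smul (h : IsExteriorDerivative β η) {p : M} {z : G}
    (hz : z ∈ (extChartAt I p).target) (s t : ℝ) (u v : G) :
    fderivWithin ℝ (coeff β p (s • u + t • v)) (range I) z
      = s • fderivWithin ℝ (coeff β p u) (range I) z
        + t • fderivWithin ℝ (coeff β p v) (range I) z := by
  have hlin : coeff β p (s • u + t • v) = s • coeff β p u + t • coeff β p v := by
    funext y
    simp only [coeff, map_add, map_smul, Pi.add_apply, Pi.smul_apply]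
  rw [hlin]
  exact (((h.differentiableWithinAt hz u).hasFDerivWithinAt.const_smul s).add
    ((h.differentiableWithinAt hz v).hasFDerivWithinAt.const_smul t)).fderivWithin
    (I.uniqueDiffOn z (extChartAt_target_subset_range p hz))

theorem eq_at (h : IsExteriorDerivative β η) {p x : M} (hx : x ∈ (chartAt H p).source)
    (u v : TangentSpace I x) :
    η x u v = fderivWithin ℝ (coeff β p (chartCoords I p x v)) (range I) (extChartAt I p x)
        (chartCoords I p x u)
      - fderivWithin ℝ (coeff β p (chartCoords I p x u)) (range I) (extChartAt I p x)
        (chartCoords I p x v) := by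
  have hxs : x ∈ (extChartAt I p).source := by rwa [extChartAt_source]
  rw [← h.eq p _ ((extChartAt I p).map_source hxs), (extChartAt I p).left_inv hxs,
    coordField_chartCoords hx, coordField_chartCoords hx]

theorem isTwoForm (h : IsExteriorDerivative β η) : IsTwoForm η := by
  intro x u v a b c d
  have hx := mem_chart_source H x
  have hz := mem_extChartAt_target (I := I) x
  simp only [h.eq_at hx, map_add, map_smul, h.fderivWithin_coeff_add_smul hz, add_apply, smul_apply]
  module

theorem eq_of_eventuallyEq (h : IsExteriorDerivative β η) (h' : IsExteriorDerivative β' η')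
    {x : M} (hx : ∀ᶠ y in 𝓝 x, β y = β' y) (u v : TangentSpace I x) : η x u v = η' x u v := by
  have hz := mem_extChartAt_target (I := I) x
  rw [← extChartAt_to_inv (I := I) x] at hx
  have hcoeff (w : G) : fderivWithin ℝ (coeff β x w) (range I) (extChartAt I x x)
      = fderivWithin ℝ (coeff β' x w) (range I) (extChartAt I x x) := by
    refine Filter.EventuallyEq.fderivWithin_eq_of_mem ?_ (extChartAt_target_subset_range x hz)
    filter_upwards [eventually_mem_target_and_symm hz hx] with y hy
    rw [coeff, coeff, hy.2]
  rw [h.eq_at (mem_chart_source H x), h'.eq_at (mem_chart_source H x), hcoeff, hcoeff]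

theorem zero : IsExteriorDerivative (fun x : M ↦ (0 : TangentSpace I x →L[ℝ] W))
    fun _ _ _ ↦ 0 := by
  have hcoeff (p : M) (w : G) : coeff (fun x ↦ (0 : TangentSpace I x →L[ℝ] W)) p w = fun _ ↦ 0 :=
    rfl
  refine ⟨fun p w ↦ ?_, fun p z _ u v ↦ ?_⟩
  · exact hcoeff p w ▸ contDiffOn_const
  · simp only [hcoeff, fderivWithin_fun_const, Pi.zero_apply, zero_apply, sub_zero]

theorem add (h : IsExteriorDerivative β η) (h' : IsExteriorDerivative β' η') :
    IsExteriorDerivative (fun x ↦ β x + β' x) fun x u v ↦ η x u v + η' x u v := by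
  refine ⟨fun p w ↦ (h.contDiffOn p w).add (h'.contDiffOn p w), fun p z hz u v ↦ ?_⟩
  have hcoeff (w : G) : fderivWithin ℝ (coeff (fun x ↦ β x + β' x) p w) (range I) z
      = fderivWithin ℝ (coeff β p w) (range I) z + fderivWithin ℝ (coeff β' p w) (range I) z :=
    fderivWithin_add (I.uniqueDiffOn z (extChartAt_target_subset_range p hz))
      (h.differentiableWithinAt hz w) (h'.differentiableWithinAt hz w)
  simp only [h.eq p z hz, h'.eq p z hz, hcoeff, add_apply]
  abel

theorem sum {ι : Type*} {S : Finset ι} {β : ι → ∀ x : M, TangentSpace I x →L[ℝ] W}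
    {η : ι → ∀ x : M, TangentSpace I x → TangentSpace I x → W}
    (h : ∀ i ∈ S, IsExteriorDerivative (β i) (η i)) :
    IsExteriorDerivative (fun x ↦ ∑ i ∈ S, β i x) fun x u v ↦ ∑ i ∈ S, η i x u v := by
  classical
  induction S using Finset.induction with
  | empty => simpa only [Finset.sum_empty] using zero
  | insert i S hi IH =>
    simpa only [Finset.sum_insert hi] using (h i (S.mem_insert_self i)).add
      (IH fun j hj ↦ h j (Finset.mem_insert_of_mem hj))

theorem clm_comp (h : IsExteriorDerivative β η) (A : W →L[ℝ] W') :
    IsExteriorDerivative (fun x ↦ A.comp (β x)) fun x u v ↦ A (η x u v) := by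
  refine ⟨fun p w ↦ A.contDiff.comp_contDiffOn (h.contDiffOn p w), fun p z hz u v ↦ ?_⟩
  have hcoeff (w : G) : fderivWithin ℝ (coeff (fun x ↦ A.comp (β x)) p w) (range I) z
      = A.comp (fderivWithin ℝ (coeff β p w) (range I) z) :=
    (A.hasFDerivAt.comp_hasFDerivWithinAt z
      (h.differentiableWithinAt hz w).hasFDerivWithinAt).fderivWithin
      (I.uniqueDiffOn z (extChartAt_target_subset_range p hz))
  simp only [h.eq p z hz, hcoeff, map_sub, ContinuousLinearMap.comp_apply]

theorem smul (h : IsExteriorDerivative β η) {f : M → ℝ} (hf : ContMDiff I 𝓘(ℝ, ℝ) 1 f) :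
    IsExteriorDerivative (fun x ↦ f x • β x) fun x u v ↦
      mvfderiv I f x u • β x v - mvfderiv I f x v • β x u + f x • η x u v := by
  have hfp (p : M) : ContDiffOn ℝ 1 (fun z ↦ f ((extChartAt I p).symm z)) (extChartAt I p).target :=
    (hf.comp_contMDiffOn (contMDiffOn_extChartAt_symm p)).contDiffOn
  refine ⟨fun p w ↦ (hfp p).smul (h.contDiffOn p w), fun p z hz u v ↦ ?_⟩
  have hfz : MDifferentiableAt I 𝓘(ℝ, ℝ) f ((extChartAt I p).symm z) :=
    hf.contMDiffAt.mdifferentiableAt one_ne_zero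
  have hcoeff (w w' : G) : fderivWithin ℝ (coeff (fun x ↦ f x • β x) p w) (range I) z w'
      = f ((extChartAt I p).symm z) • fderivWithin ℝ (coeff β p w) (range I) z w'
        + mvfderiv I f ((extChartAt I p).symm z) (coordField I p ((extChartAt I p).symm z) w')
          • coeff β p w z := by
    rw [← fderivWithin_comp_symm hz hfz]
    exact DFunLike.congr_fun (fderivWithin_fun_smul
      (I.uniqueDiffOn z (extChartAt_target_subset_range p hz))
      (hasFDerivWithinAt_comp_symm hz hfz).differentiableWithinAt
      (h.differentiableWithinAt hz w)) w'
  simp only [hcoeff, h.eq p z hz, smul_sub, coeff]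
  abel

end IsExteriorDerivative

end ExteriorDerivative

/-! ### Change of coordinates for two-forms -/

section Density

theorem det_plane (D : ℝ² →L[ℝ] ℝ²) :
    D.det = D (stdVec 0) 0 * D (stdVec 1) 1 - D (stdVec 0) 1 * D (stdVec 1) 0 := by
  rw [ContinuousLinearMap.det, ← LinearMap.det_toMatrix (EuclideanSpace.basisFun (Fin 2) ℝ).toBasis,
    Matrix.det_fin_two]
  simp only [LinearMap.toMatrix_apply, OrthonormalBasis.coe_toBasis_repr_apply,
    OrthonormalBasis.coe_toBasis, EuclideanSpace.basisFun_apply, EuclideanSpace.basisFun_repr,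
    ContinuousLinearMap.coe_coe]
  ring

theorem integrableOn_of_eq_zero_of_notMem {X V : Type*} [TopologicalSpace X] [MeasurableSpace X]
    [OpensMeasurableSpace X] [T2Space X] {μ : Measure X} [IsFiniteMeasureOnCompacts μ]
    [NormedAddCommGroup V] {T K : Set X} (hT : MeasurableSet T) (hK : IsCompact K) (hKT : K ⊆ T)
    {g : X → V} (hg : ContinuousOn g T) (h0 : ∀ z ∈ T, z ∉ K → g z = 0) : IntegrableOn g T μ :=
  ((hg.mono hKT).integrableOn_compact hK).of_forall_sdiff_eq_zero hT fun z hz ↦ h0 z hz.1 hz.2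

variable {M : Type*} [TopologicalSpace M] [ChartedSpace (EuclideanHalfSpace 2) M]
  {W : Type*} [NormedAddCommGroup W] [NormedSpace ℝ W]

theorem extChartAt_target_eq_inter_halfPlane (p : M) : (extChartAt (𝓡∂ 2) p).target
    = (𝓡∂ 2).symm ⁻¹' (chartAt (EuclideanHalfSpace 2) p).target ∩ ℍ :=
  extChartAt_target (𝓡∂ 2) p

theorem isOpen_preimage_chartAt_target (p : M) :
    IsOpen ((𝓡∂ 2).symm ⁻¹' (chartAt (EuclideanHalfSpace 2) p).target) :=
  (chartAt (EuclideanHalfSpace 2) p).open_target.preimage (𝓡∂ 2).continuous_symm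

theorem measurableSet_target (p : M) : MeasurableSet (extChartAt (𝓡∂ 2) p).target := by
  rw [extChartAt_target_eq_inter_halfPlane]
  exact (isOpen_preimage_chartAt_target p).measurableSet.inter measurableSet_halfPlane

/-- The change of coordinates from the preferred chart at `p` to the one at `q`. -/
abbrev transition (p q : M) : PartialEquiv ℝ² ℝ² :=
  (extChartAt (𝓡∂ 2) p).symm.trans (extChartAt (𝓡∂ 2) q)

theorem mem_transition_source {p q : M} {z : ℝ²} : z ∈ (transition p q).source ↔
    z ∈ (extChartAt (𝓡∂ 2) p).target ∧
      (extChartAt (𝓡∂ 2) p).symm z ∈ (chartAt (EuclideanHalfSpace 2) q).source := by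
  rw [PartialEquiv.trans_source, extChartAt_source]
  rfl

theorem mem_transition_target {p q : M} {z : ℝ²} : z ∈ (transition p q).target ↔
    z ∈ (extChartAt (𝓡∂ 2) q).target ∧
      (extChartAt (𝓡∂ 2) q).symm z ∈ (chartAt (EuclideanHalfSpace 2) p).source := by
  rw [PartialEquiv.trans_target, PartialEquiv.symm_target, extChartAt_source]
  rfl

theorem measurableSet_transition_source (p q : M) : MeasurableSet (transition p q).source := by
  obtain ⟨u, hu, hu'⟩ := continuousOn_iff'.1 (continuousOn_extChartAt_symm (I := 𝓡∂ 2) p) _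
    (isOpen_extChartAt_source (I := 𝓡∂ 2) q)
  rw [PartialEquiv.trans_source, inter_comm]
  exact hu' ▸ hu.measurableSet.inter (measurableSet_target p)

theorem symm_transition {p q : M} {z : ℝ²} (hz : z ∈ (transition p q).source) :
    (extChartAt (𝓡∂ 2) q).symm (transition p q z) = (extChartAt (𝓡∂ 2) p).symm z :=
  (extChartAt (𝓡∂ 2) q).left_inv hz.2

variable [IsManifold (𝓡∂ 2) 1 M]

/-- The coefficient of a two-form in the preferred chart at `p`, as a function on the surface. -/
def density (η : ∀ x : M, TangentSpace (𝓡∂ 2) x → TangentSpace (𝓡∂ 2) x → W) (p x : M) : W :=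
  η x (coordField (𝓡∂ 2) p x (stdVec 0)) (coordField (𝓡∂ 2) p x (stdVec 1))

/-- The coefficient of the two-form `η` in every preferred chart is continuous. -/
def HasContinuousDensity
    (η : ∀ x : M, TangentSpace (𝓡∂ 2) x → TangentSpace (𝓡∂ 2) x → W) : Prop :=
  ∀ p, ContinuousOn (fun z ↦ density η p ((extChartAt (𝓡∂ 2) p).symm z))
    (extChartAt (𝓡∂ 2) p).target

theorem IsExteriorDerivative.density_eq_curl {β : ∀ x : M, TangentSpace (𝓡∂ 2) x →L[ℝ] W}
    {η : ∀ x : M, TangentSpace (𝓡∂ 2) x → TangentSpace (𝓡∂ 2) x → W}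
    (h : IsExteriorDerivative β η) {p : M} {z : ℝ²} (hz : z ∈ (extChartAt (𝓡∂ 2) p).target) :
    density η p ((extChartAt (𝓡∂ 2) p).symm z)
      = curl (coeff β p (stdVec 0)) (coeff β p (stdVec 1)) z :=
  h.eq p z hz _ _

theorem IsExteriorDerivative.hasContinuousDensity {β : ∀ x : M, TangentSpace (𝓡∂ 2) x →L[ℝ] W}
    {η : ∀ x : M, TangentSpace (𝓡∂ 2) x → TangentSpace (𝓡∂ 2) x → W}
    (h : IsExteriorDerivative β η) : HasContinuousDensity η := by
  intro p
  have hcoeff (u w : ℝ²) : ContinuousOn (fun z ↦ fderivWithin ℝ (coeff β p w) ℍ z u)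
      (extChartAt (𝓡∂ 2) p).target := fun z hz ↦
    (((contDiffWithinAt_range (h.contDiffOn p w) hz).fderivWithin_right (m := 0)
      (𝓡∂ 2).uniqueDiffOn le_rfl
      (extChartAt_target_subset_range p hz)).continuousWithinAt.clm_apply
      continuousWithinAt_const).mono (extChartAt_target_subset_range p)
  exact ((hcoeff (stdVec 0) (stdVec 1)).sub (hcoeff (stdVec 1) (stdVec 0))).congr
    fun z hz ↦ h.density_eq_curl hz

theorem IsTwoForm.density_eq {η : ∀ x : M, TangentSpace (𝓡∂ 2) x → TangentSpace (𝓡∂ 2) x → W}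
    (h : IsTwoForm η) {p q x : M} (hq : x ∈ (chartAt (EuclideanHalfSpace 2) q).source) :
    density η p x
      = ((chartCoords (𝓡∂ 2) q x).comp (coordField (𝓡∂ 2) p x)).det • density η q x := by
  have hcoord (i : Fin 2) : coordField (𝓡∂ 2) p x (stdVec i)
      = (chartCoords (𝓡∂ 2) q x (coordField (𝓡∂ 2) p x (stdVec i))) 0
          • coordField (𝓡∂ 2) q x (stdVec 0)
        + (chartCoords (𝓡∂ 2) q x (coordField (𝓡∂ 2) p x (stdVec i))) 1
          • coordField (𝓡∂ 2) q x (stdVec 1) := by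
    rw [← map_smul, ← map_smul, ← map_add, ← eq_sum_stdVec, coordField_chartCoords hq]
  rw [density, hcoord 0, hcoord 1, h, det_plane, density]
  rfl

theorem hasFDerivWithinAt_transition {p q : M} {z : ℝ²} (hz : z ∈ (transition p q).source) :
    HasFDerivWithinAt (transition p q) ((chartCoords (𝓡∂ 2) q ((extChartAt (𝓡∂ 2) p).symm z)).comp
      (coordField (𝓡∂ 2) p ((extChartAt (𝓡∂ 2) p).symm z))) ℍ z :=
  hasFDerivWithinAt_comp_symm hz.1
    (hasMFDerivAt_extChartAt (mem_transition_source.1 hz).2).mdifferentiableAt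

theorem IsOriented.det_transition_pos (hM : IsOriented M) {p q : M} {z : ℝ²}
    (hz : z ∈ (transition p q).source) :
    0 < ((chartCoords (𝓡∂ 2) q ((extChartAt (𝓡∂ 2) p).symm z)).comp
      (coordField (𝓡∂ 2) p ((extChartAt (𝓡∂ 2) p).symm z))).det := by
  have hpos := hM _ (chart_mem_atlas _ p) _ (chart_mem_atlas _ q) ((extChartAt (𝓡∂ 2) p).symm z)
    ⟨symm_mem_chart_source hz.1, (mem_transition_source.1 hz).2⟩
  rw [show (chartAt (EuclideanHalfSpace 2) p).extend (𝓡∂ 2) ((extChartAt (𝓡∂ 2) p).symm z) = z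
    from (extChartAt (𝓡∂ 2) p).right_inv hz.1] at hpos
  rw [← (hasFDerivWithinAt_transition hz).fderivWithin
    ((𝓡∂ 2).uniqueDiffOn z (extChartAt_target_subset_range p hz.1))]
  exact hpos

theorem IsOriented.integral_density_eq (hM : IsOriented M)
    {η : ∀ x : M, TangentSpace (𝓡∂ 2) x → TangentSpace (𝓡∂ 2) x → W} (h : IsTwoForm η) {p q : M}
    (h0 : ∀ x, x ∉ (chartAt (EuclideanHalfSpace 2) p).source ∩
      (chartAt (EuclideanHalfSpace 2) q).source → ∀ u v, η x u v = 0) :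
    ∫ z in (extChartAt (𝓡∂ 2) p).target, density η p ((extChartAt (𝓡∂ 2) p).symm z)
      = ∫ z in (extChartAt (𝓡∂ 2) q).target, density η q ((extChartAt (𝓡∂ 2) q).symm z) := by
  have hmeas := measurableSet_transition_source p q
  have hsub : (transition p q).source ⊆ ℍ :=
    inter_subset_left.trans (extChartAt_target_subset_range p)
  calc ∫ z in (extChartAt (𝓡∂ 2) p).target, density η p ((extChartAt (𝓡∂ 2) p).symm z)
      = ∫ z in (transition p q).source, density η p ((extChartAt (𝓡∂ 2) p).symm z) :=
        setIntegral_eq_of_subset_of_forall_sdiff_eq_zero (measurableSet_target p)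
          inter_subset_left fun z ⟨hz, hz'⟩ ↦
            h0 _ (fun hx ↦ hz' (mem_transition_source.2 ⟨hz, hx.2⟩)) _ _
    _ = ∫ z in (transition p q).source,
          |((chartCoords (𝓡∂ 2) q ((extChartAt (𝓡∂ 2) p).symm z)).comp
            (coordField (𝓡∂ 2) p ((extChartAt (𝓡∂ 2) p).symm z))).det| •
              density η q ((extChartAt (𝓡∂ 2) q).symm (transition p q z)) :=
        setIntegral_congr_fun hmeas fun z hz ↦ by
          beta_reduce
          rw [abs_of_pos (hM.det_transition_pos hz), symm_transition hz,
            h.density_eq (mem_transition_source.1 hz).2]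
    _ = ∫ z in (transition p q).target, density η q ((extChartAt (𝓡∂ 2) q).symm z) := by
        rw [← (transition p q).image_source_eq_target]
        exact (integral_image_eq_integral_abs_det_fderiv_smul volume hmeas
          (fun z hz ↦ (hasFDerivWithinAt_transition hz).mono hsub) (transition p q).injOn
          fun z ↦ density η q ((extChartAt (𝓡∂ 2) q).symm z)).symm
    _ = ∫ z in (extChartAt (𝓡∂ 2) q).target, density η q ((extChartAt (𝓡∂ 2) q).symm z) :=
        (setIntegral_eq_of_subset_of_forall_sdiff_eq_zero (measurableSet_target q)
          inter_subset_left fun z ⟨hz, hz'⟩ ↦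
            h0 _ (fun hx ↦ hz' (mem_transition_target.2 ⟨hz, hx.1⟩)) _ _).symm

end Density

/-! ### Stokes' theorem on a compact oriented surface -/

section Stokes

variable {M : Type*} [TopologicalSpace M] [ChartedSpace (EuclideanHalfSpace 2) M]

theorem integrableOn_target_of_eq_zero_of_notMem {V : Type*} [NormedAddCommGroup V]
    {p : M} {g : M → V} {K : Set M} (hK : IsCompact K)
    (hKp : K ⊆ (chartAt (EuclideanHalfSpace 2) p).source)
    (hg : ContinuousOn (fun z ↦ g ((extChartAt (𝓡∂ 2) p).symm z)) (extChartAt (𝓡∂ 2) p).target)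
    (h0 : ∀ x ∉ K, g x = 0) :
    IntegrableOn (fun z ↦ g ((extChartAt (𝓡∂ 2) p).symm z)) (extChartAt (𝓡∂ 2) p).target := by
  rw [← extChartAt_source (𝓡∂ 2)] at hKp
  exact integrableOn_of_eq_zero_of_notMem (measurableSet_target p)
    (hK.image_of_continuousOn ((continuousOn_extChartAt p).mono hKp))
    (image_subset_iff.2 fun x hx ↦ (extChartAt (𝓡∂ 2) p).map_source (hKp hx)) hg
    fun z hz hzK ↦ h0 _ fun hx ↦ hzK ⟨_, hx, (extChartAt (𝓡∂ 2) p).right_inv hz⟩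

theorem IsExteriorDerivative.integral_density_eq_zero [IsManifold (𝓡∂ 2) 1 M]
    {W : Type*} [NormedAddCommGroup W] [NormedSpace ℝ W] [CompleteSpace W]
    {β : ∀ x : M, TangentSpace (𝓡∂ 2) x →L[ℝ] W}
    {η : ∀ x : M, TangentSpace (𝓡∂ 2) x → TangentSpace (𝓡∂ 2) x → W}
    (h : IsExteriorDerivative β η) {q : M} {K : Set M} (hK : IsCompact K)
    (hKq : K ⊆ (chartAt (EuclideanHalfSpace 2) q).source) (h0 : ∀ x ∉ K, β x = 0)
    (hb : ∀ x ∈ (𝓡∂ 2).boundary M, ∀ v ∈ boundaryTangentSpace x, β x v = 0) :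
    ∫ z in (extChartAt (𝓡∂ 2) q).target, density η q ((extChartAt (𝓡∂ 2) q).symm z) = 0 := by
  rw [← extChartAt_source (𝓡∂ 2)] at hKq
  have hcoeff (i : Fin 2) : ∀ z ∈ (extChartAt (𝓡∂ 2) q).target, z ∉ extChartAt (𝓡∂ 2) q '' K →
      coeff β q (stdVec i) z = 0 := fun z hz hzK ↦ by
    rw [coeff, h0 _ fun hx ↦ hzK ⟨_, hx, (extChartAt (𝓡∂ 2) q).right_inv hz⟩, zero_apply]
  rw [setIntegral_congr_fun (measurableSet_target q) fun z hz ↦ h.density_eq_curl hz]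
  refine setIntegral_curl_eq_zero (isOpen_preimage_chartAt_target q)
    (extChartAt_target_eq_inter_halfPlane q)
    (hK.image_of_continuousOn ((continuousOn_extChartAt q).mono hKq))
    (image_subset_iff.2 fun x hx ↦ (extChartAt (𝓡∂ 2) q).map_source (hKq hx))
    (h.contDiffOn q _) (h.contDiffOn q _) (hcoeff 0) (hcoeff 1) fun z hz hz0 ↦ ?_
  have hzq := symm_mem_chart_source hz
  have hzb : (extChartAt (𝓡∂ 2) q).symm z ∈ (𝓡∂ 2).boundary M :=
    (mem_boundary_iff hzq).2 (by rwa [(extChartAt (𝓡∂ 2) q).right_inv hz])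
  exact hb _ hzb _ (coordField_mem_boundaryTangentSpace hzq hzb (by simp [stdVec]))

variable [T2Space M] [CompactSpace M] [IsManifold (𝓡∂ 2) ∞ M]

theorem tsupport_chartPartition_subset (p : M) :
    tsupport (chartPartition M p) ⊆ (chartAt (EuclideanHalfSpace 2) p).source :=
  (SmoothPartitionOfUnity.exists_isSubordinate_chartAt_source (𝓡∂ 2) M).choose_spec p

theorem isCompact_tsupport_chartPartition (p : M) : IsCompact (tsupport (chartPartition M p)) :=
  (isClosed_tsupport _).isCompact

variable (M) in
/-- The finitely many points whose function in the partition of unity `chartPartition` is not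
identically zero. -/
def chartIndices : Finset M :=
  ((chartPartition M).locallyFinite.finite_nonempty_of_compact).toFinset

theorem chartPartition_eq_zero {p : M} (hp : p ∉ chartIndices M) (x : M) :
    chartPartition M p x = 0 := by
  by_contra hx
  exact hp ((Finite.mem_toFinset _).2 ⟨x, hx⟩)

theorem sum_chartPartition_eq_one (x : M) : ∑ p ∈ chartIndices M, chartPartition M p x = 1 := by
  rw [← (chartPartition M).sum_eq_one (mem_univ x), finsum_eq_sum_of_support_subset]
  exact fun p hp ↦ not_imp_comm.1 (fun hpM ↦ chartPartition_eq_zero hpM x) hp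

theorem continuousOn_chartPartition (p q : M) :
    ContinuousOn (fun z ↦ chartPartition M q ((extChartAt (𝓡∂ 2) p).symm z))
      (extChartAt (𝓡∂ 2) p).target :=
  (chartPartition M q).contMDiff.continuous.comp_continuousOn (continuousOn_extChartAt_symm p)

theorem surfaceIntegral_eq_sum
    (η : ∀ x : M, TangentSpace (𝓡∂ 2) x → TangentSpace (𝓡∂ 2) x → ℂ) :
    surfaceIntegral η = ∑ p ∈ chartIndices M, ∫ z in (extChartAt (𝓡∂ 2) p).target,
      density (fun x u v ↦ chartPartition M p x • η x u v) p ((extChartAt (𝓡∂ 2) p).symm z) := by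
  rw [surfaceIntegral, finsum_eq_sum_of_support_subset]
  · refine Finset.sum_congr rfl fun p _ ↦ setIntegral_congr_fun (measurableSet_target p) ?_
    intro z hz
    simp only [coordinateVector_eq hz, density, Complex.real_smul, stdVec]
  · intro p
    refine not_imp_comm.1 fun hp ↦ ?_
    simp only [chartPartition_eq_zero hp, Complex.ofReal_zero, zero_mul, integral_zero]

variable {η : ∀ x : M, TangentSpace (𝓡∂ 2) x → TangentSpace (𝓡∂ 2) x → ℂ}

theorem HasContinuousDensity.smul_chartPartition (h : HasContinuousDensity η) (p : M) :
    HasContinuousDensity fun x u v ↦ chartPartition M p x • η x u v :=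
  fun q ↦ (continuousOn_chartPartition q p).smul (h q)

theorem HasContinuousDensity.integrableOn (h : HasContinuousDensity η) (p : M) :
    IntegrableOn (fun z ↦ density (fun x u v ↦ chartPartition M p x • η x u v) p
      ((extChartAt (𝓡∂ 2) p).symm z)) (extChartAt (𝓡∂ 2) p).target :=
  integrableOn_target_of_eq_zero_of_notMem (isCompact_tsupport_chartPartition p)
    (tsupport_chartPartition_subset p) (h.smul_chartPartition p p) fun x hx ↦ by
      rw [density, image_eq_zero_of_notMem_tsupport hx, zero_smul]

theorem surfaceIntegral_sub {η' : ∀ x : M, TangentSpace (𝓡∂ 2) x → TangentSpace (𝓡∂ 2) x → ℂ}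
    (h : HasContinuousDensity η) (h' : HasContinuousDensity η') :
    surfaceIntegral (fun x u v ↦ η x u v - η' x u v) = surfaceIntegral η - surfaceIntegral η' := by
  simp only [surfaceIntegral_eq_sum, ← Finset.sum_sub_distrib]
  refine Finset.sum_congr rfl fun p _ ↦ ?_
  rw [← integral_sub (h.integrableOn p) (h'.integrableOn p)]
  simp only [density, smul_sub]

theorem surfaceIntegral_sum {ι : Type*} {S : Finset ι}
    {η : ι → ∀ x : M, TangentSpace (𝓡∂ 2) x → TangentSpace (𝓡∂ 2) x → ℂ}
    (h : ∀ i ∈ S, HasContinuousDensity (η i)) :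
    surfaceIntegral (fun x u v ↦ ∑ i ∈ S, η i x u v) = ∑ i ∈ S, surfaceIntegral (η i) := by
  simp only [surfaceIntegral_eq_sum]
  rw [Finset.sum_comm]
  refine Finset.sum_congr rfl fun p _ ↦ ?_
  rw [← integral_finsetSum _ fun i hi ↦ (h i hi).integrableOn p]
  simp only [density, Finset.smul_sum]

theorem IsOriented.surfaceIntegral_eq_integral_density (hM : IsOriented M) (hη : IsTwoForm η)
    (hc : HasContinuousDensity η) {q : M} {K : Set M} (hK : IsCompact K)
    (hKq : K ⊆ (chartAt (EuclideanHalfSpace 2) q).source) (h0 : ∀ x ∉ K, ∀ u v, η x u v = 0) :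
    surfaceIntegral η
      = ∫ z in (extChartAt (𝓡∂ 2) q).target, density η q ((extChartAt (𝓡∂ 2) q).symm z) := by
  have hint (p : M) : IntegrableOn (fun z ↦ density (fun x u v ↦ chartPartition M p x • η x u v) q
      ((extChartAt (𝓡∂ 2) q).symm z)) (extChartAt (𝓡∂ 2) q).target :=
    integrableOn_target_of_eq_zero_of_notMem hK hKq (hc.smul_chartPartition p q) fun x hx ↦ by
      rw [density, h0 x hx, smul_zero]
  calc surfaceIntegral η
      = ∑ p ∈ chartIndices M, ∫ z in (extChartAt (𝓡∂ 2) q).target,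
          density (fun x u v ↦ chartPartition M p x • η x u v) q
            ((extChartAt (𝓡∂ 2) q).symm z) := by
        rw [surfaceIntegral_eq_sum]
        refine Finset.sum_congr rfl fun p _ ↦ hM.integral_density_eq (fun x u v a b c d ↦ ?_) ?_
        · rw [hη, smul_comm]
        · intro x hx u v
          by_cases hxp : x ∈ tsupport (chartPartition M p)
          · have hxK : x ∉ K := fun hxK ↦ hx ⟨tsupport_chartPartition_subset p hxp, hKq hxK⟩
            rw [h0 x hxK, smul_zero]
          · rw [image_eq_zero_of_notMem_tsupport hxp, zero_smul]
    _ = ∫ z in (extChartAt (𝓡∂ 2) q).target, density η q ((extChartAt (𝓡∂ 2) q).symm z) := by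
        rw [← integral_finsetSum _ fun p _ ↦ hint p]
        simp only [density, ← Finset.sum_smul, sum_chartPartition_eq_one, one_smul]

theorem surfaceIntegral_eq_zero (hM : IsOriented M)
    {β : ∀ x : M, TangentSpace (𝓡∂ 2) x →L[ℝ] ℂ} (h : IsExteriorDerivative β η)
    (hb : ∀ x ∈ (𝓡∂ 2).boundary M, ∀ v ∈ boundaryTangentSpace x, β x v = 0) :
    surfaceIntegral η = 0 := by
  set ρ := chartPartition M
  let β' (q x : M) : TangentSpace (𝓡∂ 2) x →L[ℝ] ℂ := ρ q x • β x
  let η' (q x : M) (u v : TangentSpace (𝓡∂ 2) x) : ℂ := mvfderiv (𝓡∂ 2) (ρ q) x u • β x v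
    - mvfderiv (𝓡∂ 2) (ρ q) x v • β x u + ρ q x • η x u v
  have hη' (q : M) : IsExteriorDerivative (β' q) (η' q) :=
    h.smul ((ρ q).contMDiff.of_le (by simp))
  have hβ'_zero (q : M) : ∀ x ∉ tsupport (ρ q), β' q x = 0 := fun x hx ↦ by
    simp only [β', image_eq_zero_of_notMem_tsupport hx]
    exact zero_smul ℝ (β x)
  have hη'_zero (q : M) : ∀ x ∉ tsupport (ρ q), ∀ u v, η' q x u v = 0 := fun x hx u v ↦
    (hη' q).eq_of_eventuallyEq .zero (Filter.mem_of_superset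
      ((isClosed_tsupport (ρ q)).isOpen_compl.mem_nhds hx) (hβ'_zero q)) u v
  have hsum (x : M) : ∑ q ∈ chartIndices M, β' q x = β x := by
    rw [← Finset.sum_smul, sum_chartPartition_eq_one, one_smul]
  have hη : η = fun x u v ↦ ∑ q ∈ chartIndices M, η' q x u v := by
    funext x u v
    exact h.eq_of_eventuallyEq (.sum fun q _ ↦ hη' q) (.of_forall fun y ↦ (hsum y).symm) u v
  rw [hη, surfaceIntegral_sum fun q _ ↦ (hη' q).hasContinuousDensity]
  refine Finset.sum_eq_zero fun q _ ↦ ?_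
  rw [hM.surfaceIntegral_eq_integral_density (hη' q).isTwoForm (hη' q).hasContinuousDensity
    (isCompact_tsupport_chartPartition q) (tsupport_chartPartition_subset q) (hη'_zero q)]
  refine (hη' q).integral_density_eq_zero (isCompact_tsupport_chartPartition q)
    (tsupport_chartPartition_subset q) (hβ'_zero q) fun x hx v hv ↦ ?_
  simp only [β', smul_apply, hb x hx v hv, smul_zero]

end Stokes

/-! ### Symplectic linear algebra -/

section LinearAlgebra

variable {V : Type*} [AddCommGroup V] [Module ℝ V]

/-- A complex structure `J` on a vector space with a bilinear form `Θ`, compatible with `Θ`. -/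
structure IsCompatible (Θ : V →ₗ[ℝ] V →ₗ[ℝ] ℝ) (J : V →ₗ[ℝ] V) : Prop where
  self_eq_zero : ∀ v, Θ v v = 0
  sq_eq_neg : ∀ v, J (J v) = -v
  form_map : ∀ v w, Θ (J v) (J w) = Θ v w
  form_pos : ∀ v, v ≠ 0 → 0 < Θ v (J v)

/-- A Lagrangian subspace: it is equal to its own symplectic orthogonal. -/
def IsLagrangian (Θ : V →ₗ[ℝ] V →ₗ[ℝ] ℝ) (L : Submodule ℝ V) : Prop :=
  ∀ v, v ∈ L ↔ ∀ w ∈ L, Θ v w = 0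

/-- A Parseval frame of the Hermitian inner product of `Θ` and `J`, for instance a unitary basis:
`∑ ⟨u, eᵢ⟩ eᵢ = u` for all `u`, written in terms of the real vector space `V`. -/
def IsParsevalFrame {ι : Type*} [Fintype ι] (Θ : V →ₗ[ℝ] V →ₗ[ℝ] ℝ) (J : V →ₗ[ℝ] V)
    (e : ι → V) : Prop :=
  ∀ u, ∑ i, (Θ (e i) (J u) • e i + Θ (e i) u • J (e i)) = u

namespace IsCompatible

variable {Θ : V →ₗ[ℝ] V →ₗ[ℝ] ℝ} {J J' : V →ₗ[ℝ] V} {L : Submodule ℝ V}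

theorem swap (h : IsCompatible Θ J) (v w : V) : Θ v w = -Θ w v := by
  have hvw := h.self_eq_zero (v + w)
  simp only [map_add, LinearMap.add_apply, h.self_eq_zero] at hvw
  linarith

theorem symm (h : IsCompatible Θ J) (v w : V) : Θ v (J w) = Θ w (J v) := by
  rw [← h.form_map v, h.sq_eq_neg, map_neg, h.swap w]

theorem eq_zero (h : IsCompatible Θ J) {v : V} (hv : Θ v (J v) = 0) : v = 0 := by
  by_contra hv0
  exact (h.form_pos v hv0).ne' hv

theorem form_sub_pos (h : IsCompatible Θ J) (h' : IsCompatible Θ J') {v : V} (hv : v ≠ 0) :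
    0 < Θ (v - J' (J v)) (J v + J' v) := by
  have hJv : 0 ≤ Θ (J v) (J' (J v)) := by
    obtain hJv | hJv := eq_or_ne (J v) 0
    · simp [hJv]
    · exact (h'.form_pos _ hJv).le
  have hswap : Θ (J v) v = -Θ v (J v) := h.swap _ _
  simp only [map_sub, map_add, LinearMap.sub_apply, h'.form_map, h'.swap (J' (J v)) (J v), hswap]
  linarith [h.form_pos v hv, h'.form_pos v hv]

theorem exists_orthogonal_basis [FiniteDimensional ℝ L] (h : IsCompatible Θ J) :
    ∃ b : Module.Basis (Fin (Module.finrank ℝ L)) ℝ L,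
      ∀ i j, i ≠ j → Θ (b i) (J (b j)) = 0 := by
  let g : LinearMap.BilinForm ℝ L := (Θ.compl₂ J).domRestrict₁₂ L L
  obtain ⟨b, hb⟩ := LinearMap.BilinForm.exists_orthogonal_basis (B := g)
    ⟨fun v w ↦ h.symm (v : V) (w : V)⟩
  exact ⟨b, fun i j hij ↦ hb hij⟩

theorem exists_isParsevalFrame [FiniteDimensional ℝ L] (h : IsCompatible Θ J)
    (hL : IsLagrangian Θ L) :
    ∃ e : Fin (Module.finrank ℝ L) → V, (∀ i, e i ∈ L) ∧ IsParsevalFrame Θ J e := by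
  obtain ⟨b, hb⟩ := h.exists_orthogonal_basis (L := L)
  have hLL (i j) : Θ (b i) (b j) = 0 := (hL _).1 (b i).2 _ (b j).2
  have hpos (i) : 0 < Θ (b i) (J (b i)) := h.form_pos _ fun hi ↦ b.ne_zero i (Subtype.ext hi)
  let c (i) : ℝ := (√(Θ (b i) (J (b i))))⁻¹
  have hc (i) : c i * c i * Θ (b i) (J (b i)) = 1 := by
    rw [← mul_inv, Real.mul_self_sqrt (hpos i).le, inv_mul_cancel₀ (hpos i).ne']
  refine ⟨fun i ↦ c i • (b i : V), fun i ↦ L.smul_mem _ (b i).2, fun u ↦ ?_⟩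
  set v := ∑ i, (Θ (c i • (b i : V)) (J u) • c i • (b i : V)
    + Θ (c i • (b i : V)) u • J (c i • (b i : V))) with hv
  have form_b_v (k) : Θ (b k) v = Θ (b k) u := by
    rw [hv, map_sum, Finset.sum_eq_single_of_mem k (Finset.mem_univ k) fun i _ hi ↦ by
      simp [hLL, hb k i hi.symm]]
    simp only [map_add, map_smul, LinearMap.smul_apply, smul_eq_mul, hLL]
    linear_combination Θ (b k) u * hc k
  have form_b_J_v (k) : Θ (b k) (J v) = Θ (b k) (J u) := by
    rw [hv, map_sum, map_sum, Finset.sum_eq_single_of_mem k (Finset.mem_univ k) fun i _ hi ↦ by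
      simp [hLL, hb k i hi.symm, h.sq_eq_neg]]
    simp only [map_add, map_smul, LinearMap.smul_apply, smul_eq_mul, h.sq_eq_neg, map_neg, hLL]
    linear_combination Θ (b k) (J u) * hc k
  have eq_zero_of_basis (w : V) (hw : ∀ k, Θ (b k) w = 0) : ∀ x ∈ L, Θ x w = 0 := fun x hx ↦
    DFunLike.congr_fun (b.ext (f₁ := Θ.flip w ∘ₗ L.subtype) (f₂ := 0) hw) ⟨x, hx⟩
  have hmem : v - u ∈ L := (hL _).2 fun w hw ↦ by
    rw [h.swap, eq_zero_of_basis _ (fun k ↦ by rw [map_sub, form_b_v, sub_self]) w hw, neg_zero]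
  exact sub_eq_zero.1 (h.eq_zero (eq_zero_of_basis _
    (fun k ↦ by rw [map_sub, map_sub, form_b_J_v, sub_self]) _ hmem))

end IsCompatible

namespace IsParsevalFrame

variable {Θ : V →ₗ[ℝ] V →ₗ[ℝ] ℝ} {J J' : V →ₗ[ℝ] V} {L : Submodule ℝ V} {ι : Type*} [Fintype ι]
  {e : ι → V}

theorem trace_eq [FiniteDimensional ℝ V] (he : IsParsevalFrame Θ J e) (B : V →ₗ[ℝ] V) :
    LinearMap.trace ℝ V B = ∑ i, (Θ (e i) (J (B (e i))) + Θ (e i) (B (J (e i)))) := by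
  have hB : B = ∑ i, ((Θ (e i) ∘ₗ J).smulRight (B (e i)) + (Θ (e i)).smulRight (B (J (e i)))) := by
    ext u
    conv_lhs => rw [← he u]
    simp
  conv_lhs => rw [hB]
  simp

theorem trace_eq_zero_of_skew [FiniteDimensional ℝ V] (he : IsParsevalFrame Θ J e)
    (h : IsCompatible Θ J) {B : V →ₗ[ℝ] V} (hB : ∀ v w, Θ (B v) w + Θ v (B w) = 0) :
    LinearMap.trace ℝ V B = 0 := by
  rw [he.trace_eq]
  exact Finset.sum_eq_zero fun i _ ↦ by rw [h.symm, hB]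

theorem trace_comp_eq_zero [FiniteDimensional ℝ V] (he : IsParsevalFrame Θ J e)
    (h : IsCompatible Θ J) (hL : IsLagrangian Θ L) (heL : ∀ i, e i ∈ L) {A : V →ₗ[ℝ] V}
    (hAJ : ∀ v, A (J v) = J (A v)) (hA : ∀ v ∈ L, A v ∈ L) :
    LinearMap.trace ℝ V (J ∘ₗ A) = 0 := by
  rw [he.trace_eq]
  refine Finset.sum_eq_zero fun i _ ↦ ?_
  have hLL : Θ (e i) (A (e i)) = 0 := (hL _).1 (heL i) _ (hA _ (heL i))
  simp only [LinearMap.comp_apply, hAJ, h.sq_eq_neg, map_neg, hLL, neg_zero, add_zero]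

theorem form_add_pos (he : IsParsevalFrame Θ J' e) (h : IsCompatible Θ J) (h' : IsCompatible Θ J')
    {u : V} (hu : u ≠ 0) :
    0 < Θ (∑ i, (Θ (e i) u • J' (e i) - Θ (J (e i)) u • e i)) (J u + J' u) := by
  have hu_form : ∑ i, (Θ (e i) (J' u) * Θ (e i) (J u) + Θ (e i) u * Θ (J' (e i)) (J u))
      = Θ u (J u) := by
    simpa only [map_sum, map_add, map_smul, LinearMap.sum_apply, LinearMap.add_apply,
      LinearMap.smul_apply, smul_eq_mul] using congrArg (fun v ↦ Θ v (J u)) (he u)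
  have hsum : Θ (∑ i, (Θ (e i) u • J' (e i) - Θ (J (e i)) u • e i)) (J u + J' u)
      = ∑ i, (Θ (e i) u ^ 2 + Θ (e i) (J u) ^ 2) + Θ u (J u) := by
    rw [← hu_form, ← Finset.sum_add_distrib, map_sum, LinearMap.sum_apply]
    refine Finset.sum_congr rfl fun i _ ↦ ?_
    simp only [map_sub, map_add, map_smul, LinearMap.sub_apply, LinearMap.smul_apply, smul_eq_mul,
      h'.form_map, h.swap (J (e i)) u, h.symm u (e i)]
    ring
  rw [hsum]
  exact add_pos_of_nonneg_of_pos (Finset.sum_nonneg fun i _ ↦ by positivity) (h.form_pos u hu)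

end IsParsevalFrame

end LinearAlgebra

/-! ### Sections of vector bundles -/

section OperatorFamilies

variable {F W : Type*} [NormedAddCommGroup F] [NormedSpace ℝ F] [FiniteDimensional ℝ F]
  [NormedAddCommGroup W] [NormedSpace ℝ W]

variable (F W) in
theorem exists_clm_reconstruct_of_apply :
    ∃ (b : Fin (Module.finrank ℝ F) → F)
      (R : (Fin (Module.finrank ℝ F) → W) →L[ℝ] F →L[ℝ] W),
      ∀ A : F →L[ℝ] W, R (fun j ↦ A (b j)) = A := by
  have hd : Module.finrank ℝ F = Module.finrank ℝ (Fin (Module.finrank ℝ F) → ℝ) :=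
    (Module.finrank_fin_fun ℝ).symm
  let e₁ := ContinuousLinearEquiv.ofFinrankEq hd
  let e₂ := (e₁.arrowCongr (1 : W ≃L[ℝ] W)).trans
    (ContinuousLinearEquiv.piRing (Fin (Module.finrank ℝ F)))
  exact ⟨fun j ↦ e₁.symm (Pi.single j 1), e₂.symm, e₂.symm_apply_apply⟩

theorem contDiffWithinAt_clm_of_apply {V : Type*} [NormedAddCommGroup V] [NormedSpace ℝ V]
    {n : WithTop ℕ∞} {g : V → F →L[ℝ] W} {S : Set V} {x : V}
    (h : ∀ f, ContDiffWithinAt ℝ n (fun y ↦ g y f) S x) : ContDiffWithinAt ℝ n g S x := by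
  obtain ⟨b, R, hR⟩ := exists_clm_reconstruct_of_apply F W
  rw [funext fun y ↦ (hR (g y)).symm]
  exact R.contDiff.contDiffAt.comp_contDiffWithinAt x (contDiffWithinAt_pi.2 fun j ↦ h (b j))

theorem contMDiffAt_clm_of_apply {G H : Type*} [NormedAddCommGroup G] [NormedSpace ℝ G]
    [TopologicalSpace H] {I : ModelWithCorners ℝ G H} {M : Type*} [TopologicalSpace M]
    [ChartedSpace H M] {n : WithTop ℕ∞} {g : M → F →L[ℝ] W} {x : M}
    (h : ∀ f, ContMDiffAt I 𝓘(ℝ, W) n (fun y ↦ g y f) x) :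
    ContMDiffAt I 𝓘(ℝ, F →L[ℝ] W) n g x := by
  obtain ⟨b, R, hR⟩ := exists_clm_reconstruct_of_apply F W
  rw [funext fun y ↦ (hR (g y)).symm]
  exact R.contMDiff.contMDiffAt.comp x (contMDiffAt_pi_space.2 fun j ↦ h (b j))

end OperatorFamilies

section Sections

variable {G H : Type*} [NormedAddCommGroup G] [NormedSpace ℝ G] [TopologicalSpace H]
  {I : ModelWithCorners ℝ G H} {M : Type*} [TopologicalSpace M] [ChartedSpace H M]
  {F : Type*} [NormedAddCommGroup F] [NormedSpace ℝ F]
  {E : M → Type*} [TopologicalSpace (TotalSpace F E)] [∀ x, TopologicalSpace (E x)]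
  [FiberBundle F E]

variable (I F) in
/-- The section `s` is smooth at `x`. -/
abbrev SmoothAt (s : ∀ y, E y) (x : M) : Prop :=
  ContMDiffAt I (I.prod 𝓘(ℝ, F)) ∞ (fun y ↦ TotalSpace.mk' F y (s y)) x

variable (I F) in
/-- The section `s` is differentiable at `x`. -/
abbrev DiffAt (s : ∀ y, E y) (x : M) : Prop :=
  MDifferentiableAt I (I.prod 𝓘(ℝ, F)) (fun y ↦ TotalSpace.mk' F y (s y)) x

variable (I F) in
/-- The section `s` is smooth on a neighbourhood of `x`. This is stronger than `SmoothAt`, which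
only provides, for every `n`, a neighbourhood on which `s` is of class `C^n`. -/
def SmoothNear (s : ∀ y, E y) (x : M) : Prop := ∀ᶠ y in 𝓝 x, SmoothAt I F s y

variable {s t : ∀ y, E y} {x : M}

theorem SmoothAt.diffAt (h : SmoothAt I F s x) : DiffAt I F s x :=
  h.mdifferentiableAt (by simp)

theorem SmoothNear.smoothAt (h : SmoothNear I F s x) : SmoothAt I F s x :=
  h.self_of_nhds

theorem SmoothNear.diffAt (h : SmoothNear I F s x) : DiffAt I F s x :=
  h.smoothAt.diffAt

theorem SmoothNear.of_contMDiffOn {U : Set M} (hU : U ∈ 𝓝 x)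
    (hs : ContMDiffOn I (I.prod 𝓘(ℝ, F)) ∞ (fun y ↦ TotalSpace.mk' F y (s y)) U) :
    SmoothNear I F s x := by
  filter_upwards [eventually_mem_nhds_iff.2 hU] with y hy using hs.contMDiffAt hy

theorem SmoothNear.exists_contMDiffOn (h : SmoothNear I F s x) :
    ∃ U ∈ 𝓝 x, ContMDiffOn I (I.prod 𝓘(ℝ, F)) ∞ (fun y ↦ TotalSpace.mk' F y (s y)) U :=
  ⟨{y | SmoothAt I F s y}, h, fun _ hy ↦ ContMDiffAt.contMDiffWithinAt hy⟩

theorem SmoothAt.congr (h : SmoothAt I F s x) (hst : ∀ᶠ y in 𝓝 x, t y = s y) :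
    SmoothAt I F t x :=
  h.congr_of_eventuallyEq (hst.mono fun y hy ↦ congrArg (TotalSpace.mk' F y) hy)

theorem DiffAt.congr (h : DiffAt I F s x) (hst : ∀ᶠ y in 𝓝 x, t y = s y) : DiffAt I F t x :=
  h.congr_of_eventuallyEq (hst.mono fun y hy ↦ congrArg (TotalSpace.mk' F y) hy)

variable [∀ x, AddCommGroup (E x)] [∀ x, Module ℝ (E x)] [VectorBundle ℝ F E]
  (e : Trivialization F (π F E)) [MemTrivializationAtlas e]

/-- The section with constant value `f` in the trivialization `e`. -/
def constSection (f : F) (y : M) : E y := e.symmL ℝ y f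

/-- The local representative of the section `s` in the trivialization `e`. -/
def localRep (s : ∀ y, E y) (y : M) : F := e.continuousLinearMapAt ℝ y (s y)

variable {e}

theorem localRep_constSection (hx : x ∈ e.baseSet) (f : F) :
    localRep e (constSection e f) x = f :=
  e.continuousLinearMapAt_symmL hx f

theorem constSection_localRep (hx : x ∈ e.baseSet) (s : ∀ y, E y) :
    constSection e (localRep e s x) x = s x :=
  e.symmL_continuousLinearMapAt hx (s x)

theorem localRep_eventuallyEq (hx : x ∈ e.baseSet) (s : ∀ y, E y) :
    (fun y ↦ (e ⟨y, s y⟩).2) =ᶠ[𝓝 x] localRep e s := by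
  filter_upwards [e.open_baseSet.mem_nhds hx] with y hy
  rw [localRep, Trivialization.continuousLinearMapAt_apply, e.coe_linearMapAt_of_mem hy]

theorem smoothAt_iff_localRep [ContMDiffVectorBundle ∞ F E I] (hx : x ∈ e.baseSet) :
    SmoothAt I F s x ↔ ContMDiffAt I 𝓘(ℝ, F) ∞ (localRep e s) x := by
  rw [SmoothAt, e.contMDiffAt_section_iff hx]
  exact (localRep_eventuallyEq hx s).contMDiffAt_iff

theorem diffAt_iff_localRep [ContMDiffVectorBundle 1 F E I] (hx : x ∈ e.baseSet) :
    DiffAt I F s x ↔ MDifferentiableAt I 𝓘(ℝ, F) (localRep e s) x := by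
  rw [DiffAt, e.mdifferentiableAt_section_iff _ _ hx]
  exact (localRep_eventuallyEq hx s).mdifferentiableAt_iff

theorem diffAt_constSection [ContMDiffVectorBundle 1 F E I] (hx : x ∈ e.baseSet) (f : F) :
    DiffAt I F (constSection e f) x := by
  rw [diffAt_iff_localRep hx]
  refine (mdifferentiableAt_const (c := f)).congr_of_eventuallyEq ?_
  filter_upwards [e.open_baseSet.mem_nhds hx] with y hy using localRep_constSection hy f

theorem smoothAt_constSection [ContMDiffVectorBundle ∞ F E I] (hx : x ∈ e.baseSet) (f : F) :
    SmoothAt I F (constSection e f) x := by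
  rw [smoothAt_iff_localRep hx]
  refine (contMDiffAt_const (c := f)).congr_of_eventuallyEq ?_
  filter_upwards [e.open_baseSet.mem_nhds hx] with y hy using localRep_constSection hy f

theorem smoothNear_constSection [ContMDiffVectorBundle ∞ F E I] (hx : x ∈ e.baseSet) (f : F) :
    SmoothNear I F (constSection e f) x := by
  filter_upwards [e.open_baseSet.mem_nhds hx] with y hy using smoothAt_constSection hy f

theorem smoothAt_coordField [IsManifold I ∞ M] {p : M} (hx : x ∈ (chartAt H p).source) (w : G) :
    SmoothAt (E := fun y : M ↦ TangentSpace I y) I G (fun y ↦ coordField I p y w) x :=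
  smoothAt_constSection (e := trivializationAt G (TangentSpace I) p) (by simpa using hx) w

theorem contDiffWithinAt_localRep [IsManifold I ∞ M] [ContMDiffVectorBundle ∞ F E I] {p : M}
    {z : G} (hz : z ∈ (extChartAt I p).target)
    (hb : (extChartAt I p).symm z ∈ e.baseSet) (hs : SmoothAt I F s ((extChartAt I p).symm z)) :
    ContDiffWithinAt ℝ ∞ (fun z ↦ localRep e s ((extChartAt I p).symm z)) (range I) z :=
  (((smoothAt_iff_localRep hb).1 hs).comp_contMDiffWithinAt z
    (contMDiffOn_extChartAt_symm p z hz)).contDiffWithinAt.mono_of_mem_nhdsWithin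
      (extChartAt_target_mem_nhdsWithin_of_mem hz)

end Sections

section BundleMaps

variable {G H : Type*} [NormedAddCommGroup G] [NormedSpace ℝ G] [TopologicalSpace H]
  {I : ModelWithCorners ℝ G H} {M : Type*} [TopologicalSpace M] [ChartedSpace H M]
  {F : Type*} [NormedAddCommGroup F] [NormedSpace ℝ F]
  {E : M → Type*} [TopologicalSpace (TotalSpace F E)] [∀ x, AddCommGroup (E x)]
  [∀ x, Module ℝ (E x)] [∀ x, TopologicalSpace (E x)] [FiberBundle F E] [VectorBundle ℝ F E]
  {F' : Type*} [NormedAddCommGroup F'] [NormedSpace ℝ F']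
  {E' : M → Type*} [TopologicalSpace (TotalSpace F' E')] [∀ x, AddCommGroup (E' x)]
  [∀ x, Module ℝ (E' x)] [∀ x, TopologicalSpace (E' x)] [∀ x, IsTopologicalAddGroup (E' x)]
  [∀ x, ContinuousSMul ℝ (E' x)] [FiberBundle F' E'] [VectorBundle ℝ F' E']
  {Φ : ∀ y, E y →L[ℝ] E' y} {s : ∀ y, E y} {x : M}

theorem SmoothAt.apply (h : SmoothAt I (F →L[ℝ] F') Φ x) (hs : SmoothAt I F s x) :
    SmoothAt I F' (fun y ↦ Φ y (s y)) x :=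
  ContMDiffAt.clm_bundle_apply h hs

theorem SmoothNear.apply (h : SmoothNear I (F →L[ℝ] F') Φ x) (hs : SmoothNear I F s x) :
    SmoothNear I F' (fun y ↦ Φ y (s y)) x := by
  filter_upwards [h, hs] with y hy hsy using hy.apply hsy

theorem DiffAt.apply [ContMDiffVectorBundle 1 F E I] [ContMDiffVectorBundle 1 F' E' I]
    (h : SmoothAt I (F →L[ℝ] F') Φ x) (hs : DiffAt I F s x) :
    DiffAt I F' (fun y ↦ Φ y (s y)) x :=
  MDifferentiableAt.clm_bundle_apply h.diffAt hs

theorem smoothAt_hom_of_apply [FiniteDimensional ℝ F] [ContMDiffVectorBundle ∞ F' E' I]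
    (h : ∀ f : F, SmoothAt I F' (fun y ↦ Φ y (constSection (trivializationAt F E x) f y)) x) :
    SmoothAt I (F →L[ℝ] F') Φ x :=
  (contMDiffAt_hom_bundle _).2 ⟨contMDiffAt_id, contMDiffAt_clm_of_apply fun f ↦
    (smoothAt_iff_localRep (FiberBundle.mem_baseSet_trivializationAt F' E' x)).1 (h f)⟩

end BundleMaps

/-! ### Connection forms -/

section ConnectionForm

variable {G H : Type*} [NormedAddCommGroup G] [NormedSpace ℝ G] [TopologicalSpace H]
  {I : ModelWithCorners ℝ G H} {M : Type*} [TopologicalSpace M] [ChartedSpace H M]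
  {F : Type*} [NormedAddCommGroup F] [NormedSpace ℝ F]
  {E : M → Type*} [TopologicalSpace (TotalSpace F E)] [∀ x, AddCommGroup (E x)]
  [∀ x, Module ℝ (E x)] [∀ x, TopologicalSpace (E x)] [∀ x, IsTopologicalAddGroup (E x)]
  [∀ x, ContinuousSMul ℝ (E x)] [FiberBundle F E]

theorem cov_congr (D : CovariantDerivative I F E) {s t : ∀ y, E y} {x : M}
    (hs : DiffAt I F s x) (hst : ∀ᶠ y in 𝓝 x, t y = s y) : D t x = D s x :=
  D.isCovariantDerivativeOnUniv.congr_of_eventuallyEq (hs.congr hst) hs Filter.univ_mem hst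

variable [VectorBundle ℝ F E]

theorem smoothAt_cov [FiniteDimensional ℝ G] [T2Space M] [IsManifold I ∞ M]
    [ContMDiffVectorBundle ∞ F E I] {D : CovariantDerivative I F E}
    (hD : CovariantDerivative.ContMDiffCovariantDerivative D ∞) {s : ∀ y, E y} {x : M}
    (hs : SmoothNear I F s x) :
    SmoothAt (E := fun y ↦ TangentSpace I y →L[ℝ] E y) I (G →L[ℝ] F) (D s) x := by
  obtain ⟨U, hU, hsU⟩ := hs.exists_contMDiffOn
  obtain ⟨f, hf⟩ := (SmoothBumpFunction.nhds_basis_tsupport (I := I) x).mem_iff.1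
    (interior_mem_nhds.2 hU)
  have hfs := ContMDiffOn.smul_section_of_tsupport (V := E) (F := F) (s := s)
    f.contMDiff.contMDiffOn isOpen_interior hf.2 (hsU.mono interior_subset)
  have hDfs := hD.contMDiff.contMDiff (σ := (f : M → ℝ) • s) (by simpa using hfs.contMDiffOn)
  refine SmoothAt.congr (hDfs.contMDiffAt (x := x) Filter.univ_mem) ?_
  filter_upwards [f.eventuallyEq_one.eventually_nhds, hs] with y hfy hsy
  refine (cov_congr D hsy.diffAt ?_).symm
  filter_upwards [hfy] with z hfz
  simp [hfz]

variable (e : Trivialization F (π F E)) [MemTrivializationAtlas e]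

variable (I) in
/-- The connection on the domain of the trivialization `e` whose parallel sections are the constant
ones. -/
def flatConnection (s : ∀ y, E y) (x : M) : TangentSpace I x →L[ℝ] E x :=
  e.symmL ℝ x ∘L mvfderiv I (localRep e s) x

variable [ContMDiffVectorBundle 1 F E I]

theorem isCovariantDerivativeOn_flatConnection :
    IsCovariantDerivativeOn F (flatConnection I e) e.baseSet where
  add {s t x} hs ht hx := by
    have hadd : localRep e (s + t) = localRep e s + localRep e t :=
      funext fun y ↦ map_add (e.continuousLinearMapAt ℝ y) _ _
    rw [flatConnection, hadd, mvfderiv_add ((diffAt_iff_localRep hx).1 hs)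
      ((diffAt_iff_localRep hx).1 ht), ContinuousLinearMap.comp_add]
    rfl
  leibniz {s g x} hs hg hx := by
    have hsmul : localRep e (g • s) = g • localRep e s :=
      funext fun y ↦ map_smul (e.continuousLinearMapAt ℝ y) _ _
    rw [flatConnection, hsmul, mvfderiv_smul hg ((diffAt_iff_localRep hx).1 hs)]
    ext v
    have hs_x : e.symmL ℝ x (localRep e s x) = s x := constSection_localRep hx s
    simp [flatConnection, hs_x]

variable [FiniteDimensional ℝ F]

/-- The connection form of `D` in the trivialization `e` and in the chart at `p`: the difference of
`D` and the flat connection of `e`. -/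
def connectionForm (D : CovariantDerivative I F E) (p : M) [IsManifold I 1 M] (z : G) :
    G →L[ℝ] F →L[ℝ] F :=
  (LinearMap.toContinuousLinearMap
    { toFun := fun f ↦ e.continuousLinearMapAt ℝ ((extChartAt I p).symm z) ∘L
        D.isCovariantDerivativeOn.difference (isCovariantDerivativeOn_flatConnection e)
          ((extChartAt I p).symm z) (constSection e f ((extChartAt I p).symm z)) ∘L
        coordField I p ((extChartAt I p).symm z)
      map_add' := fun f g ↦ by
        simp only [constSection, map_add, ContinuousLinearMap.add_comp,
          ContinuousLinearMap.comp_add]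
      map_smul' := fun c f ↦ by
        simp only [constSection, map_smul, ContinuousLinearMap.smul_comp,
          ContinuousLinearMap.comp_smul, RingHom.id_apply] }).flip

variable {e} [IsManifold I 1 M]

theorem connectionForm_apply (D : CovariantDerivative I F E) (p : M) (z w : G) (f : F) :
    connectionForm e D p z w f = e.continuousLinearMapAt ℝ ((extChartAt I p).symm z)
      (D.isCovariantDerivativeOn.difference (isCovariantDerivativeOn_flatConnection e)
        ((extChartAt I p).symm z) (constSection e f ((extChartAt I p).symm z))
        (coordField I p ((extChartAt I p).symm z) w)) :=
  rfl

theorem localRep_cov {D : CovariantDerivative I F E} {p : M} {z : G}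
    (hz : z ∈ (extChartAt I p).target) (hb : (extChartAt I p).symm z ∈ e.baseSet)
    {s : ∀ y, E y} (hs : DiffAt I F s ((extChartAt I p).symm z)) (w : G) :
    e.continuousLinearMapAt ℝ ((extChartAt I p).symm z)
        (D s ((extChartAt I p).symm z) (coordField I p ((extChartAt I p).symm z) w))
      = fderivWithin ℝ (fun z ↦ localRep e s ((extChartAt I p).symm z)) (range I) z w
        + connectionForm e D p z w (localRep e s ((extChartAt I p).symm z)) := by
  have hdiff := IsCovariantDerivativeOn.difference_apply D.isCovariantDerivativeOn
    (isCovariantDerivativeOn_flatConnection e) hb hs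
  rw [fderivWithin_comp_symm hz ((diffAt_iff_localRep hb).1 hs), connectionForm_apply,
    constSection_localRep hb, hdiff, sub_apply, map_sub, flatConnection,
    ContinuousLinearMap.comp_apply, e.continuousLinearMapAt_symmL hb, add_sub_cancel]

theorem connectionForm_eq_cov_constSection {D : CovariantDerivative I F E} {p : M} {z : G}
    (hb : (extChartAt I p).symm z ∈ e.baseSet) {f : F}
    (hf : DiffAt I F (constSection e f) ((extChartAt I p).symm z)) (w : G) :
    connectionForm e D p z w f = e.continuousLinearMapAt ℝ ((extChartAt I p).symm z)
      (D (constSection e f) ((extChartAt I p).symm z)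
        (coordField I p ((extChartAt I p).symm z) w)) := by
  have hflat : flatConnection I e (constSection e f) ((extChartAt I p).symm z) = 0 := by
    have hconst : localRep e (constSection e f) =ᶠ[𝓝 ((extChartAt I p).symm z)] fun _ ↦ f := by
      filter_upwards [e.open_baseSet.mem_nhds hb] with y hy using localRep_constSection hy f
    have hderiv : mvfderiv I (localRep e (constSection e f)) ((extChartAt I p).symm z) = 0 := by
      rw [mvfderiv, hconst.mfderiv_eq, mfderiv_const]
      exact ContinuousLinearMap.comp_zero _
    rw [flatConnection, hderiv, ContinuousLinearMap.comp_zero]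
  rw [connectionForm_apply, IsCovariantDerivativeOn.difference_apply _ _ hb hf, hflat, sub_zero]

theorem contDiffWithinAt_connectionForm [FiniteDimensional ℝ G] [T2Space M] [IsManifold I ∞ M]
    [ContMDiffVectorBundle ∞ F E I] {D : CovariantDerivative I F E}
    (hD : CovariantDerivative.ContMDiffCovariantDerivative D ∞) {p : M} {z : G}
    (hz : z ∈ (extChartAt I p).target) (hb : (extChartAt I p).symm z ∈ e.baseSet) :
    ContDiffWithinAt ℝ ∞ (connectionForm e D p) (range I) z := by
  refine contDiffWithinAt_clm_of_apply fun w ↦ contDiffWithinAt_clm_of_apply fun f ↦ ?_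
  have hsmooth := contDiffWithinAt_localRep hz hb (SmoothAt.apply
    (smoothAt_cov hD (smoothNear_constSection hb f))
    (smoothAt_coordField (symm_mem_chart_source hz) w))
  refine hsmooth.congr_of_eventuallyEq_of_mem ?_ (extChartAt_target_subset_range p hz)
  filter_upwards [eventually_mem_target_and_symm hz (e.open_baseSet.mem_nhds hb)] with y hy
  exact connectionForm_eq_cov_constSection hy.2 (smoothAt_constSection hy.2 f).diffAt w

end ConnectionForm

/-! ### Curvature forms -/

section CurvatureForm

variable {G F : Type*} [NormedAddCommGroup G] [NormedSpace ℝ G] [NormedAddCommGroup F]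
  [NormedSpace ℝ F]

/-- The curvature `∂_u Γ_v - ∂_v Γ_u + [Γ_u, Γ_v]` of the connection form `Γ` on the set `S`. -/
def curvatureForm (S : Set G) (Γ : G → G →L[ℝ] F →L[ℝ] F) (z u v : G) : F →L[ℝ] F :=
  fderivWithin ℝ Γ S z u v - fderivWithin ℝ Γ S z v u + (Γ z u * Γ z v - Γ z v * Γ z u)

/-- The covariant derivative `∂_X g + Γ_X g` on the set `S`, along the vector field `X` and for the
connection form `Γ`. -/
def covariantForm (S : Set G) (Γ : G → G →L[ℝ] F →L[ℝ] F) (X : G → G) (g : G → F) (z : G) : F :=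
  fderivWithin ℝ g S z (X z) + Γ z (X z) (g z)

variable {S : Set G} {Γ : G → G →L[ℝ] F →L[ℝ] F} {X Y : G → G} {g g' : G → F} {z : G}

theorem covariantForm_congr (hz : z ∈ S) (h : g =ᶠ[𝓝[S] z] g') :
    covariantForm S Γ X g z = covariantForm S Γ X g' z := by
  have hgz := h.eq_of_nhdsWithin hz
  rw [covariantForm, covariantForm, h.fderivWithin_eq hgz, hgz]

variable (hS : UniqueDiffOn ℝ S) (hz : z ∈ S) (hΓ : DifferentiableWithinAt ℝ Γ S z)
  (hg : ContDiffWithinAt ℝ 2 g S z)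
include hS hz hΓ hg

theorem fderivWithin_covariantForm (hX : DifferentiableWithinAt ℝ X S z) (w : G) :
    fderivWithin ℝ (covariantForm S Γ X g) S z w
      = fderivWithin ℝ (fderivWithin ℝ g S) S z w (X z)
        + fderivWithin ℝ g S z (fderivWithin ℝ X S z w)
        + (fderivWithin ℝ Γ S z w (X z) (g z) + Γ z (fderivWithin ℝ X S z w) (g z)
          + Γ z (X z) (fderivWithin ℝ g S z w)) := by
  have hg' : DifferentiableWithinAt ℝ (fderivWithin ℝ g S) S z :=
    (hg.fderivWithin_right (m := 1) hS (by norm_num) hz).differentiableWithinAt one_ne_zero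
  have hderiv : HasFDerivWithinAt (covariantForm S Γ X g) _ S z :=
    (hg'.hasFDerivWithinAt.clm_apply hX.hasFDerivWithinAt).add
      ((hΓ.hasFDerivWithinAt.clm_apply hX.hasFDerivWithinAt).clm_apply
        (hg.differentiableWithinAt two_ne_zero).hasFDerivWithinAt)
  rw [hderiv.fderivWithin (hS z hz)]
  simp only [ContinuousLinearMap.flip_add, add_apply, ContinuousLinearMap.comp_apply,
    ContinuousLinearMap.flip_apply]
  abel

theorem curvatureForm_apply (hzS : z ∈ closure (interior S))
    (hX : DifferentiableWithinAt ℝ X S z) (hY : DifferentiableWithinAt ℝ Y S z) :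
    curvatureForm S Γ z (X z) (Y z) (g z)
      = covariantForm S Γ X (covariantForm S Γ Y g) z
        - covariantForm S Γ Y (covariantForm S Γ X g) z
        - covariantForm S Γ (VectorField.lieBracketWithin ℝ X Y S) g z := by
  have hsymm : IsSymmSndFDerivWithinAt ℝ g S z :=
    hg.isSymmSndFDerivWithinAt (by simp) hS hzS hz
  have happly (X' : G → G) (g' : G → F) : covariantForm S Γ X' g' z
      = fderivWithin ℝ g' S z (X' z) + Γ z (X' z) (g' z) := rfl
  rw [happly X, happly Y (covariantForm S Γ X g), happly (VectorField.lieBracketWithin ℝ X Y S),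
    fderivWithin_covariantForm hS hz hΓ hg hY, fderivWithin_covariantForm hS hz hΓ hg hX,
    hsymm.eq (X z) (Y z)]
  simp only [curvatureForm, VectorField.lieBracketWithin, happly, map_sub, map_add, add_apply,
    sub_apply, mul_apply_eq_comp]
  abel

end CurvatureForm

section LieBracket

variable {G H : Type*} [NormedAddCommGroup G] [NormedSpace ℝ G] [TopologicalSpace H]
  {I : ModelWithCorners ℝ G H} {M : Type*} [TopologicalSpace M] [ChartedSpace H M]
  [IsManifold I ∞ M]

theorem mpullbackWithin_extChartAt_symm (X : ∀ y : M, TangentSpace I y) {p : M} {z : G}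
    (hz : z ∈ (extChartAt I p).target) :
    VectorField.mpullbackWithin 𝓘(ℝ, G) I (extChartAt I p).symm X (range I) z
      = chartCoords I p ((extChartAt I p).symm z) (X ((extChartAt I p).symm z)) := by
  have hx := symm_mem_chart_source hz
  refine DFunLike.congr_fun (ContinuousLinearMap.inverse_eq (f := mfderivWithin 𝓘(ℝ, G) I
    (extChartAt I p).symm (range I) z) ?_ ?_) _
  · refine ContinuousLinearMap.ext fun v ↦ ?_
    exact (mfderivWithin_symm_eq hz _).trans (coordField_chartCoords hx v)
  · refine ContinuousLinearMap.ext fun (w : G) ↦ ?_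
    exact (congrArg (chartCoords I p _) (mfderivWithin_symm_eq hz w)).trans
      (chartCoords_coordField hx w)

theorem chartCoords_mlieBracket [CompleteSpace G] {X Y : ∀ y : M, TangentSpace I y} {p : M} {z : G}
    (hz : z ∈ (extChartAt I p).target)
    (hX : DiffAt I G X ((extChartAt I p).symm z)) (hY : DiffAt I G Y ((extChartAt I p).symm z)) :
    chartCoords I p ((extChartAt I p).symm z)
        (VectorField.mlieBracket I X Y ((extChartAt I p).symm z))
      = VectorField.lieBracketWithin ℝ
        (fun z ↦ chartCoords I p ((extChartAt I p).symm z) (X ((extChartAt I p).symm z)))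
        (fun z ↦ chartCoords I p ((extChartAt I p).symm z) (Y ((extChartAt I p).symm z)))
        (range I) z := by
  have hsmoothness : minSmoothness ℝ 3 ≤ ∞ := by
    rw [minSmoothness_of_isRCLikeNormedField]; exact ENat.LEInfty.out
  have : IsManifold I (minSmoothness ℝ 3) M := .of_le (n := ∞) hsmoothness
  have hzr := extChartAt_target_subset_range p hz
  have hT := extChartAt_target_mem_nhdsWithin_of_mem hz
  have hpullback := VectorField.mpullbackWithin_mlieBracketWithin (I := 𝓘(ℝ, G)) (I' := I)
    (f := (extChartAt I p).symm) (V := X) (W := Y) (s := range I) (t := univ) (n := ∞)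
    (x₀ := z) hX.mdifferentiableWithinAt hY.mdifferentiableWithinAt
    I.uniqueDiffOn.uniqueMDiffOn
    ((contMDiffOn_extChartAt_symm p z hz).mono_of_mem_nhdsWithin hT) hzr
    (by rw [minSmoothness_of_isRCLikeNormedField]; exact ENat.LEInfty.out)
    (by simp) (I.range_subset_closure_interior hzr)
  rw [mpullbackWithin_extChartAt_symm _ hz, VectorField.mlieBracketWithin_univ,
    VectorField.mlieBracketWithin_eq_lieBracketWithin] at hpullback
  rw [hpullback]
  refine Filter.EventuallyEq.lieBracketWithin_vectorField_eq ?_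
    (mpullbackWithin_extChartAt_symm X hz) ?_ (mpullbackWithin_extChartAt_symm Y hz)
  · filter_upwards [hT] with y hy using mpullbackWithin_extChartAt_symm X hy
  · filter_upwards [hT] with y hy using mpullbackWithin_extChartAt_symm Y hy

theorem differentiableWithinAt_chartCoords {X : ∀ y : M, TangentSpace I y} {p : M} {z : G}
    (hz : z ∈ (extChartAt I p).target) (hX : SmoothAt I G X ((extChartAt I p).symm z)) :
    DifferentiableWithinAt ℝ (fun z ↦ chartCoords I p ((extChartAt I p).symm z)
      (X ((extChartAt I p).symm z))) (range I) z := by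
  have hsmooth := contDiffWithinAt_localRep (e := trivializationAt G (TangentSpace I) p) hz
    (by simpa using symm_mem_chart_source hz) hX
  refine (hsmooth.differentiableWithinAt (by simp)).congr_of_eventuallyEq_of_mem ?_
    (extChartAt_target_subset_range p hz)
  filter_upwards [extChartAt_target_mem_nhdsWithin_of_mem hz] with y hy
  rw [chartCoords_eq (symm_mem_chart_source hy)]
  rfl

end LieBracket

section Curvature

variable {G H : Type*} [NormedAddCommGroup G] [NormedSpace ℝ G] [TopologicalSpace H]
  {I : ModelWithCorners ℝ G H} {M : Type*} [TopologicalSpace M] [ChartedSpace H M]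
  {F : Type*} [NormedAddCommGroup F] [NormedSpace ℝ F] [FiniteDimensional ℝ F]
  {E : M → Type*} [TopologicalSpace (TotalSpace F E)] [∀ x, AddCommGroup (E x)]
  [∀ x, Module ℝ (E x)] [∀ x, TopologicalSpace (E x)] [∀ x, IsTopologicalAddGroup (E x)]
  [∀ x, ContinuousSMul ℝ (E x)] [FiberBundle F E] [VectorBundle ℝ F E]
  {e : Trivialization F (π F E)} [MemTrivializationAtlas e]

theorem localRep_cov_field [IsManifold I 1 M] [ContMDiffVectorBundle 1 F E I]
    {D : CovariantDerivative I F E} {p : M} {z : G}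
    (hz : z ∈ (extChartAt I p).target) (hb : (extChartAt I p).symm z ∈ e.baseSet)
    {s : ∀ y, E y} (hs : DiffAt I F s ((extChartAt I p).symm z))
    (X : ∀ y : M, TangentSpace I y) :
    localRep e (fun y ↦ D s y (X y)) ((extChartAt I p).symm z)
      = covariantForm (range I) (connectionForm e D p)
        (fun z ↦ chartCoords I p ((extChartAt I p).symm z) (X ((extChartAt I p).symm z)))
        (fun z ↦ localRep e s ((extChartAt I p).symm z)) z := by
  have hcov := localRep_cov (D := D) hz hb hs
    (chartCoords I p _ (X ((extChartAt I p).symm z)))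
  rwa [coordField_chartCoords (symm_mem_chart_source hz)] at hcov

theorem localRep_cov_cov [FiniteDimensional ℝ G] [T2Space M] [IsManifold I ∞ M]
    [ContMDiffVectorBundle ∞ F E I] {D : CovariantDerivative I F E}
    (hD : CovariantDerivative.ContMDiffCovariantDerivative D ∞) {p : M} {z : G}
    (hz : z ∈ (extChartAt I p).target) (hb : (extChartAt I p).symm z ∈ e.baseSet)
    {s : ∀ y, E y} (hs : SmoothNear I F s ((extChartAt I p).symm z))
    (X : ∀ y : M, TangentSpace I y) {Y : ∀ y : M, TangentSpace I y}
    (hY : SmoothAt I G Y ((extChartAt I p).symm z)) :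
    localRep e (fun y ↦ D (fun y ↦ D s y (Y y)) y (X y)) ((extChartAt I p).symm z)
      = covariantForm (range I) (connectionForm e D p)
        (fun z ↦ chartCoords I p ((extChartAt I p).symm z) (X ((extChartAt I p).symm z)))
        (covariantForm (range I) (connectionForm e D p)
          (fun z ↦ chartCoords I p ((extChartAt I p).symm z) (Y ((extChartAt I p).symm z)))
          (fun z ↦ localRep e s ((extChartAt I p).symm z))) z := by
  rw [localRep_cov_field hz hb ((smoothAt_cov hD hs).apply hY).diffAt]
  refine covariantForm_congr (extChartAt_target_subset_range p hz) ?_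
  filter_upwards [eventually_mem_target_and_symm hz (hs.and (e.open_baseSet.mem_nhds hb))]
    with y ⟨hy, hsy, hby⟩
  exact localRep_cov_field hy hby hsy.diffAt Y

end Curvature

section SurfaceCurvature

variable {F : Type*} [NormedAddCommGroup F] [NormedSpace ℝ F] {M : Type*} [TopologicalSpace M]
  {E : M → Type*} [TopologicalSpace (TotalSpace F E)] [∀ x, AddCommGroup (E x)]
  [∀ x, Module ℝ (E x)] [∀ x, TopologicalSpace (E x)] [FiberBundle F E] [VectorBundle ℝ F E]

theorem localExtension_self {x : M} (f : E x) : localExtension F f x = f :=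
  (trivializationAt F E x).symmL_continuousLinearMapAt
    (FiberBundle.mem_baseSet_trivializationAt F E x) f

variable [ChartedSpace (EuclideanHalfSpace 2) M] [ContMDiffVectorBundle ∞ F E (𝓡∂ 2)]

theorem smoothNear_extend {x : M} (f : E x) :
    SmoothNear (𝓡∂ 2) F (FiberBundle.extend F f) x :=
  have ⟨_, hU, hs⟩ := FiberBundle.exists_contMDiffOn_extend (𝓡∂ 2) F f (k := ∞)
  .of_contMDiffOn hU hs

variable [IsManifold (𝓡∂ 2) ∞ M] [∀ x, IsTopologicalAddGroup (E x)] [∀ x, ContinuousSMul ℝ (E x)]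

theorem smoothNear_localExtension {x : M} (f : E x) :
    SmoothNear (𝓡∂ 2) F (localExtension F f) x :=
  have ⟨_, hU, hs⟩ := contMDiffOn_localExtension (F := F) f
  .of_contMDiffOn hU hs

variable [T2Space M] [FiniteDimensional ℝ F] {e : Trivialization F (π F E)}
  [MemTrivializationAtlas e]
  {D : CovariantDerivative (𝓡∂ 2) F E}
  (hD : CovariantDerivative.ContMDiffCovariantDerivative D ∞)
include hD

theorem localRep_curvatureAux {p : M} {z : ℝ²} (hz : z ∈ (extChartAt (𝓡∂ 2) p).target)
    (hb : (extChartAt (𝓡∂ 2) p).symm z ∈ e.baseSet) {s : ∀ y, E y}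
    {X Y : ∀ y : M, TangentSpace (𝓡∂ 2) y}
    (hs : SmoothNear (𝓡∂ 2) F s ((extChartAt (𝓡∂ 2) p).symm z))
    (hX : SmoothAt (𝓡∂ 2) ℝ² X ((extChartAt (𝓡∂ 2) p).symm z))
    (hY : SmoothAt (𝓡∂ 2) ℝ² Y ((extChartAt (𝓡∂ 2) p).symm z)) :
    localRep e (curvatureAux D X Y s) ((extChartAt (𝓡∂ 2) p).symm z)
      = curvatureForm ℍ (connectionForm e D p) z
        (chartCoords (𝓡∂ 2) p _ (X ((extChartAt (𝓡∂ 2) p).symm z)))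
        (chartCoords (𝓡∂ 2) p _ (Y ((extChartAt (𝓡∂ 2) p).symm z)))
        (localRep e s ((extChartAt (𝓡∂ 2) p).symm z)) := by
  have hzr := extChartAt_target_subset_range p hz
  have hcurv := curvatureForm_apply (𝓡∂ 2).uniqueDiffOn hzr
    ((contDiffWithinAt_connectionForm hD hz hb).differentiableWithinAt (by simp))
    ((contDiffWithinAt_localRep hz hb hs.smoothAt).of_le ENat.LEInfty.out)
    ((𝓡∂ 2).range_subset_closure_interior hzr)
    (differentiableWithinAt_chartCoords hz hX) (differentiableWithinAt_chartCoords hz hY)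
  rw [hcurv, ← localRep_cov_cov hD hz hb hs X hY, ← localRep_cov_cov hD hz hb hs Y hX]
  refine (map_sub (e.continuousLinearMapAt ℝ _) _ _).trans ?_
  rw [map_sub]
  congr 1
  refine (localRep_cov_field hz hb hs.smoothAt.diffAt
    (VectorField.mlieBracket (𝓡∂ 2) X Y)).trans ?_
  rw [covariantForm, covariantForm, chartCoords_mlieBracket hz hX.diffAt hY.diffAt]

theorem localRep_curvature {p : M} {z : ℝ²} (hz : z ∈ (extChartAt (𝓡∂ 2) p).target)
    (hb : (extChartAt (𝓡∂ 2) p).symm z ∈ e.baseSet)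
    (u v : TangentSpace (𝓡∂ 2) ((extChartAt (𝓡∂ 2) p).symm z))
    (f : E ((extChartAt (𝓡∂ 2) p).symm z)) :
    e.continuousLinearMapAt ℝ _ (curvature D hD _ u v f)
      = curvatureForm ℍ (connectionForm e D p) z (chartCoords (𝓡∂ 2) p _ u)
        (chartCoords (𝓡∂ 2) p _ v) (e.continuousLinearMapAt ℝ _ f) := by
  have hcurv := localRep_curvatureAux hD hz hb (smoothNear_localExtension f)
    (smoothNear_extend u).smoothAt (smoothNear_extend v).smoothAt
  rw [FiberBundle.extend_apply_self, FiberBundle.extend_apply_self, localRep, localRep,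
    localExtension_self] at hcurv
  exact hcurv

theorem curvatureAux_eq_curvature {x : M} {s : ∀ y, E y} {X Y : ∀ y : M, TangentSpace (𝓡∂ 2) y}
    (hs : SmoothNear (𝓡∂ 2) F s x) (hX : SmoothAt (𝓡∂ 2) ℝ² X x) (hY : SmoothAt (𝓡∂ 2) ℝ² Y x) :
    curvatureAux D X Y s x = curvature D hD x (X x) (Y x) (s x) := by
  obtain ⟨p, z, hz, rfl⟩ : ∃ p, ∃ z ∈ (extChartAt (𝓡∂ 2) p).target,
      (extChartAt (𝓡∂ 2) p).symm z = x := ⟨x, _, mem_extChartAt_target x, extChartAt_to_inv x⟩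
  have hb := FiberBundle.mem_baseSet_trivializationAt F E ((extChartAt (𝓡∂ 2) p).symm z)
  have heq := (localRep_curvatureAux hD hz hb hs hX hY).trans
    (localRep_curvature hD hz hb _ _ _).symm
  rw [localRep, ← Trivialization.coe_continuousLinearEquivAt_eq _ hb] at heq
  exact ((trivializationAt F E _).continuousLinearEquivAt ℝ _ hb).injective heq

end SurfaceCurvature

/-! ### Traces of curvature forms -/

section Trace

variable {F : Type*} [NormedAddCommGroup F] [NormedSpace ℝ F]
  {G : Type*} [NormedAddCommGroup G] [NormedSpace ℝ G] {S : Set G} {z : G}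

theorem continuousWithinAt_curvatureForm {Γ : G → G →L[ℝ] F →L[ℝ] F} (hS : UniqueDiffOn ℝ S)
    (hz : z ∈ S) (hΓ : ContDiffWithinAt ℝ 1 Γ S z) (u v : G) :
    ContinuousWithinAt (fun z ↦ curvatureForm S Γ z u v) S z := by
  have hΓw (w : G) : ContinuousWithinAt (fun z ↦ Γ z w) S z :=
    hΓ.continuousWithinAt.clm_apply continuousWithinAt_const
  have hdΓ (u v : G) : ContinuousWithinAt (fun z ↦ fderivWithin ℝ Γ S z u v) S z :=
    ((hΓ.fderivWithin_right (m := 0) hS (by simp) hz).continuousWithinAt.clm_apply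
      continuousWithinAt_const).clm_apply continuousWithinAt_const
  exact ((hdΓ u v).sub (hdΓ v u)).add
    (((hΓw u).mul (hΓw v)).sub ((hΓw v).mul (hΓw u)))

theorem hasFDerivWithinAt_sub_apply {Γ Γ' : G → G →L[ℝ] F}
    (hΓ : DifferentiableWithinAt ℝ Γ S z) (hΓ' : DifferentiableWithinAt ℝ Γ' S z) (v : G) :
    HasFDerivWithinAt (fun z ↦ Γ' z v - Γ z v)
      ((fderivWithin ℝ Γ' S z - fderivWithin ℝ Γ S z).flip v) S z :=
  (ContinuousLinearMap.apply ℝ F v).hasFDerivAt.comp_hasFDerivWithinAt z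
    (hΓ'.hasFDerivWithinAt.sub hΓ.hasFDerivWithinAt)

variable [FiniteDimensional ℝ F]

variable (F) in
/-- The trace of endomorphisms of `F`, as a continuous linear form. -/
def traceCLM : (F →L[ℝ] F) →L[ℝ] ℝ :=
  LinearMap.toContinuousLinearMap (LinearMap.trace ℝ F ∘ₗ ContinuousLinearMap.coeLM ℝ)

theorem traceCLM_apply (a : F →L[ℝ] F) : traceCLM F a = LinearMap.trace ℝ F (a : F →ₗ[ℝ] F) :=
  rfl

theorem traceCLM_mul_comm (a b : F →L[ℝ] F) : traceCLM F (a * b) = traceCLM F (b * a) :=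
  LinearMap.trace_mul_comm ℝ (a : F →ₗ[ℝ] F) (b : F →ₗ[ℝ] F)

theorem traceCLM_transgression {k a b a' b' p q p' q' : F →L[ℝ] F}
    (ha : k * (a' - a) = (a' - a) * k) (hb : k * (b' - b) = (b' - b) * k) :
    traceCLM F (k * (p' - q' + (a' * b' - b' * a'))) - traceCLM F (k * (p - q + (a * b - b * a)))
      = traceCLM F ((k * a - a * k) * (b' - b) + k * (p' - p))
        - traceCLM F ((k * b - b * k) * (a' - a) + k * (q' - q)) := by
  obtain ⟨α, rfl⟩ : ∃ α, a' = a + α := ⟨a' - a, by abel⟩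
  obtain ⟨β, rfl⟩ : ∃ β, b' = b + β := ⟨b' - b, by abel⟩
  rw [add_sub_cancel_left] at ha hb ⊢
  rw [add_sub_cancel_left]
  have hβa : traceCLM F (k * (β * a)) = traceCLM F (a * (k * β)) := by
    rw [← mul_assoc, traceCLM_mul_comm]
  have hαb : traceCLM F (k * (α * b)) = traceCLM F (b * (k * α)) := by
    rw [← mul_assoc, traceCLM_mul_comm]
  have hβα : traceCLM F (k * (β * α)) = traceCLM F (k * (α * β)) := by
    rw [← mul_assoc, hb, mul_assoc, traceCLM_mul_comm, mul_assoc]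
  simp only [mul_add, add_mul, mul_sub, sub_mul, map_add, map_sub, mul_assoc, hβa, hαb, hβα]
  ring

theorem mul_sub_comm_of_commutator_eq {R : Type*} [Ring R] {k a a' : R}
    (h : k * a - a * k = k * a' - a' * k) : k * (a' - a) = (a' - a) * k := by
  rw [mul_sub, sub_mul, sub_eq_sub_iff_sub_eq_sub, h]

theorem fderivWithin_traceCLM_mul {K A : G → F →L[ℝ] F} (hS : UniqueDiffWithinAt ℝ S z)
    (hK : DifferentiableWithinAt ℝ K S z) (hA : DifferentiableWithinAt ℝ A S z) (w : G) :
    fderivWithin ℝ (fun z ↦ traceCLM F (K z * A z)) S z w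
      = traceCLM F (fderivWithin ℝ K S z w * A z + K z * fderivWithin ℝ A S z w) := by
  have hderiv : HasFDerivWithinAt (fun z ↦ traceCLM F (K z * A z)) _ S z :=
    (traceCLM F).hasFDerivAt.comp_hasFDerivWithinAt z
      (hK.hasFDerivWithinAt.mul' hA.hasFDerivWithinAt)
  rw [hderiv.fderivWithin hS]
  exact congrArg (traceCLM F) (add_comm _ _)

theorem traceCLM_mul_curvatureForm_sub {Γ Γ' : G → G →L[ℝ] F →L[ℝ] F} {K : G → F →L[ℝ] F}
    (hS : UniqueDiffWithinAt ℝ S z) (hΓ : DifferentiableWithinAt ℝ Γ S z)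
    (hΓ' : DifferentiableWithinAt ℝ Γ' S z) (hK : DifferentiableWithinAt ℝ K S z)
    (h : ∀ w, fderivWithin ℝ K S z w = K z * Γ z w - Γ z w * K z)
    (h' : ∀ w, fderivWithin ℝ K S z w = K z * Γ' z w - Γ' z w * K z) (u v : G) :
    traceCLM F (K z * curvatureForm S Γ' z u v) - traceCLM F (K z * curvatureForm S Γ z u v)
      = fderivWithin ℝ (fun z ↦ traceCLM F (K z * (Γ' z v - Γ z v))) S z u
        - fderivWithin ℝ (fun z ↦ traceCLM F (K z * (Γ' z u - Γ z u))) S z v := by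
  have hderiv (v w : G) : fderivWithin ℝ (fun z ↦ traceCLM F (K z * (Γ' z v - Γ z v))) S z w
      = traceCLM F ((K z * Γ z w - Γ z w * K z) * (Γ' z v - Γ z v)
        + K z * (fderivWithin ℝ Γ' S z w v - fderivWithin ℝ Γ S z w v)) := by
    have hsub := hasFDerivWithinAt_sub_apply hΓ hΓ' v
    rw [fderivWithin_traceCLM_mul hS hK hsub.differentiableWithinAt, hsub.fderivWithin hS, h]
    rfl
  rw [hderiv, hderiv, curvatureForm, curvatureForm]
  exact traceCLM_transgression (mul_sub_comm_of_commutator_eq ((h u).symm.trans (h' u)))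
    (mul_sub_comm_of_commutator_eq ((h v).symm.trans (h' v)))

end Trace

/-! ### Parallel endomorphisms and trace forms -/

section TraceForm

variable {G H : Type*} [NormedAddCommGroup G] [NormedSpace ℝ G] [TopologicalSpace H]
  {I : ModelWithCorners ℝ G H} {M : Type*} [TopologicalSpace M] [ChartedSpace H M]
  {F : Type*} [NormedAddCommGroup F] [NormedSpace ℝ F]
  {E : M → Type*} [TopologicalSpace (TotalSpace F E)] [∀ x, AddCommGroup (E x)]
  [∀ x, Module ℝ (E x)] [∀ x, TopologicalSpace (E x)] [FiberBundle F E] [VectorBundle ℝ F E]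
  {e : Trivialization F (π F E)} [MemTrivializationAtlas e]

variable (e) in
/-- The expression of the field `K` of endomorphisms of `E` in the trivialization `e`. -/
def localRepHom (K : ∀ y, E y →L[ℝ] E y) (y : M) : F →L[ℝ] F :=
  e.continuousLinearMapAt ℝ y ∘L K y ∘L e.symmL ℝ y

theorem localRepHom_continuousLinearMapAt {x : M} (hx : x ∈ e.baseSet) (K : ∀ y, E y →L[ℝ] E y)
    (f : E x) :
    localRepHom e K x (e.continuousLinearMapAt ℝ x f) = e.continuousLinearMapAt ℝ x (K x f) := by
  rw [localRepHom, ContinuousLinearMap.comp_apply, ContinuousLinearMap.comp_apply,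
    e.symmL_continuousLinearMapAt hx]

theorem trace_eq_traceCLM [FiniteDimensional ℝ F] {x : M} (hx : x ∈ e.baseSet)
    (A : E x →ₗ[ℝ] E x) (B : F →L[ℝ] F)
    (h : ∀ f, e.continuousLinearMapAt ℝ x (A f) = B (e.continuousLinearMapAt ℝ x f)) :
    LinearMap.trace ℝ (E x) A = traceCLM F B := by
  let φ := (e.continuousLinearEquivAt ℝ x hx).toLinearEquiv
  have hφ (f : E x) : φ f = e.continuousLinearMapAt ℝ x f := by
    rw [Trivialization.continuousLinearMapAt_apply, e.coe_linearMapAt_of_mem hx]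
    rfl
  have hconj : φ.conj A = B := by
    ext f
    obtain ⟨f, rfl⟩ := φ.surjective f
    rw [LinearEquiv.conj_apply_apply, LinearEquiv.symm_apply_apply, hφ, hφ, h]
    rfl
  rw [traceCLM_apply, ← hconj, LinearMap.trace_conj']

variable [∀ x, IsTopologicalAddGroup (E x)] [∀ x, ContinuousSMul ℝ (E x)]

/-- The field `K` of endomorphisms of `E` is parallel for the connection `D`. -/
def IsParallel (D : CovariantDerivative I F E) (K : ∀ y, E y →L[ℝ] E y) : Prop :=
  ∀ (s : ∀ y, E y) (x : M), DiffAt I F s x → ∀ v, D (fun y ↦ K y (s y)) x v = K x (D s x v)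

variable [FiniteDimensional ℝ F]

theorem contDiffWithinAt_localRepHom [IsManifold I ∞ M] [ContMDiffVectorBundle ∞ F E I]
    {K : ∀ y, E y →L[ℝ] E y} {p : M} {z : G}
    (hz : z ∈ (extChartAt I p).target) (hb : (extChartAt I p).symm z ∈ e.baseSet)
    (hK : SmoothAt (E := fun y ↦ E y →L[ℝ] E y) I (F →L[ℝ] F) K ((extChartAt I p).symm z)) :
    ContDiffWithinAt ℝ ∞ (fun z ↦ localRepHom e K ((extChartAt I p).symm z)) (range I) z :=
  contDiffWithinAt_clm_of_apply fun f ↦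
    contDiffWithinAt_localRep hz hb (hK.apply (smoothAt_constSection hb f))

theorem fderivWithin_localRepHom [IsManifold I ∞ M] [ContMDiffVectorBundle ∞ F E I]
    {D : CovariantDerivative I F E} {K : ∀ y, E y →L[ℝ] E y} (hDK : IsParallel D K) {p : M} {z : G}
    (hz : z ∈ (extChartAt I p).target) (hb : (extChartAt I p).symm z ∈ e.baseSet)
    (hK : SmoothAt (E := fun y ↦ E y →L[ℝ] E y) I (F →L[ℝ] F) K ((extChartAt I p).symm z))
    (w : G) :
    fderivWithin ℝ (fun z ↦ localRepHom e K ((extChartAt I p).symm z)) (range I) z w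
      = localRepHom e K ((extChartAt I p).symm z) * connectionForm e D p z w
        - connectionForm e D p z w * localRepHom e K ((extChartAt I p).symm z) := by
  ext f
  have hf := smoothAt_constSection (I := I) hb f
  have hcov := localRep_cov (D := D) hz hb (hK.apply hf).diffAt w
  rw [hDK _ _ hf.diffAt, ← localRepHom_continuousLinearMapAt hb,
    ← connectionForm_eq_cov_constSection hb hf.diffAt] at hcov
  have hderiv := (((contDiffWithinAt_localRepHom hz hb hK).differentiableWithinAt
    (by simp)).hasFDerivWithinAt.clm_apply (hasFDerivWithinAt_const f z _)).fderivWithin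
    (I.uniqueDiffOn z (extChartAt_target_subset_range p hz))
  have hKf : fderivWithin ℝ (fun z ↦ localRep e (fun y ↦ K y (constSection e f y))
      ((extChartAt I p).symm z)) (range I) z w = _ := DFunLike.congr_fun hderiv w
  rw [hKf] at hcov
  simp only [add_apply, sub_apply, ContinuousLinearMap.comp_apply, zero_apply, map_zero, zero_add,
    ContinuousLinearMap.flip_apply, mul_apply_eq_comp] at hcov ⊢
  rw [hcov]
  exact (add_sub_cancel_right _ _).symm

variable [ContMDiffVectorBundle 1 F E I]

/-- The one-form `D' - D` with values in the endomorphisms of `E`, for two connections `D`, `D'`. -/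
def differenceForm (D D' : CovariantDerivative I F E) (x : M) :
    TangentSpace I x →ₗ[ℝ] E x →ₗ[ℝ] E x :=
  (ContinuousLinearMap.coeLM ℝ ∘ₗ (D'.difference D x).toLinearMap).flip

theorem differenceForm_apply {D D' : CovariantDerivative I F E} {s : ∀ y, E y} {x : M}
    (hs : DiffAt I F s x) (v : TangentSpace I x) :
    differenceForm D D' x v (s x) = D' s x v - D s x v :=
  DFunLike.congr_fun (IsCovariantDerivativeOn.difference_apply D'.isCovariantDerivativeOnUniv
    D.isCovariantDerivativeOnUniv trivial hs) v

variable [FiniteDimensional ℝ G]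

/-- The one-form `tr (K (D' - D))`. -/
def traceForm (K : ∀ y, E y →L[ℝ] E y) (D D' : CovariantDerivative I F E) (x : M) :
    TangentSpace I x →L[ℝ] ℝ :=
  LinearMap.toContinuousLinearMap (𝕜 := ℝ) (E := G)
    (LinearMap.trace ℝ (E x) ∘ₗ LinearMap.mulLeft ℝ (K x : Module.End ℝ (E x)) ∘ₗ
      differenceForm D D' x)

theorem traceForm_apply (K : ∀ y, E y →L[ℝ] E y) (D D' : CovariantDerivative I F E) (x : M)
    (v : TangentSpace I x) : traceForm K D D' x v
      = LinearMap.trace ℝ (E x) ((K x : E x →ₗ[ℝ] E x) ∘ₗ differenceForm D D' x v) :=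
  rfl

variable [IsManifold I 1 M]

theorem coeff_traceForm {K : ∀ y, E y →L[ℝ] E y} {D D' : CovariantDerivative I F E} {p : M} {z : G}
    (hb : (extChartAt I p).symm z ∈ e.baseSet) (w : G) :
    coeff (traceForm K D D') p w z = traceCLM F (localRepHom e K ((extChartAt I p).symm z)
      * (connectionForm e D' p z w - connectionForm e D p z w)) := by
  rw [coeff, traceForm_apply]
  refine trace_eq_traceCLM hb _ _ fun f ↦ ?_
  have hs : DiffAt I F (constSection e (e.continuousLinearMapAt ℝ _ f)) ((extChartAt I p).symm z) :=
    diffAt_constSection hb _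
  have hdiff := differenceForm_apply (D := D) (D' := D') hs (coordField I p _ w)
  rw [constSection, e.symmL_continuousLinearMapAt hb] at hdiff
  rw [LinearMap.comp_apply, hdiff, mul_apply_eq_comp, sub_apply,
    connectionForm_eq_cov_constSection hb hs, connectionForm_eq_cov_constSection hb hs, ← map_sub,
    localRepHom_continuousLinearMapAt hb]
  rfl

end TraceForm

/-! ### Transgression of traces of curvatures -/

section Transgression

variable {M : Type*} [TopologicalSpace M] [ChartedSpace (EuclideanHalfSpace 2) M]
  [IsManifold (𝓡∂ 2) ∞ M]
  {F : Type*} [NormedAddCommGroup F] [NormedSpace ℝ F] [FiniteDimensional ℝ F]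
  {E : M → Type*} [TopologicalSpace (TotalSpace F E)] [∀ x, AddCommGroup (E x)]
  [∀ x, Module ℝ (E x)] [∀ x, TopologicalSpace (E x)] [∀ x, IsTopologicalAddGroup (E x)]
  [∀ x, ContinuousSMul ℝ (E x)] [FiberBundle F E] [VectorBundle ℝ F E]
  [ContMDiffVectorBundle ∞ F E (𝓡∂ 2)]
  {e : Trivialization F (π F E)} [MemTrivializationAtlas e]
  {D D' : CovariantDerivative (𝓡∂ 2) F E} {K : ∀ y, E y →L[ℝ] E y}

theorem fderivWithin_coeff_traceForm {p : M} {z : ℝ²} (hz : z ∈ (extChartAt (𝓡∂ 2) p).target)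
    (hb : (extChartAt (𝓡∂ 2) p).symm z ∈ e.baseSet) (w : ℝ²) :
    fderivWithin ℝ (coeff (traceForm K D D') p w) ℍ z
      = fderivWithin ℝ (fun z ↦ traceCLM F (localRepHom e K ((extChartAt (𝓡∂ 2) p).symm z)
        * (connectionForm e D' p z w - connectionForm e D p z w))) ℍ z := by
  refine Filter.EventuallyEq.fderivWithin_eq_of_mem ?_ (extChartAt_target_subset_range p hz)
  filter_upwards [eventually_mem_target_and_symm hz (e.open_baseSet.mem_nhds hb)] with y hy
  exact coeff_traceForm hy.2 w

variable [T2Space M]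

theorem contDiffWithinAt_coeff_traceForm
    (hD : CovariantDerivative.ContMDiffCovariantDerivative D ∞)
    (hD' : CovariantDerivative.ContMDiffCovariantDerivative D' ∞)
    (hK : ∀ x, SmoothAt (E := fun y ↦ E y →L[ℝ] E y) (𝓡∂ 2) (F →L[ℝ] F) K x) {p : M} {z : ℝ²}
    (hz : z ∈ (extChartAt (𝓡∂ 2) p).target) (w : ℝ²) :
    ContDiffWithinAt ℝ ∞ (coeff (traceForm K D D') p w) ℍ z := by
  set e := trivializationAt F E ((extChartAt (𝓡∂ 2) p).symm z)
  have hb : (extChartAt (𝓡∂ 2) p).symm z ∈ e.baseSet :=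
    FiberBundle.mem_baseSet_trivializationAt F E _
  have hΓ {D : CovariantDerivative (𝓡∂ 2) F E}
      (hD : CovariantDerivative.ContMDiffCovariantDerivative D ∞) :
      ContDiffWithinAt ℝ ∞ (fun z ↦ connectionForm e D p z w) ℍ z :=
    (contDiffWithinAt_connectionForm hD hz hb).clm_apply contDiffWithinAt_const
  refine ((traceCLM F).contDiff.contDiffAt.comp_contDiffWithinAt z
    ((contDiffWithinAt_localRepHom hz hb (hK _)).mul
      ((hΓ hD').sub (hΓ hD)))).congr_of_eventuallyEq_of_mem ?_
    (extChartAt_target_subset_range p hz)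
  filter_upwards [eventually_mem_target_and_symm hz (e.open_baseSet.mem_nhds hb)] with y hy
  exact coeff_traceForm hy.2 w

theorem trace_comp_curvature (hD : CovariantDerivative.ContMDiffCovariantDerivative D ∞) {p : M}
    {z : ℝ²} (hz : z ∈ (extChartAt (𝓡∂ 2) p).target)
    (hb : (extChartAt (𝓡∂ 2) p).symm z ∈ e.baseSet) (u v : ℝ²) :
    LinearMap.trace ℝ _ ((K ((extChartAt (𝓡∂ 2) p).symm z) :
        E ((extChartAt (𝓡∂ 2) p).symm z) →ₗ[ℝ] E ((extChartAt (𝓡∂ 2) p).symm z))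
        ∘ₗ curvature D hD _ (coordField (𝓡∂ 2) p _ u) (coordField (𝓡∂ 2) p _ v))
      = traceCLM F (localRepHom e K ((extChartAt (𝓡∂ 2) p).symm z)
        * curvatureForm ℍ (connectionForm e D p) z u v) := by
  refine trace_eq_traceCLM hb _ _ fun f ↦ ?_
  have hz' := symm_mem_chart_source hz
  rw [LinearMap.comp_apply, ContinuousLinearMap.coe_coe, ← localRepHom_continuousLinearMapAt hb,
    mul_apply_eq_comp, localRep_curvature hD hz hb, chartCoords_coordField hz',
    chartCoords_coordField hz']

theorem isExteriorDerivative_traceForm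
    (hD : CovariantDerivative.ContMDiffCovariantDerivative D ∞)
    (hD' : CovariantDerivative.ContMDiffCovariantDerivative D' ∞)
    (hK : ∀ x, SmoothAt (E := fun y ↦ E y →L[ℝ] E y) (𝓡∂ 2) (F →L[ℝ] F) K x)
    (hDK : IsParallel D K) (hDK' : IsParallel D' K) :
    IsExteriorDerivative (traceForm K D D') fun x u v ↦
      LinearMap.trace ℝ (E x) ((K x : E x →ₗ[ℝ] E x) ∘ₗ curvature D' hD' x u v)
        - LinearMap.trace ℝ (E x) ((K x : E x →ₗ[ℝ] E x) ∘ₗ curvature D hD x u v) := by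
  refine ⟨fun p w z hz ↦ ((contDiffWithinAt_coeff_traceForm hD hD' hK hz w).mono
    (extChartAt_target_subset_range p)).of_le (by simp), fun p z hz u v ↦ ?_⟩
  have hb := FiberBundle.mem_baseSet_trivializationAt F E ((extChartAt (𝓡∂ 2) p).symm z)
  rw [trace_comp_curvature hD hz hb, trace_comp_curvature hD' hz hb,
    fderivWithin_coeff_traceForm hz hb, fderivWithin_coeff_traceForm hz hb]
  exact traceCLM_mul_curvatureForm_sub
    ((𝓡∂ 2).uniqueDiffOn z (extChartAt_target_subset_range p hz))
    ((contDiffWithinAt_connectionForm hD hz hb).differentiableWithinAt (by simp))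
    ((contDiffWithinAt_connectionForm hD' hz hb).differentiableWithinAt (by simp))
    ((contDiffWithinAt_localRepHom hz hb (hK _)).differentiableWithinAt (by simp))
    (fderivWithin_localRepHom hDK hz hb (hK _)) (fderivWithin_localRepHom hDK' hz hb (hK _)) u v

theorem hasContinuousDensity_trace_comp_curvature
    (hD : CovariantDerivative.ContMDiffCovariantDerivative D ∞)
    (hK : ∀ x, SmoothAt (E := fun y ↦ E y →L[ℝ] E y) (𝓡∂ 2) (F →L[ℝ] F) K x) :
    HasContinuousDensity fun x u v ↦
      LinearMap.trace ℝ (E x) ((K x : E x →ₗ[ℝ] E x) ∘ₗ curvature D hD x u v) := by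
  intro p z hz
  set e := trivializationAt F E ((extChartAt (𝓡∂ 2) p).symm z)
  have hb : (extChartAt (𝓡∂ 2) p).symm z ∈ e.baseSet :=
    FiberBundle.mem_baseSet_trivializationAt F E _
  have hzℍ := extChartAt_target_subset_range p hz
  have hcurv := continuousWithinAt_curvatureForm (𝓡∂ 2).uniqueDiffOn hzℍ
    ((contDiffWithinAt_connectionForm hD hz hb).of_le (by simp)) (stdVec 0) (stdVec 1)
  refine (((traceCLM F).continuous.continuousAt.comp_continuousWithinAt
    ((contDiffWithinAt_localRepHom hz hb (hK _)).continuousWithinAt.mul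
      hcurv)).congr_of_eventuallyEq_of_mem ?_ hzℍ).mono (extChartAt_target_subset_range p)
  filter_upwards [eventually_mem_target_and_symm hz (e.open_baseSet.mem_nhds hb)] with y hy
  exact trace_comp_curvature hD hy.1 hy.2 _ _

end Transgression

/-! ### Parallel sections along the boundary -/

section LinearODE

variable {F : Type*} [NormedAddCommGroup F] [NormedSpace ℝ F]

/-- Adjoining the time as a variable reduces this to the autonomous case. -/
theorem exists_eventually_hasDerivAt_of_contDiffAt [CompleteSpace F] {v : ℝ → F → F} {t₀ : ℝ}
    {f₀ : F} (hv : ContDiffAt ℝ 1 (Function.uncurry v) (t₀, f₀)) :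
    ∃ g : ℝ → F, g t₀ = f₀ ∧ ∀ᶠ t in 𝓝 t₀, HasDerivAt g (v t (g t)) t := by
  obtain ⟨α, hα₀, ε, hε, hα⟩ := ((contDiffAt_const (c := (1 : ℝ))).prodMk
    hv).exists_forall_mem_closedBall_exists_eq_forall_mem_Ioo_hasDerivAt₀ t₀
  have htime (t : ℝ) (ht : t ∈ Ioo (t₀ - ε) (t₀ + ε)) : HasDerivAt (Prod.fst ∘ α) 1 t :=
    hasFDerivAt_fst.comp_hasDerivAt t (hα t ht)
  have ht₀ : t₀ ∈ Ioo (t₀ - ε) (t₀ + ε) := ⟨by linarith, by linarith⟩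
  have htime_eq : EqOn (Prod.fst ∘ α) id (Ioo (t₀ - ε) (t₀ + ε)) :=
    isOpen_Ioo.eqOn_of_deriv_eq isPreconnected_Ioo
      (fun t ht ↦ (htime t ht).differentiableAt.differentiableWithinAt) differentiableOn_id
      (fun t ht ↦ by rw [(htime t ht).deriv, deriv_id]) ht₀ (by simp [hα₀])
  refine ⟨Prod.snd ∘ α, by rw [Function.comp_apply, hα₀], ?_⟩
  filter_upwards [isOpen_Ioo.mem_nhds ht₀] with t ht
  have hderiv := hasFDerivAt_snd.comp_hasDerivAt t (hα t ht)
  have ht_eq : (α t).1 = t := htime_eq ht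
  simpa only [ContinuousLinearMap.coe_snd', Function.uncurry_def, Function.comp_apply, ht_eq]
    using hderiv

end LinearODE

section Boundary

variable {M : Type*} [TopologicalSpace M] [ChartedSpace (EuclideanHalfSpace 2) M]

theorem isPreconnected_preimage_inter_boundary [IsManifold (𝓡∂ 2) 1 M] {x : M} {B : Set ℝ²}
    (hconvex : Convex ℝ B) (hB : ∀ z ∈ B, z 0 = 0 → z ∈ (extChartAt (𝓡∂ 2) x).target) :
    IsPreconnected ((extChartAt (𝓡∂ 2) x).source ∩ extChartAt (𝓡∂ 2) x ⁻¹' B ∩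
      (𝓡∂ 2).boundary M) := by
  have himage : (extChartAt (𝓡∂ 2) x).source ∩ extChartAt (𝓡∂ 2) x ⁻¹' B ∩ (𝓡∂ 2).boundary M
      = (extChartAt (𝓡∂ 2) x).symm '' (B ∩ {z | z 0 = 0}) := by
    ext y
    constructor
    · rintro ⟨⟨hy, hyB⟩, hyb⟩
      exact ⟨_, ⟨hyB, (mem_boundary_iff (by rwa [← extChartAt_source (𝓡∂ 2)])).1 hyb⟩,
        (extChartAt (𝓡∂ 2) x).left_inv hy⟩
    · rintro ⟨z, ⟨hz, hz0⟩, rfl⟩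
      have ht := hB z hz hz0
      refine ⟨⟨(extChartAt (𝓡∂ 2) x).map_target ht, ?_⟩,
        (mem_boundary_iff (symm_mem_chart_source ht)).2 ?_⟩
      · rwa [mem_preimage, (extChartAt (𝓡∂ 2) x).right_inv ht]
      · rwa [(extChartAt (𝓡∂ 2) x).right_inv ht]
  have hconvex_inter : Convex ℝ (B ∩ {z | z 0 = 0}) := hconvex.inter
    (convex_hyperplane (EuclideanSpace.proj (𝕜 := ℝ) (0 : Fin 2)).toLinearMap.isLinear 0)
  rw [himage]
  exact hconvex_inter.isPreconnected.image _
    ((continuousOn_extChartAt_symm x).mono fun z hz ↦ hB z hz.1 hz.2)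

theorem exists_isPreconnected_inter_boundary [IsManifold (𝓡∂ 2) 1 M] (x : M)
    {P : M → Prop} (hP : ∀ᶠ y in 𝓝 x, P y) :
    ∃ U : Set M, IsOpen U ∧ x ∈ U ∧ IsPreconnected (U ∩ (𝓡∂ 2).boundary M) ∧ ∀ y ∈ U, P y := by
  set z₀ := extChartAt (𝓡∂ 2) x x
  obtain ⟨r, hr, hball⟩ := Metric.mem_nhdsWithin_iff.1 (eventually_mem_target_and_symm
    (mem_extChartAt_target (I := 𝓡∂ 2) x) (P := P) (by rwa [extChartAt_to_inv x]))
  refine ⟨(extChartAt (𝓡∂ 2) x).source ∩ extChartAt (𝓡∂ 2) x ⁻¹' Metric.ball z₀ r,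
    isOpen_extChartAt_preimage' x Metric.isOpen_ball,
    ⟨mem_extChartAt_source x, Metric.mem_ball_self hr⟩,
    isPreconnected_preimage_inter_boundary (convex_ball z₀ r)
      fun z hz hz0 ↦ (hball ⟨hz, mem_halfPlane.2 hz0.ge⟩).1, fun y hy ↦ ?_⟩
  have hPy := (hball ⟨hy.2,
    extChartAt_target_subset_range x ((extChartAt (𝓡∂ 2) x).map_source hy.1)⟩).2
  rwa [(extChartAt (𝓡∂ 2) x).left_inv hy.1] at hPy

variable {F : Type*} [NormedAddCommGroup F] [NormedSpace ℝ F]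
  {E : M → Type*} [TopologicalSpace (TotalSpace F E)] [∀ x, AddCommGroup (E x)]
  [∀ x, Module ℝ (E x)] [∀ x, TopologicalSpace (E x)] [FiberBundle F E] [VectorBundle ℝ F E]
  (e : Trivialization F (π F E)) [MemTrivializationAtlas e]

/-- The section whose representative in the trivialization `e` is the function `g` of the coordinate
of index `1` in the chart at `p`. Along the boundary this is the only nonconstant coordinate. -/
def sectionOfCoord (p : M) (g : ℝ → F) (y : M) : E y :=
  e.symmL ℝ y (g (extChartAt (𝓡∂ 2) p y 1))

variable {e}

theorem localRep_sectionOfCoord_eventuallyEq {p : M} {z : ℝ²}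
    (hz : z ∈ (extChartAt (𝓡∂ 2) p).target) (hb : (extChartAt (𝓡∂ 2) p).symm z ∈ e.baseSet)
    (g : ℝ → F) :
    (fun z ↦ localRep e (sectionOfCoord e p g) ((extChartAt (𝓡∂ 2) p).symm z))
      =ᶠ[𝓝[ℍ] z] fun z ↦ g (z 1) := by
  filter_upwards [eventually_mem_target_and_symm hz (e.open_baseSet.mem_nhds hb)] with y hy
  rw [localRep, sectionOfCoord, e.continuousLinearMapAt_symmL hy.2,
    (extChartAt (𝓡∂ 2) p).right_inv hy.1]

variable [IsManifold (𝓡∂ 2) 1 M] [ContMDiffVectorBundle 1 F E (𝓡∂ 2)]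

theorem diffAt_sectionOfCoord {p x : M} (hp : x ∈ (chartAt (EuclideanHalfSpace 2) p).source)
    (hb : x ∈ e.baseSet) {g : ℝ → F} (hg : DifferentiableAt ℝ g (extChartAt (𝓡∂ 2) p x 1)) :
    DiffAt (𝓡∂ 2) F (sectionOfCoord e p g) x := by
  rw [diffAt_iff_localRep hb]
  have hcoord : MDifferentiableAt (𝓡∂ 2) 𝓘(ℝ, ℝ) (fun y ↦ extChartAt (𝓡∂ 2) p y 1) x :=
    ((EuclideanSpace.proj (𝕜 := ℝ) (1 : Fin 2)).hasMFDerivAt.comp x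
      (hasMFDerivAt_extChartAt hp)).mdifferentiableAt
  refine (MDifferentiableAt.comp x hg.mdifferentiableAt hcoord).congr_of_eventuallyEq ?_
  filter_upwards [e.open_baseSet.mem_nhds hb] with y hy using e.continuousLinearMapAt_symmL hy _

variable [FiniteDimensional ℝ F] [∀ x, IsTopologicalAddGroup (E x)] [∀ x, ContinuousSMul ℝ (E x)]
  {D : CovariantDerivative (𝓡∂ 2) F E}

theorem cov_sectionOfCoord_eq_zero {p : M} {z : ℝ²}
    (hz : z ∈ (extChartAt (𝓡∂ 2) p).target) (hb : (extChartAt (𝓡∂ 2) p).symm z ∈ e.baseSet)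
    (hz0 : z 0 = 0) {g : ℝ → F}
    (hg : HasDerivAt g (-connectionForm e D p z (stdVec 1) (g (z 1))) (z 1))
    {v : TangentSpace (𝓡∂ 2) ((extChartAt (𝓡∂ 2) p).symm z)} (hv : v ∈ boundaryTangentSpace _) :
    D (sectionOfCoord e p g) ((extChartAt (𝓡∂ 2) p).symm z) v = 0 := by
  have hsrc := symm_mem_chart_source hz
  have hright := (extChartAt (𝓡∂ 2) p).right_inv hz
  have hzℍ := extChartAt_target_subset_range p hz
  have hdiff := diffAt_sectionOfCoord hsrc hb (g := g) (by
    rw [hright]; exact hg.differentiableAt)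
  set w := chartCoords (𝓡∂ 2) p _ v
  have hw0 : w 0 = 0 :=
    (mem_boundaryTangentSpace_iff hsrc ((mem_boundary_iff hsrc).2 (by rwa [hright]))).1 hv
  have hw_eq : w = w 1 • stdVec 1 := by simpa [hw0] using eq_sum_stdVec w
  have hlocal := localRep_sectionOfCoord_eventuallyEq hz hb g
  have hderiv : HasFDerivAt (fun z : ℝ² ↦ g (z 1)) _ z :=
    hg.hasFDerivAt.comp z (EuclideanSpace.proj (𝕜 := ℝ) (1 : Fin 2)).hasFDerivAt
  have hcov := localRep_cov (D := D) hz hb hdiff w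
  rw [hlocal.fderivWithin_eq_of_mem hzℍ,
    hderiv.hasFDerivWithinAt.fderivWithin ((𝓡∂ 2).uniqueDiffOn z hzℍ),
    hlocal.eq_of_nhdsWithin hzℍ, coordField_chartCoords hsrc, hw_eq] at hcov
  have hzero : e.continuousLinearMapAt ℝ _ (D (sectionOfCoord e p g) _ v) = 0 :=
    hcov.trans (by simp)
  have hsymm := congrArg (e.symmL ℝ ((extChartAt (𝓡∂ 2) p).symm z)) hzero
  rwa [e.symmL_continuousLinearMapAt hb, map_zero] at hsymm

variable [T2Space M] [IsManifold (𝓡∂ 2) ∞ M] [ContMDiffVectorBundle ∞ F E (𝓡∂ 2)]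

theorem exists_hasDerivAt_connectionForm
    (hD : CovariantDerivative.ContMDiffCovariantDerivative D ∞) {p : M} {t₀ : ℝ}
    (hz : planeEquiv (0, t₀) ∈ (extChartAt (𝓡∂ 2) p).target)
    (hb : (extChartAt (𝓡∂ 2) p).symm (planeEquiv (0, t₀)) ∈ e.baseSet) (f : F) :
    ∃ g : ℝ → F, g t₀ = f ∧ ∀ᶠ t in 𝓝 t₀,
      HasDerivAt g (-connectionForm e D p (planeEquiv (0, t)) (stdVec 1) (g t)) t := by
  have : CompleteSpace F := FiniteDimensional.complete ℝ F
  have hline : ContDiff ℝ ∞ fun t : ℝ ↦ planeEquiv (0, t) :=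
    planeEquiv.contDiff.comp (contDiff_const.prodMk contDiff_id)
  have hΓ : ContDiffAt ℝ ∞ (connectionForm e D p ∘ fun t : ℝ ↦ planeEquiv (0, t)) t₀ :=
    ContDiffWithinAt.comp (s := univ) t₀ (contDiffWithinAt_connectionForm hD hz hb)
      hline.contDiffWithinAt fun t _ ↦ planeEquiv_mem_halfPlane.2 le_rfl
  refine exists_eventually_hasDerivAt_of_contDiffAt
    (v := fun t f ↦ -connectionForm e D p (planeEquiv (0, t)) (stdVec 1) f) ?_
  exact ContDiffAt.of_le (n := ∞) (((hΓ.comp (t₀, f) contDiffAt_fst).clm_apply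
    contDiffAt_const).clm_apply contDiffAt_snd).neg (by simp)

theorem exists_parallel_section
    (hD : CovariantDerivative.ContMDiffCovariantDerivative D ∞) {x : M}
    (hx : x ∈ (𝓡∂ 2).boundary M) (f : E x) :
    ∃ U : Set M, IsOpen U ∧ x ∈ U ∧ IsPreconnected (U ∩ (𝓡∂ 2).boundary M) ∧
      ∃ s : ∀ y, E y, s x = f ∧ ∀ y ∈ U ∩ (𝓡∂ 2).boundary M,
        DiffAt (𝓡∂ 2) F s y ∧ ∀ v ∈ boundaryTangentSpace y, D s y v = 0 := by
  set e := trivializationAt F E x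
  have hb : x ∈ e.baseSet := FiberBundle.mem_baseSet_trivializationAt F E x
  have hline {z : ℝ²} (hz : z 0 = 0) : planeEquiv (0, z 1) = z := by
    ext i; fin_cases i <;> simp [hz]
  have hx_line := hline ((mem_boundary_iff (mem_chart_source _ x)).1 hx)
  obtain ⟨g, hgx, hg⟩ := exists_hasDerivAt_connectionForm (e := e) hD (p := x)
    (t₀ := extChartAt (𝓡∂ 2) x x 1) (by rw [hx_line]; exact mem_extChartAt_target x)
    (by rwa [hx_line, extChartAt_to_inv]) (e.continuousLinearMapAt ℝ x f)
  have hcoord : ContinuousAt (fun y ↦ extChartAt (𝓡∂ 2) x y 1) x :=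
    (EuclideanSpace.proj (𝕜 := ℝ) (1 : Fin 2)).continuous.continuousAt.comp
      (continuousAt_extChartAt x)
  obtain ⟨U, hU, hxU, hconn, hgood⟩ := exists_isPreconnected_inter_boundary x
    ((hcoord.eventually hg).and ((e.open_baseSet.eventually_mem hb).and
      (extChartAt_source_mem_nhds (I := 𝓡∂ 2) x)))
  refine ⟨U, hU, hxU, hconn, sectionOfCoord e x g, ?_, ?_⟩
  · rw [sectionOfCoord, hgx, e.symmL_continuousLinearMapAt hb]
  · rintro y ⟨hyU, hyb⟩
    obtain ⟨hgy, hby, hy⟩ := hgood y hyU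
    obtain ⟨z, hz, rfl⟩ : ∃ z ∈ (extChartAt (𝓡∂ 2) x).target, (extChartAt (𝓡∂ 2) x).symm z = y :=
      ⟨_, (extChartAt (𝓡∂ 2) x).map_source hy, (extChartAt (𝓡∂ 2) x).left_inv hy⟩
    have hsrc := symm_mem_chart_source hz
    refine ⟨diffAt_sectionOfCoord hsrc hby hgy.differentiableAt, fun v hv ↦ ?_⟩
    rw [mem_boundary_iff hsrc, (extChartAt (𝓡∂ 2) x).right_inv hz] at hyb
    rw [(extChartAt (𝓡∂ 2) x).right_inv hz, hline hyb] at hgy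
    exact cov_sectionOfCoord_eq_zero hz hby hyb hgy hv

end Boundary

/-! ### Orthogonal connections along the boundary -/

theorem finiteDimensional_fiber {B : Type*} [TopologicalSpace B] (F : Type*)
    [NormedAddCommGroup F] [NormedSpace ℝ F] [FiniteDimensional ℝ F] {E : B → Type*}
    [TopologicalSpace (TotalSpace F E)] [∀ x, AddCommGroup (E x)] [∀ x, Module ℝ (E x)]
    [∀ x, TopologicalSpace (E x)] [FiberBundle F E] [VectorBundle ℝ F E] (x : B) :
    FiniteDimensional ℝ (E x) :=
  ((trivializationAt F E x).continuousLinearEquivAt ℝ x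
    (FiberBundle.mem_baseSet_trivializationAt F E x)).symm.toLinearEquiv.finiteDimensional

section BundlePair

variable {M : Type*} [TopologicalSpace M] [ChartedSpace (EuclideanHalfSpace 2) M]
  {F : Type*} [NormedAddCommGroup F] [NormedSpace ℝ F]
  {E : M → Type*} [TopologicalSpace (TotalSpace F E)] [∀ x, AddCommGroup (E x)]
  [∀ x, Module ℝ (E x)] [∀ x, TopologicalSpace (E x)] [FiberBundle F E] [VectorBundle ℝ F E]
  {Ω : SymplecticStructure F E}

/-- The symplectic form on the fibre at `x`, as a bilinear map. -/
def SymplecticStructure.formAt (Ω : SymplecticStructure F E) (x : M) : E x →ₗ[ℝ] E x →ₗ[ℝ] ℝ :=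
  ContinuousLinearMap.coeLM ℝ ∘ₗ (Ω.form x).toLinearMap

theorem SymplecticStructure.smoothAt_form (Ω : SymplecticStructure F E) {s t : ∀ y, E y} {x : M}
    (hs : SmoothAt (𝓡∂ 2) F s x) (ht : SmoothAt (𝓡∂ 2) F t x) :
    ContMDiffAt (𝓡∂ 2) 𝓘(ℝ, ℝ) ∞ (fun y ↦ Ω.form y (s y) (t y)) x := by
  have h : SmoothAt (E := Bundle.Trivial M ℝ) (𝓡∂ 2) ℝ (fun y ↦ Ω.form y (s y) (t y)) x :=
    ContMDiffAt.clm_bundle_apply₂ (F₁ := F) (F₂ := F) (Ω.contMDiff_form x) hs ht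
  exact (contMDiffAt_totalSpace.1 h).2

theorem SymplecticStructure.mdifferentiableAt_form [ContMDiffVectorBundle 1 F E (𝓡∂ 2)]
    (Ω : SymplecticStructure F E) {s t : ∀ y, E y} {x : M} (hs : DiffAt (𝓡∂ 2) F s x)
    (ht : DiffAt (𝓡∂ 2) F t x) :
    MDifferentiableAt (𝓡∂ 2) 𝓘(ℝ, ℝ) (fun y ↦ Ω.form y (s y) (t y)) x := by
  have h : DiffAt (E := Bundle.Trivial M ℝ) (𝓡∂ 2) ℝ (fun y ↦ Ω.form y (s y) (t y)) x :=
    MDifferentiableAt.clm_bundle_apply₂ (F₁ := F) (F₂ := F)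
      ((Ω.contMDiff_form x).mdifferentiableAt (by simp)) hs ht
  exact ((mdifferentiableAt_totalSpace _ _).1 h).2

theorem LagrangianSubbundle.isLagrangian_fiber (L : LagrangianSubbundle Ω)
    (x : (𝓡∂ 2).boundary M) : IsLagrangian (Ω.formAt x) (L.fiber x) :=
  L.lagrangian x

/-- Along the boundary and near `x`, the section `s` takes values in the Lagrangian subbundle. -/
def LagrangianSubbundle.ContainsNear (L : LagrangianSubbundle Ω) (s : ∀ y, E y) (x : M) : Prop :=
  ∀ᶠ y in 𝓝 x, ∀ hy : y ∈ (𝓡∂ 2).boundary M, s y ∈ L.fiber ⟨y, hy⟩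

theorem LagrangianSubbundle.exists_section_eq (L : LagrangianSubbundle Ω) {x : M}
    (hx : x ∈ (𝓡∂ 2).boundary M) {f : E x} (hf : f ∈ L.fiber ⟨x, hx⟩) :
    ∃ s : ∀ y, E y, s x = f ∧ SmoothNear (𝓡∂ 2) F s x ∧ L.ContainsNear s x := by
  obtain ⟨U, hU, k, s, hs, hsU⟩ := L.exists_frame ⟨x, hx⟩
  rw [← (hsU ⟨x, hx⟩ (mem_of_mem_nhds hU)).2, Submodule.mem_span_range_iff_exists_fun] at hf
  obtain ⟨c, hc⟩ := hf
  refine ⟨fun y ↦ ∑ i, c i • s i y, hc, .of_contMDiffOn hU ?_, ?_⟩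
  · exact ContMDiffOn.sum_section fun i _ ↦ (hs i).const_smul_section
  · filter_upwards [hU] with y hy hyb
    rw [← (hsU ⟨y, hyb⟩ hy).2]
    exact Submodule.sum_mem _ fun i _ ↦
      Submodule.smul_mem _ _ (Submodule.subset_span (mem_range_self i))

theorem exists_section_eq [ContMDiffVectorBundle 1 F E (𝓡∂ 2)] {x : M} (f : E x) :
    ∃ s : ∀ y, E y, s x = f ∧ DiffAt (𝓡∂ 2) F s x := by
  have hx := FiberBundle.mem_baseSet_trivializationAt F E x
  exact ⟨constSection (trivializationAt F E x) _,
    (trivializationAt F E x).symmL_continuousLinearMapAt hx f, diffAt_constSection hx _⟩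

variable [∀ x, IsTopologicalAddGroup (E x)] [∀ x, ContinuousSMul ℝ (E x)]

theorem CompatibleComplexStructure.smoothAt_J (J : CompatibleComplexStructure Ω) (x : M) :
    SmoothAt (E := fun y ↦ E y →L[ℝ] E y) (𝓡∂ 2) (F →L[ℝ] F) J.J x :=
  J.contMDiff_J x

theorem CompatibleComplexStructure.isCompatible (J : CompatibleComplexStructure Ω) (x : M) :
    IsCompatible (Ω.formAt x) (J.J x : E x →ₗ[ℝ] E x) :=
  ⟨Ω.self_eq_zero x, J.sq_eq_neg x, J.form_map x, J.form_pos x⟩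

theorem LagrangianSubbundle.exists_isParsevalFrame [FiniteDimensional ℝ F]
    (L : LagrangianSubbundle Ω) (J : CompatibleComplexStructure Ω) (x : (𝓡∂ 2).boundary M) :
    ∃ (k : ℕ) (e : Fin k → E x), (∀ i, e i ∈ L.fiber x) ∧
      IsParsevalFrame (Ω.formAt x) (J.J x : E x →ₗ[ℝ] E x) e :=
  have := finiteDimensional_fiber F (E := E) x
  ⟨_, (J.isCompatible x).exists_isParsevalFrame (L.isLagrangian_fiber x)⟩

variable [ContMDiffVectorBundle ∞ F E (𝓡∂ 2)]
  {L : LagrangianSubbundle Ω}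
  {J J' : CompatibleComplexStructure Ω} {D D' : CovariantDerivative (𝓡∂ 2) F E}

/-- The connection maps sections of the Lagrangian subbundle to sections of the Lagrangian subbundle
in the directions tangent to the boundary. This is the infinitesimal version of
`ParallelTransportPreserves`. -/
def LagrangianSubbundle.IsPreservedBy (L : LagrangianSubbundle Ω)
    (D : CovariantDerivative (𝓡∂ 2) F E) : Prop :=
  ∀ (x : M) (hx : x ∈ (𝓡∂ 2).boundary M) (s : ∀ y, E y), DiffAt (𝓡∂ 2) F s x →
    L.ContainsNear s x → ∀ v ∈ boundaryTangentSpace x, D s x v ∈ L.fiber ⟨x, hx⟩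

/-- The imaginary part of the identity for the Hermitian inner product. -/
theorem IsUnitaryAlongBoundary.mvfderiv_form (h : IsUnitaryAlongBoundary J D) {x : M}
    (hx : x ∈ (𝓡∂ 2).boundary M) {s t : ∀ y, E y} (hs : DiffAt (𝓡∂ 2) F s x)
    (ht : DiffAt (𝓡∂ 2) F t x) {v : TangentSpace (𝓡∂ 2) x} (hv : v ∈ boundaryTangentSpace x) :
    mvfderiv (𝓡∂ 2) (fun y ↦ Ω.form y (s y) (t y)) x v
      = Ω.form x (D s x v) (t x) + Ω.form x (s x) (D t x v) := by
  have hhermitian : MDifferentiableAt (𝓡∂ 2) 𝓘(ℝ, ℂ) (fun y ↦ J.hermitian y (s y) (t y)) x :=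
    (Complex.ofRealCLM.mdifferentiableAt.comp x
      (Ω.mdifferentiableAt_form hs (DiffAt.apply (J.smoothAt_J x) ht))).add
      ((Complex.I • Complex.ofRealCLM).mdifferentiableAt.comp x (Ω.mdifferentiableAt_form hs ht))
  have him : (Complex.imCLM ∘ fun y ↦ J.hermitian y (s y) (t y))
      = fun y ↦ Ω.form y (s y) (t y) := by
    ext y
    simp [CompatibleComplexStructure.hermitian]
  have hderiv := Complex.imCLM.hasMFDerivAt.comp x hhermitian.hasMFDerivAt
  rw [him] at hderiv
  have hderiv_v : mvfderiv (𝓡∂ 2) (fun y ↦ Ω.form y (s y) (t y)) x v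
      = (mvfderiv (𝓡∂ 2) (fun y ↦ J.hermitian y (s y) (t y)) x v).im :=
    DFunLike.congr_fun hderiv.mfderiv v
  rw [hderiv_v, h x hx s t hs ht v hv]
  simp [CompatibleComplexStructure.hermitian]

variable [FiniteDimensional ℝ F]

theorem IsUnitaryAlongBoundary.form_differenceForm (h : IsUnitaryAlongBoundary J D)
    (h' : IsUnitaryAlongBoundary J' D') {x : M} (hx : x ∈ (𝓡∂ 2).boundary M)
    {v : TangentSpace (𝓡∂ 2) x} (hv : v ∈ boundaryTangentSpace x) (f g : E x) :
    Ω.form x (differenceForm D D' x v f) g + Ω.form x f (differenceForm D D' x v g) = 0 := by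
  obtain ⟨s, rfl, hs⟩ := exists_section_eq (F := F) f
  obtain ⟨t, rfl, ht⟩ := exists_section_eq (F := F) g
  rw [differenceForm_apply hs, differenceForm_apply ht]
  simp only [map_sub, sub_apply]
  linarith [h.mvfderiv_form hx hs ht hv, h'.mvfderiv_form hx hs ht hv]

theorem differenceForm_comp_J (h : IsComplexLinear J D) (h' : IsComplexLinear J D') (x : M)
    (v : TangentSpace (𝓡∂ 2) x) (f : E x) :
    differenceForm D D' x v (J.J x f) = J.J x (differenceForm D D' x v f) := by
  obtain ⟨s, rfl, hs⟩ := exists_section_eq (F := F) f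
  rw [differenceForm_apply hs, map_sub, ← h s x hs, ← h' s x hs]
  exact differenceForm_apply (DiffAt.apply (J.smoothAt_J x) hs) v

theorem LagrangianSubbundle.IsPreservedBy.differenceForm_mem (h : L.IsPreservedBy D)
    (h' : L.IsPreservedBy D') {x : M} (hx : x ∈ (𝓡∂ 2).boundary M) {v : TangentSpace (𝓡∂ 2) x}
    (hv : v ∈ boundaryTangentSpace x) {f : E x} (hf : f ∈ L.fiber ⟨x, hx⟩) :
    differenceForm D D' x v f ∈ L.fiber ⟨x, hx⟩ := by
  obtain ⟨s, rfl, hs, hsL⟩ := L.exists_section_eq hx hf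
  rw [differenceForm_apply hs.diffAt]
  exact Submodule.sub_mem _ (h' x hx s hs.diffAt hsL v hv) (h x hx s hs.diffAt hsL v hv)

theorem traceForm_id_eq_zero (L : LagrangianSubbundle Ω) (h : IsUnitaryAlongBoundary J D)
    (h' : IsUnitaryAlongBoundary J' D') {x : M} (hx : x ∈ (𝓡∂ 2).boundary M)
    {v : TangentSpace (𝓡∂ 2) x} (hv : v ∈ boundaryTangentSpace x) :
    traceForm (fun y ↦ ContinuousLinearMap.id ℝ (E y)) D D' x v = 0 := by
  have := finiteDimensional_fiber F (E := E) x
  obtain ⟨k, e, -, he⟩ := L.exists_isParsevalFrame J ⟨x, hx⟩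
  exact he.trace_eq_zero_of_skew (J.isCompatible x) (h.form_differenceForm h' hx hv)

theorem traceForm_J_eq_zero (h : IsComplexLinear J D) (h' : IsComplexLinear J D')
    (hL : L.IsPreservedBy D) (hL' : L.IsPreservedBy D') {x : M} (hx : x ∈ (𝓡∂ 2).boundary M)
    {v : TangentSpace (𝓡∂ 2) x} (hv : v ∈ boundaryTangentSpace x) :
    traceForm J.J D D' x v = 0 := by
  have := finiteDimensional_fiber F (E := E) x
  obtain ⟨k, e, heL, he⟩ := L.exists_isParsevalFrame J ⟨x, hx⟩
  exact he.trace_comp_eq_zero (J.isCompatible x) (L.isLagrangian_fiber ⟨x, hx⟩) heL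
    (differenceForm_comp_J h h' x v) fun f hf ↦ hL.differenceForm_mem hL' hx hv hf

/-- The symplectic product of `∇s` with a parallel section of `L` is the derivative of a function
that vanishes on the boundary. -/
theorem OrthogonalConnection.isPreservedBy [T2Space M] [IsManifold (𝓡∂ 2) ∞ M]
    (N : OrthogonalConnection L J) :
    L.IsPreservedBy N.D := by
  intro x hx s hs hsL v hv
  rw [L.lagrangian]
  intro f hf
  obtain ⟨U, hU, hxU, hconn, σ, rfl, hσ⟩ := exists_parallel_section N.smooth hx f
  have hσL : ∀ y (hy : y ∈ (𝓡∂ 2).boundary M), y ∈ U → σ y ∈ L.fiber ⟨y, hy⟩ := fun y hy hyU ↦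
    N.orthogonal U hU hconn σ hσ ⟨x, hx⟩ ⟨y, hy⟩ hxU hyU hf
  obtain ⟨hσx, hσ0⟩ := hσ x ⟨hxU, hx⟩
  have hderiv_eq_zero : mvfderiv (𝓡∂ 2) (fun y ↦ Ω.form y (s y) (σ y)) x v = 0 := by
    refine mvfderiv_eq_zero_of_boundary hx (Ω.mdifferentiableAt_form hs hσx) ?_ hv
    filter_upwards [hsL, hU.mem_nhds hxU] with y hy hyU hyb
    exact (L.lagrangian ⟨y, hyb⟩ _).1 (hy hyb) _ (hσL y hyb hyU)
  have hleibniz := N.unitary.mvfderiv_form hx hs hσx hv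
  rwa [hderiv_eq_zero, hσ0 v hv, map_zero, add_zero, eq_comm] at hleibniz

end BundlePair

/-! ### Fields of endomorphisms -/

section EndomorphismFields

variable {G H : Type*} [NormedAddCommGroup G] [NormedSpace ℝ G] [TopologicalSpace H]
  {I : ModelWithCorners ℝ G H} {M : Type*} [TopologicalSpace M] [ChartedSpace H M]
  {F : Type*} [NormedAddCommGroup F] [NormedSpace ℝ F]
  {E : M → Type*} [TopologicalSpace (TotalSpace F E)] [∀ x, AddCommGroup (E x)]
  [∀ x, Module ℝ (E x)] [∀ x, TopologicalSpace (E x)] [FiberBundle F E] [VectorBundle ℝ F E]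
  {Φ : ∀ y, E y →L[ℝ] E y} {x : M}

theorem localRepHom_eq_conj {e : Trivialization F (π F E)} [MemTrivializationAtlas e]
    (hx : x ∈ e.baseSet) (Φ : ∀ y, E y →L[ℝ] E y) :
    localRepHom e Φ x = (e.continuousLinearEquivAt ℝ x hx : E x →L[ℝ] F) ∘L Φ x ∘L
      ((e.continuousLinearEquivAt ℝ x hx).symm : F →L[ℝ] E x) := by
  ext f
  simp [localRepHom, e.coe_continuousLinearEquivAt_eq hx, e.symm_continuousLinearEquivAt_eq hx]

theorem localRepHom_inverse {e : Trivialization F (π F E)} [MemTrivializationAtlas e]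
    (hx : x ∈ e.baseSet) (Φ : ∀ y, E y →L[ℝ] E y) :
    localRepHom e (fun y ↦ (Φ y).inverse) x = (localRepHom e Φ x).inverse := by
  rw [localRepHom_eq_conj hx, localRepHom_eq_conj hx, ContinuousLinearMap.inverse_equiv_comp,
    ContinuousLinearMap.inverse_comp_equiv, ContinuousLinearEquiv.symm_symm,
    ContinuousLinearMap.comp_assoc]

variable [∀ x, IsTopologicalAddGroup (E x)] [∀ x, ContinuousSMul ℝ (E x)]

theorem smoothAt_iff_localRepHom :
    SmoothAt (E := fun y ↦ E y →L[ℝ] E y) I (F →L[ℝ] F) Φ x ↔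
      ContMDiffAt I 𝓘(ℝ, F →L[ℝ] F) ∞ (localRepHom (trivializationAt F E x) Φ) x :=
  (contMDiffAt_hom_bundle _).trans (and_iff_right contMDiffAt_id)

theorem SmoothAt.inverse [CompleteSpace F]
    (hΦ : SmoothAt (E := fun y ↦ E y →L[ℝ] E y) I (F →L[ℝ] F) Φ x) (hx : (Φ x).IsInvertible) :
    SmoothAt (E := fun y ↦ E y →L[ℝ] E y) I (F →L[ℝ] F) (fun y ↦ (Φ y).inverse) x := by
  have hxe := FiberBundle.mem_baseSet_trivializationAt F E x
  set e := trivializationAt F E x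
  have hinv : (localRepHom e Φ x).IsInvertible := by
    rw [localRepHom_eq_conj hxe]
    exact ContinuousLinearMap.isInvertible_equiv.comp
      (hx.comp ContinuousLinearMap.isInvertible_equiv)
  rw [smoothAt_iff_localRepHom] at hΦ ⊢
  refine (hinv.contDiffAt_map_inverse.contMDiffAt.comp x hΦ).congr_of_eventuallyEq ?_
  filter_upwards [e.open_baseSet.mem_nhds hxe] with y hy using localRepHom_inverse hy Φ

theorem smoothAt_id [FiniteDimensional ℝ F] [ContMDiffVectorBundle ∞ F E I] :
    SmoothAt (E := fun y ↦ E y →L[ℝ] E y) I (F →L[ℝ] F)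
      (fun y ↦ ContinuousLinearMap.id ℝ (E y)) x :=
  smoothAt_hom_of_apply fun f ↦ smoothAt_constSection
    (FiberBundle.mem_baseSet_trivializationAt F E x) f

end EndomorphismFields

section FiniteRank

variable {B : Type*} [TopologicalSpace B]
  {F : Type*} [NormedAddCommGroup F] [NormedSpace ℝ F] [FiniteDimensional ℝ F]

theorem eventually_forall_bilin_pos {b : B → F →L[ℝ] F →L[ℝ] ℝ} {x : B} (hb : ContinuousAt b x)
    (hpos : ∀ f, f ≠ 0 → 0 < b x f f) : ∀ᶠ y in 𝓝 x, ∀ f, f ≠ 0 → 0 < b y f f := by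
  have hsphere : ∀ᶠ y in 𝓝 x, ∀ f ∈ Metric.sphere (0 : F) 1, 0 < b y f f := by
    refine (isCompact_sphere (0 : F) 1).eventually_forall_of_forall_eventually fun f hf ↦ ?_
    have hcont : ContinuousAt (fun q : B × F ↦ b q.1 q.2 q.2) (x, f) :=
      ((ContinuousAt.comp (f := Prod.fst) hb continuousAt_fst).clm_apply
        continuousAt_snd).clm_apply continuousAt_snd
    exact hcont.eventually (lt_mem_nhds (hpos f (ne_zero_of_mem_unit_sphere ⟨f, hf⟩)))
  filter_upwards [hsphere] with y hy f hf
  have hscale := hy (‖f‖⁻¹ • f) (by simp [norm_smul, hf])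
  rw [map_smul, map_smul, smul_apply, smul_eq_mul, smul_eq_mul] at hscale
  have hinv : 0 < ‖f‖⁻¹ := inv_pos.2 (norm_pos_iff.2 hf)
  exact (mul_pos_iff_of_pos_left hinv).1 ((mul_pos_iff_of_pos_left hinv).1 hscale)

variable {E : B → Type*} [TopologicalSpace (TotalSpace F E)] [∀ x, AddCommGroup (E x)]
  [∀ x, Module ℝ (E x)] [∀ x, TopologicalSpace (E x)] [FiberBundle F E] [VectorBundle ℝ F E]
  {e : Trivialization F (π F E)} [MemTrivializationAtlas e] {x : B}

theorem eventually_forall_form_pos {b : ∀ y, E y →ₗ[ℝ] E y →ₗ[ℝ] ℝ} (hx : x ∈ e.baseSet)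
    (hb : ∀ f g, ContinuousAt (fun y ↦ b y (constSection e f y) (constSection e g y)) x)
    (hpos : ∀ u, u ≠ 0 → 0 < b x u u) : ∀ᶠ y in 𝓝 x, ∀ u, u ≠ 0 → 0 < b y u u := by
  let c (y : B) : F →L[ℝ] F →L[ℝ] ℝ := ((b y).compl₁₂ (e.symmL ℝ y : F →ₗ[ℝ] E y)
    (e.symmL ℝ y : F →ₗ[ℝ] E y)).toContinuousBilinearMap
  have hc : ContinuousAt c x := continuousAt_clm_apply.2 fun f ↦ continuousAt_clm_apply.2 (hb f)
  have hcpos : ∀ f, f ≠ 0 → 0 < c x f f := fun f hf ↦ hpos _ fun h ↦ hf <| by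
    rw [← e.continuousLinearMapAt_symmL (R := ℝ) hx f]
    exact (congrArg _ h).trans (map_zero _)
  filter_upwards [e.open_baseSet.mem_nhds hx, eventually_forall_bilin_pos hc hcpos]
    with y hy hypos u hu
  have hsymm : e.symmL ℝ y (e.continuousLinearMapAt ℝ y u) = u :=
    e.symmL_continuousLinearMapAt hy u
  have hu' := hypos (e.continuousLinearMapAt ℝ y u) fun h ↦ hu (by rw [← hsymm, h, map_zero])
  change 0 < b y (e.symmL ℝ y _) (e.symmL ℝ y _) at hu'
  rwa [hsymm] at hu'

theorem isInvertible_of_forall_eq_zero (hx : x ∈ e.baseSet) {A : E x →L[ℝ] E x}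
    (hA : ∀ v, A v = 0 → v = 0) : A.IsInvertible := by
  let ε := e.continuousLinearEquivAt ℝ x hx
  have hinj : Function.Injective ((ε : E x →L[ℝ] F) ∘L A ∘L (ε.symm : F →L[ℝ] E x)) :=
    (injective_iff_map_eq_zero _).2 fun f hf ↦
      (map_eq_zero_iff _ ε.symm.injective).1 (hA _ ((map_eq_zero_iff _ ε.injective).1 hf))
  rw [← ContinuousLinearMap.isInvertible_equiv_comp (e := ε),
    ← ContinuousLinearMap.isInvertible_comp_equiv (e := ε.symm)]
  exact ⟨(LinearEquiv.ofInjectiveEndo _ hinj).toContinuousLinearEquiv, rfl⟩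

end FiniteRank

/-! ### Intertwiners of two complex structures -/

section Intertwiner

variable {M : Type*} [TopologicalSpace M] [ChartedSpace (EuclideanHalfSpace 2) M]
  {F : Type*} [NormedAddCommGroup F] [NormedSpace ℝ F]
  {E : M → Type*} [TopologicalSpace (TotalSpace F E)] [∀ x, AddCommGroup (E x)]
  [∀ x, Module ℝ (E x)] [∀ x, TopologicalSpace (E x)] [∀ x, IsTopologicalAddGroup (E x)]
  [∀ x, ContinuousSMul ℝ (E x)] [FiberBundle F E] [VectorBundle ℝ F E]
  {Ω : SymplecticStructure F E}

/-- A complex linear map `(E x, J) → (E x, J')` that preserves the Lagrangian subspace over boundary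
points. The positivity condition makes it injective, is open and convex, and therefore allows local
intertwiners to be glued by a partition of unity. -/
structure IsPositiveIntertwiner (L : LagrangianSubbundle Ω) (J J' : CompatibleComplexStructure Ω)
    (x : M) (A : E x →L[ℝ] E x) : Prop where
  map_J : ∀ v, A (J.J x v) = J'.J x (A v)
  form_pos : ∀ v, v ≠ 0 → 0 < Ω.form x (A v) (J.J x v + J'.J x v)
  map_mem : ∀ hx : x ∈ (𝓡∂ 2).boundary M, ∀ v ∈ L.fiber ⟨x, hx⟩, A v ∈ L.fiber ⟨x, hx⟩

/-- The field of complex linear maps `(E, J) → (E, J')` given by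
`u ↦ ∑ (g_J(u, sᵢ) sᵢ - ω(u, sᵢ) J' sᵢ)`. If `J = J'` and the `sᵢ` form a Hermitian Parseval frame,
then it is the identity. -/
def frameIntertwiner (J J' : CompatibleComplexStructure Ω) {k : ℕ} (s : Fin k → ∀ y, E y) (y : M) :
    E y →L[ℝ] E y :=
  ∑ i, ((Ω.form y (s i y)).smulRight (J'.J y (s i y)) -
    (Ω.form y (J.J y (s i y))).smulRight (s i y))

variable {L : LagrangianSubbundle Ω} {J J' : CompatibleComplexStructure Ω} {x : M}
  {k : ℕ} {s : Fin k → ∀ y, E y}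

theorem frameIntertwiner_apply (u : E x) : frameIntertwiner J J' s x u =
    ∑ i, (Ω.form x (s i x) u • J'.J x (s i x) - Ω.form x (J.J x (s i x)) u • s i x) := by
  simp [frameIntertwiner]

theorem frameIntertwiner_map_J (u : E x) :
    frameIntertwiner J J' s x (J.J x u) = J'.J x (frameIntertwiner J J' s x u) := by
  have hform (v : E x) : Ω.form x v (J.J x u) = -Ω.form x (J.J x v) u := by
    rw [← J.form_map x v, J.sq_eq_neg, map_neg]
  simp only [frameIntertwiner_apply, map_sum, map_sub, map_smul, J'.sq_eq_neg, J.form_map, hform]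
  refine Finset.sum_congr rfl fun i _ ↦ ?_
  module

theorem frameIntertwiner_mem (hx : x ∈ (𝓡∂ 2).boundary M) (hs : ∀ i, s i x ∈ L.fiber ⟨x, hx⟩)
    {u : E x} (hu : u ∈ L.fiber ⟨x, hx⟩) : frameIntertwiner J J' s x u ∈ L.fiber ⟨x, hx⟩ := by
  rw [frameIntertwiner_apply]
  refine Submodule.sum_mem _ fun i _ ↦ ?_
  rw [(L.lagrangian ⟨x, hx⟩ _).1 (hs i) u hu, zero_smul, zero_sub]
  exact Submodule.neg_mem _ (Submodule.smul_mem _ _ (hs i))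

theorem IsParsevalFrame.form_frameIntertwiner_pos
    (hs : IsParsevalFrame (Ω.formAt x) (J'.J x : E x →ₗ[ℝ] E x) fun i ↦ s i x) {u : E x}
    (hu : u ≠ 0) : 0 < Ω.form x (frameIntertwiner J J' s x u) (J.J x u + J'.J x u) := by
  rw [frameIntertwiner_apply]
  exact hs.form_add_pos (J.isCompatible x) (J'.isCompatible x) hu

theorem IsPositiveIntertwiner.isInvertible [FiniteDimensional ℝ F] {A : E x →L[ℝ] E x}
    (h : IsPositiveIntertwiner L J J' x A) : A.IsInvertible := by
  refine isInvertible_of_forall_eq_zero (FiberBundle.mem_baseSet_trivializationAt F E x)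
    fun v hv ↦ ?_
  by_contra hv0
  simpa [hv] using h.form_pos v hv0

theorem convex_setOf_isPositiveIntertwiner (L : LagrangianSubbundle Ω)
    (J J' : CompatibleComplexStructure Ω) (x : M) :
    Convex ℝ {A | IsPositiveIntertwiner L J J' x A} := by
  refine convex_iff_forall_pos.2 fun A hA B hB a b ha hb _ ↦ ⟨fun v ↦ ?_, fun v hv ↦ ?_, ?_⟩
  · simp [hA.map_J, hB.map_J]
  · rw [add_apply, smul_apply, smul_apply, (Ω.form x).map_add, (Ω.form x).map_smul,
      (Ω.form x).map_smul, add_apply, smul_apply, smul_apply]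
    exact add_pos (smul_pos ha (hA.form_pos v hv)) (smul_pos hb (hB.form_pos v hv))
  · exact fun hx v hv ↦ Submodule.add_mem _ (Submodule.smul_mem _ _ (hA.map_mem hx v hv))
      (Submodule.smul_mem _ _ (hB.map_mem hx v hv))

variable [FiniteDimensional ℝ F] [ContMDiffVectorBundle ∞ F E (𝓡∂ 2)]

theorem smoothAt_frameIntertwiner (hs : ∀ i, SmoothAt (𝓡∂ 2) F (s i) x) :
    SmoothAt (E := fun y ↦ E y →L[ℝ] E y) (𝓡∂ 2) (F →L[ℝ] F) (frameIntertwiner J J' s) x := by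
  refine smoothAt_hom_of_apply fun f ↦ ?_
  simp only [frameIntertwiner_apply]
  have hf := smoothAt_constSection (I := 𝓡∂ 2) (FiberBundle.mem_baseSet_trivializationAt F E x) f
  refine ContMDiffAt.sum_section fun i _ ↦ ContMDiffAt.sub_section
    (ContMDiffAt.smul_section (Ω.smoothAt_form (hs i) hf) ((J'.smoothAt_J x).apply (hs i)))
    (ContMDiffAt.smul_section (Ω.smoothAt_form ((J.smoothAt_J x).apply (hs i)) hf) (hs i))

theorem eventually_forall_form_add_pos {A : ∀ y, E y →L[ℝ] E y}
    (hA : SmoothAt (E := fun y ↦ E y →L[ℝ] E y) (𝓡∂ 2) (F →L[ℝ] F) A x)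
    (hpos : ∀ v, v ≠ 0 → 0 < Ω.form x (A x v) (J.J x v + J'.J x v)) :
    ∀ᶠ y in 𝓝 x, ∀ v, v ≠ 0 → 0 < Ω.form y (A y v) (J.J y v + J'.J y v) := by
  have hx := FiberBundle.mem_baseSet_trivializationAt F E x
  refine eventually_forall_form_pos hx (b := fun y ↦ (Ω.formAt y).compl₁₂
    (A y : E y →ₗ[ℝ] E y) (J.J y + J'.J y : E y →L[ℝ] E y)) (fun f g ↦ ?_) hpos
  have hf := smoothAt_constSection (I := 𝓡∂ 2) hx f
  have hg := smoothAt_constSection (I := 𝓡∂ 2) hx g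
  exact (Ω.smoothAt_form (hA.apply hf) (ContMDiffAt.add_section ((J.smoothAt_J x).apply hg)
    ((J'.smoothAt_J x).apply hg))).continuousAt

theorem exists_positiveIntertwiner_near_boundary (L : LagrangianSubbundle Ω)
    (J J' : CompatibleComplexStructure Ω) (hx : x ∈ (𝓡∂ 2).boundary M) :
    ∃ A, SmoothNear (E := fun y ↦ E y →L[ℝ] E y) (𝓡∂ 2) (F →L[ℝ] F) A x ∧
      ∀ᶠ y in 𝓝 x, IsPositiveIntertwiner L J J' y (A y) := by
  obtain ⟨k, e, heL, he⟩ := L.exists_isParsevalFrame J' ⟨x, hx⟩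
  choose s hse hs hsL using fun i ↦ L.exists_section_eq hx (heL i)
  obtain rfl : (fun i ↦ s i x) = e := funext hse
  have hsmooth : SmoothNear (E := fun y ↦ E y →L[ℝ] E y) (𝓡∂ 2) (F →L[ℝ] F)
      (frameIntertwiner J J' s) x :=
    (Filter.eventually_all.2 hs).mono fun y ↦ smoothAt_frameIntertwiner
  refine ⟨frameIntertwiner J J' s, hsmooth, ?_⟩
  filter_upwards [Filter.eventually_all.2 hsL, eventually_forall_form_add_pos hsmooth.smoothAt
    fun v hv ↦ he.form_frameIntertwiner_pos hv] with y hyL hypos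
  exact ⟨frameIntertwiner_map_J, hypos,
    fun hy v ↦ frameIntertwiner_mem hy fun i ↦ hyL i hy⟩

theorem exists_positiveIntertwiner_near_interior [IsManifold (𝓡∂ 2) ∞ M]
    (L : LagrangianSubbundle Ω) (J J' : CompatibleComplexStructure Ω)
    (hx : x ∉ (𝓡∂ 2).boundary M) :
    ∃ A, SmoothNear (E := fun y ↦ E y →L[ℝ] E y) (𝓡∂ 2) (F →L[ℝ] F) A x ∧
      ∀ᶠ y in 𝓝 x, IsPositiveIntertwiner L J J' y (A y) := by
  have hclosed : IsClosed ((𝓡∂ 2).boundary M) :=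
    ModelWithCorners.isClosed_boundary (I := 𝓡∂ 2) (n := ∞) (by simp)
  refine ⟨fun y ↦ .id ℝ (E y) - J'.J y ∘L J.J y, .of_forall fun y ↦ ?_, ?_⟩
  · refine smoothAt_hom_of_apply fun f ↦ ?_
    have hf := smoothAt_constSection (I := 𝓡∂ 2) (FiberBundle.mem_baseSet_trivializationAt F E y) f
    exact ContMDiffAt.sub_section hf ((J'.smoothAt_J y).apply ((J.smoothAt_J y).apply hf))
  · filter_upwards [hclosed.isOpen_compl.mem_nhds hx] with y hy
    refine ⟨fun v ↦ ?_, fun v ↦ (J.isCompatible y).form_sub_pos (J'.isCompatible y),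
      fun hy' ↦ absurd hy' hy⟩
    simp [J.sq_eq_neg, J'.sq_eq_neg, add_comm]

theorem exists_smooth_positiveIntertwiner [T2Space M] [SigmaCompactSpace M]
    [IsManifold (𝓡∂ 2) ∞ M] (L : LagrangianSubbundle Ω) (J J' : CompatibleComplexStructure Ω) :
    ∃ A, (∀ x, SmoothAt (E := fun y ↦ E y →L[ℝ] E y) (𝓡∂ 2) (F →L[ℝ] F) A x) ∧
      ∀ x, IsPositiveIntertwiner L J J' x (A x) := by
  have hlocal (x : M) : ∃ A, SmoothNear (E := fun y ↦ E y →L[ℝ] E y) (𝓡∂ 2) (F →L[ℝ] F) A x ∧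
      ∀ᶠ y in 𝓝 x, IsPositiveIntertwiner L J J' y (A y) := by
    by_cases hx : x ∈ (𝓡∂ 2).boundary M
    · exact exists_positiveIntertwiner_near_boundary L J J' hx
    · exact exists_positiveIntertwiner_near_interior L J J' hx
  obtain ⟨A, hA⟩ := exists_contMDiffSection_forall_mem_convex_of_local (n := ⊤)
    (F_fiber := F →L[ℝ] F) (𝓡∂ 2) (fun y ↦ E y →L[ℝ] E y) _
    (convex_setOf_isPositiveIntertwiner L J J') fun x ↦ by
      obtain ⟨A, hA, hApos⟩ := hlocal x
      obtain ⟨U, hU, hAU⟩ := hA.exists_contMDiffOn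
      exact ⟨_, Filter.inter_mem hU hApos, A, hAU.mono inter_subset_left, fun y hy ↦ hy.2⟩
  exact ⟨A, fun x ↦ A.contMDiff x, hA⟩

end Intertwiner

/-! ### Conjugation of connections -/

section Conjugation

theorem inverse_mem_of_forall_mem {V : Type*} [AddCommGroup V] [Module ℝ V] [TopologicalSpace V]
    {A : V →L[ℝ] V} (hA : A.IsInvertible) {S : Submodule ℝ V} [FiniteDimensional ℝ S]
    (hS : ∀ v ∈ S, A v ∈ S) {v : V} (hv : v ∈ S) : A.inverse v ∈ S := by
  have hinj : Function.Injective ((A : V →ₗ[ℝ] V).restrict hS) :=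
    fun a b hab ↦ Subtype.ext (hA.injective (congrArg Subtype.val hab))
  obtain ⟨w, hw⟩ := LinearMap.injective_iff_surjective.1 hinj ⟨v, hv⟩
  have hw' : A w = v := congrArg Subtype.val hw
  rw [← hw', hA.inverse_apply_self]
  exact w.2

variable {G H : Type*} [NormedAddCommGroup G] [NormedSpace ℝ G] [TopologicalSpace H]
  {I : ModelWithCorners ℝ G H} {M : Type*} [TopologicalSpace M] [ChartedSpace H M]
  {F : Type*} [NormedAddCommGroup F] [NormedSpace ℝ F]
  {E : M → Type*} [TopologicalSpace (TotalSpace F E)] [∀ x, AddCommGroup (E x)]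
  [∀ x, Module ℝ (E x)] [∀ x, TopologicalSpace (E x)] [∀ x, IsTopologicalAddGroup (E x)]
  [∀ x, ContinuousSMul ℝ (E x)] [FiberBundle F E] [VectorBundle ℝ F E]
  [ContMDiffVectorBundle ∞ F E I]
  {D : CovariantDerivative I F E} {Φ : ∀ y, E y →L[ℝ] E y}
  (hΦ : ∀ x, SmoothAt (E := fun y ↦ E y →L[ℝ] E y) I (F →L[ℝ] F) Φ x)
  (hinv : ∀ x, (Φ x).IsInvertible)

/-- The connection `Φ⁻¹ ∘ D ∘ Φ`. -/
def conjugate (D : CovariantDerivative I F E)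
    (hΦ : ∀ x, SmoothAt (E := fun y ↦ E y →L[ℝ] E y) I (F →L[ℝ] F) Φ x)
    (hinv : ∀ x, (Φ x).IsInvertible) : CovariantDerivative I F E where
  toFun s x := (Φ x).inverse ∘L D (fun y ↦ Φ y (s y)) x
  isCovariantDerivativeOnUniv :=
    { add := by
        intro s t x hs ht _
        have h : (fun y ↦ Φ y ((s + t) y)) = (fun y ↦ Φ y (s y)) + fun y ↦ Φ y (t y) :=
          funext fun y ↦ map_add (Φ y) (s y) (t y)
        rw [h, D.isCovariantDerivativeOnUniv.add (DiffAt.apply (hΦ x) hs) (DiffAt.apply (hΦ x) ht),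
          ContinuousLinearMap.comp_add]
      leibniz := by
        intro s g x hs hg _
        have h : (fun y ↦ Φ y ((g • s) y)) = g • fun y ↦ Φ y (s y) :=
          funext fun y ↦ map_smul (Φ y) (g y) (s y)
        rw [h, D.isCovariantDerivativeOnUniv.leibniz (DiffAt.apply (hΦ x) hs) hg]
        ext v
        simp [(hinv x).inverse_apply_self] }

theorem conjugate_apply (s : ∀ y, E y) (x : M) (v : TangentSpace I x) :
    conjugate D hΦ hinv s x v = (Φ x).inverse (D (fun y ↦ Φ y (s y)) x v) := rfl

theorem IsParallel.conjugate {K K' : ∀ y, E y →L[ℝ] E y} (hD : IsParallel D K')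
    (hK : ∀ x v, Φ x (K x v) = K' x (Φ x v)) : IsParallel (conjugate D hΦ hinv) K := by
  intro s x hs v
  refine (hinv x).injective ?_
  simp only [conjugate_apply, hK, (hinv x).self_apply_inverse]
  exact hD _ x (DiffAt.apply (hΦ x) hs) v

end Conjugation

section CurvatureOfConjugate

variable {M : Type*} [TopologicalSpace M] [ChartedSpace (EuclideanHalfSpace 2) M]
  {F : Type*} [NormedAddCommGroup F] [NormedSpace ℝ F] [FiniteDimensional ℝ F]
  {E : M → Type*} [TopologicalSpace (TotalSpace F E)] [∀ x, AddCommGroup (E x)]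
  [∀ x, Module ℝ (E x)] [∀ x, TopologicalSpace (E x)] [∀ x, IsTopologicalAddGroup (E x)]
  [∀ x, ContinuousSMul ℝ (E x)] [FiberBundle F E] [VectorBundle ℝ F E]
  [ContMDiffVectorBundle ∞ F E (𝓡∂ 2)]
  {D : CovariantDerivative (𝓡∂ 2) F E} {Φ : ∀ y, E y →L[ℝ] E y}
  (hΦ : ∀ x, SmoothAt (E := fun y ↦ E y →L[ℝ] E y) (𝓡∂ 2) (F →L[ℝ] F) Φ x)
  (hinv : ∀ x, (Φ x).IsInvertible)

theorem LagrangianSubbundle.IsPreservedBy.conjugate {Ω : SymplecticStructure F E}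
    {L : LagrangianSubbundle Ω} (h : L.IsPreservedBy D)
    (hL : ∀ x, ∀ hx : x ∈ (𝓡∂ 2).boundary M, ∀ v ∈ L.fiber ⟨x, hx⟩, Φ x v ∈ L.fiber ⟨x, hx⟩) :
    L.IsPreservedBy (conjugate D hΦ hinv) := by
  intro x hx s hs hsL v hv
  have := finiteDimensional_fiber F (E := E) x
  refine inverse_mem_of_forall_mem (hinv x) (hL x hx) (h x hx _ (DiffAt.apply (hΦ x) hs) ?_ v hv)
  filter_upwards [hsL] with y hy hyb using hL y hyb _ (hy hyb)

variable [T2Space M] [IsManifold (𝓡∂ 2) ∞ M]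

theorem contMDiff_conjugate (hD : CovariantDerivative.ContMDiffCovariantDerivative D ∞) :
    CovariantDerivative.ContMDiffCovariantDerivative (conjugate D hΦ hinv) ∞ := by
  have := FiniteDimensional.complete ℝ F
  refine ⟨⟨fun {s} hs x _ ↦ ContMDiffAt.contMDiffWithinAt ?_⟩⟩
  have hs' (y : M) : SmoothAt (𝓡∂ 2) F s y :=
    (hs.contMDiffAt Filter.univ_mem).of_le (by simp)
  have hDs := smoothAt_cov hD (x := x) (.of_forall fun y ↦ (hΦ y).apply (hs' y))
  refine smoothAt_hom_of_apply (E := fun y : M ↦ TangentSpace (𝓡∂ 2) y) (F := ℝ²)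
    (Φ := fun y ↦ conjugate D hΦ hinv s y) fun f ↦ ?_
  exact ((hΦ x).inverse (hinv x)).apply (hDs.apply (smoothAt_constSection
    (FiberBundle.mem_baseSet_trivializationAt ℝ² (TangentSpace (𝓡∂ 2)) x) f))

theorem curvature_conjugate (hD : CovariantDerivative.ContMDiffCovariantDerivative D ∞)
    (hD' : CovariantDerivative.ContMDiffCovariantDerivative (conjugate D hΦ hinv) ∞) (x : M)
    (u v : TangentSpace (𝓡∂ 2) x) (f : E x) :
    curvature (conjugate D hΦ hinv) hD' x u v f
      = (Φ x).inverse (curvature D hD x u v (Φ x f)) := by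
  have hs : SmoothNear (𝓡∂ 2) F (fun y ↦ Φ y (localExtension F f y)) x :=
    SmoothNear.apply (.of_forall hΦ) (smoothNear_localExtension f)
  calc curvature (conjugate D hΦ hinv) hD' x u v f
      = (Φ x).inverse (curvatureAux D (FiberBundle.extend ℝ² u) (FiberBundle.extend ℝ² v)
          (fun y ↦ Φ y (localExtension F f y)) x) := by
        change curvatureAux (conjugate D hΦ hinv) _ _ _ x = _
        simp only [curvatureAux, conjugate_apply, (hinv _).self_apply_inverse, map_sub]
    _ = (Φ x).inverse (curvature D hD x u v (Φ x f)) := by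
        rw [curvatureAux_eq_curvature hD hs (smoothNear_extend u).smoothAt
            (smoothNear_extend v).smoothAt,
          FiberBundle.extend_apply_self, FiberBundle.extend_apply_self, localExtension_self]

theorem trace_comp_curvature_conjugate
    (hD : CovariantDerivative.ContMDiffCovariantDerivative D ∞)
    (hD' : CovariantDerivative.ContMDiffCovariantDerivative (conjugate D hΦ hinv) ∞)
    {K K' : ∀ y, E y →L[ℝ] E y} (hK : ∀ x v, Φ x (K x v) = K' x (Φ x v)) (x : M)
    (u v : TangentSpace (𝓡∂ 2) x) :
    LinearMap.trace ℝ (E x) ((K x : E x →ₗ[ℝ] E x) ∘ₗ curvature (conjugate D hΦ hinv) hD' x u v)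
      = LinearMap.trace ℝ (E x) ((K' x : E x →ₗ[ℝ] E x) ∘ₗ curvature D hD x u v) := by
  let φ : E x ≃ₗ[ℝ] E x := .ofBijective (Φ x : E x →ₗ[ℝ] E x) (hinv x).bijective
  have hintertwine : ((K' x : E x →ₗ[ℝ] E x) ∘ₗ curvature D hD x u v) ∘ₗ φ
      = φ ∘ₗ (K x : E x →ₗ[ℝ] E x) ∘ₗ curvature (conjugate D hΦ hinv) hD' x u v := by
    ext f
    change K' x (curvature D hD x u v (Φ x f)) = Φ x (K x (curvature _ hD' x u v f))
    rw [hK, curvature_conjugate hΦ hinv hD, (hinv x).self_apply_inverse]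
  rw [← LinearMap.trace_conj' _ φ, LinearEquiv.conj_apply, ← hintertwine, LinearMap.comp_assoc,
    LinearEquiv.comp_symm, LinearMap.comp_id]

end CurvatureOfConjugate

/-! ### The transgression form -/

section Transgression

variable {M : Type*} [TopologicalSpace M] [ChartedSpace (EuclideanHalfSpace 2) M]
  [IsManifold (𝓡∂ 2) ∞ M]
  {F : Type*} [NormedAddCommGroup F] [NormedSpace ℝ F] [FiniteDimensional ℝ F]
  {E : M → Type*} [TopologicalSpace (TotalSpace F E)] [∀ x, AddCommGroup (E x)]
  [∀ x, Module ℝ (E x)] [∀ x, TopologicalSpace (E x)] [∀ x, IsTopologicalAddGroup (E x)]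
  [∀ x, ContinuousSMul ℝ (E x)] [FiberBundle F E] [VectorBundle ℝ F E]
  [ContMDiffVectorBundle ∞ F E (𝓡∂ 2)]
  {Ω : SymplecticStructure F E} {L : LagrangianSubbundle Ω} {J J' : CompatibleComplexStructure Ω}

/-- The one-form `(tr (∇' - ∇) - i tr (J (Φ⁻¹ ∇' Φ - ∇))) / 2`, where `Φ` intertwines `J` and the
complex structure `J'` of `∇'`. It plays the part of the complex trace of `∇' - ∇`, which is not
complex linear. The real part is not conjugated because `Φ⁻¹ ∇' Φ` need not be unitary along the
boundary. -/
def transgressionForm (J : CompatibleComplexStructure Ω) (D D' : CovariantDerivative (𝓡∂ 2) F E)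
    {Φ : ∀ y, E y →L[ℝ] E y}
    (hΦ : ∀ x, SmoothAt (E := fun y ↦ E y →L[ℝ] E y) (𝓡∂ 2) (F →L[ℝ] F) Φ x)
    (hinv : ∀ x, (Φ x).IsInvertible) (x : M) : TangentSpace (𝓡∂ 2) x →L[ℝ] ℂ :=
  ((1 / 2 : ℂ) • Complex.ofRealCLM) ∘L traceForm (fun y ↦ .id ℝ (E y)) D D' x
    + ((-Complex.I / 2) • Complex.ofRealCLM) ∘L traceForm J.J D (conjugate D' hΦ hinv) x

variable [T2Space M]

theorem hasContinuousDensity_complexTrace (N : OrthogonalConnection L J) :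
    HasContinuousDensity fun x u v ↦
      complexTrace (J.J x : E x →ₗ[ℝ] E x) (curvature N.D N.smooth x u v) := by
  intro p
  have htrace := hasContinuousDensity_trace_comp_curvature N.smooth (fun x ↦ smoothAt_id) p
  have htrace_J := hasContinuousDensity_trace_comp_curvature N.smooth J.smoothAt_J p
  exact ((Complex.continuous_ofReal.comp_continuousOn htrace).sub (continuousOn_const.mul
    (Complex.continuous_ofReal.comp_continuousOn htrace_J))).div_const _

variable {Φ : ∀ y, E y →L[ℝ] E y}
  (hΦ : ∀ x, SmoothAt (E := fun y ↦ E y →L[ℝ] E y) (𝓡∂ 2) (F →L[ℝ] F) Φ x)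
  (hinv : ∀ x, (Φ x).IsInvertible) (N : OrthogonalConnection L J) (N' : OrthogonalConnection L J')

theorem isExteriorDerivative_transgressionForm
    (hJ : ∀ x v, Φ x (J.J x v) = J'.J x (Φ x v)) :
    IsExteriorDerivative (transgressionForm J N.D N'.D hΦ hinv) fun x u v ↦
      complexTrace (J'.J x : E x →ₗ[ℝ] E x) (curvature N'.D N'.smooth x u v)
        - complexTrace (J.J x : E x →ₗ[ℝ] E x) (curvature N.D N.smooth x u v) := by
  have hreal := isExteriorDerivative_traceForm N.smooth N'.smooth (fun x ↦ smoothAt_id)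
    (fun _ _ _ _ ↦ rfl) fun _ _ _ _ ↦ rfl
  have himag := isExteriorDerivative_traceForm N.smooth (contMDiff_conjugate hΦ hinv N'.smooth)
    J.smoothAt_J N.complexLinear (IsParallel.conjugate hΦ hinv N'.complexLinear hJ)
  have hsum : IsExteriorDerivative (transgressionForm J N.D N'.D hΦ hinv) _ :=
    (hreal.clm_comp ((1 / 2 : ℂ) • Complex.ofRealCLM)).add
      (himag.clm_comp ((-Complex.I / 2) • Complex.ofRealCLM))
  convert hsum using 4 with x u v
  rw [trace_comp_curvature_conjugate hΦ hinv N'.smooth _ hJ]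
  simp only [complexTrace, ContinuousLinearMap.coe_id, LinearMap.id_comp, one_div, smul_apply,
    Complex.ofRealCLM_apply, Complex.ofReal_sub, smul_eq_mul]
  ring

theorem transgressionForm_eq_zero
    (hJ : ∀ x v, Φ x (J.J x v) = J'.J x (Φ x v))
    (hL : ∀ x, ∀ hx : x ∈ (𝓡∂ 2).boundary M, ∀ v ∈ L.fiber ⟨x, hx⟩, Φ x v ∈ L.fiber ⟨x, hx⟩)
    {x : M} (hx : x ∈ (𝓡∂ 2).boundary M) {v : TangentSpace (𝓡∂ 2) x}
    (hv : v ∈ boundaryTangentSpace x) : transgressionForm J N.D N'.D hΦ hinv x v = 0 := by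
  have hreal := traceForm_id_eq_zero L N.unitary N'.unitary hx hv
  have himag := traceForm_J_eq_zero N.complexLinear
    (IsParallel.conjugate hΦ hinv N'.complexLinear hJ) N.isPreservedBy
    (N'.isPreservedBy.conjugate hΦ hinv hL) hx hv
  simp [transgressionForm, hreal, himag]

theorem exists_isExteriorDerivative_complexTrace_sub [SigmaCompactSpace M]
    (N : OrthogonalConnection L J) (N' : OrthogonalConnection L J') :
    ∃ β : ∀ x : M, TangentSpace (𝓡∂ 2) x →L[ℝ] ℂ,
      IsExteriorDerivative β (fun x u v ↦
        complexTrace (J'.J x : E x →ₗ[ℝ] E x) (curvature N'.D N'.smooth x u v)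
          - complexTrace (J.J x : E x →ₗ[ℝ] E x) (curvature N.D N.smooth x u v)) ∧
      ∀ x ∈ (𝓡∂ 2).boundary M, ∀ v ∈ boundaryTangentSpace x, β x v = 0 := by
  obtain ⟨Φ, hΦ, hΦpos⟩ := exists_smooth_positiveIntertwiner L J J'
  have hinv (x : M) : (Φ x).IsInvertible := (hΦpos x).isInvertible
  have hJ (x : M) := (hΦpos x).map_J
  exact ⟨transgressionForm J N.D N'.D hΦ hinv,
    isExteriorDerivative_transgressionForm hΦ hinv N N' hJ,
    fun x hx v ↦ transgressionForm_eq_zero hΦ hinv N N' hJ (fun x ↦ (hΦpos x).map_mem) hx⟩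

end Transgression

end ChernWeilMaslov

end

theorem mainTheorem6
    {M : Type*} [TopologicalSpace M] [T2Space M] [CompactSpace M]
    [ChartedSpace (EuclideanHalfSpace 2) M] [IsManifold (𝓡∂ 2) ∞ M]
    (hM : ChernWeilMaslov.IsOriented M)
    {F : Type*} [NormedAddCommGroup F] [NormedSpace ℝ F] [FiniteDimensional ℝ F]
    {E : M → Type*} [TopologicalSpace (TotalSpace F E)] [∀ x, AddCommGroup (E x)]
    [∀ x, Module ℝ (E x)] [∀ x, TopologicalSpace (E x)] [∀ x, IsTopologicalAddGroup (E x)]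
    [∀ x, ContinuousSMul ℝ (E x)] [FiberBundle F E] [VectorBundle ℝ F E]
    [ContMDiffVectorBundle ∞ F E (𝓡∂ 2)]
    (Ω : ChernWeilMaslov.SymplecticStructure F E) (L : ChernWeilMaslov.LagrangianSubbundle Ω)
    (J₀ J₁ : ChernWeilMaslov.CompatibleComplexStructure Ω)
    (N₀ : ChernWeilMaslov.OrthogonalConnection L J₀)
    (N₁ : ChernWeilMaslov.OrthogonalConnection L J₁) :
    ChernWeilMaslov.chernWeilMaslovIndex N₀ = ChernWeilMaslov.chernWeilMaslovIndex N₁ := by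
  obtain ⟨β, hβ, hβ_boundary⟩ := ChernWeilMaslov.exists_isExteriorDerivative_complexTrace_sub N₀ N₁
  have hzero := ChernWeilMaslov.surfaceIntegral_eq_zero hM hβ hβ_boundary
  rw [ChernWeilMaslov.surfaceIntegral_sub (ChernWeilMaslov.hasContinuousDensity_complexTrace N₁)
    (ChernWeilMaslov.hasContinuousDensity_complexTrace N₀), sub_eq_zero] at hzero
  rw [ChernWeilMaslov.chernWeilMaslovIndex, ChernWeilMaslov.chernWeilMaslovIndex, hzero]
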